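/- Let $S\in\frac12\mathbb N$ (with $0$ allowed), let $\ell,\beta\in\mathbb N$, and let $\alpha$ be an integer with $-\beta\le\alpha<\beta$. For $n\in\mathbb N$ consider the sites $\{-\ell+1,\dots,\ell\}$, the edges $E_\ell=\{\{x,x+1\}:-\ell+1\le x\le\ell-1\}$, $E^1_\ell=\{\{x,x+1\}:x=-\ell+1,-\ell+3,\dots,\ell-1\}$, $E_\ell^2=E_\ell\setminus E_\ell^1$, and the discrete times $T_{\beta,n}=\frac1n\mathbb Z\cap[-\beta,\beta]_{\rm per}$, where $[-\beta,\beta]_{\rm per}$ is the circle obtained by identifying $-\beta$ with $\beta$. A configuration $\omega\in\Omega_{\ell,n}$ is a set of double bars $\omega\subset E_\ell\times T_{\beta,n}$ with at most one double bar at any time and none at time $0$. The loops of $\omega$ are the closed trajectories in $\{-\ell+1,\dots,\ell\}\times[-\beta,\beta]_{\rm per}$ that move vertically with unit speed and that, on meeting a double bar at $\{x,x+1\}\times t$, jump to the other site of the edge and reverse their time direction; loops with the same support are identified. $\mathcal L(\omega)$ is the number of loops. A loop is long (a contour) if it visits more than two sites. Let $\mathbb P_{\beta,\ell,n}$ be the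 probability on $\Omega_{\ell,n}$ for which $\omega$ has probability proportional to $(\frac1n)^{|\omega|}(2S+1)^{\mathcal L(\omega)-|\omega|}$. Let $\Omega^\alpha_{\ell,n}\subset\Omega_{\ell,n}$ be the set of configurations such that $\{x,x+1\}\times[\alpha,\alpha+1]$ contains at least one double bar for every $\{x,x+1\}\in E^1_\ell$ and none for every $\{x,x+1\}\in E^2_\ell$. The loops of such configurations do not wind around the time circle, so that they have an interior in the sense of Jordan curves. Let $E_x^\circlearrowleft$ be the event that $(x,0)$ belongs to a long loop or to the interior of a long loop. Proposition. For every site $x\in\{-\ell+1,\dots,\ell\}$ the limit below exists, and $$\lim_{n\to\infty}\mathbb P_{\beta,\ell,n}\bigl(E_x^\circlearrowleft\,\big|\,\Omega^\alpha_{\ell,n}\bigr)\le\frac{64}{(2S+1)^{3/2}}+\frac{128}{(2S+1)^2}+\frac1{12}\sum_{k\ge7}\frac{(k+1)4^k}{(2S+1)^{\frac12k-1}},$$ where the right side is $+\infty$ if the series diverges. -/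

import Mathlib

open Filter Topology

noncomputable section

namespace SpinLoops

/-! Space is the chain `{-ℓ+1, …, ℓ}`.  The time axis is the circle `[-β, β]_per`, on which the
times `-β` and `β` are one point, and the discrete times are the multiples of `1/n` on it.
The integer `j` stands for the time `j / n`, and `-β n ≤ j < β n`. -/

/-- The vertices `{-ℓ+1, …, ℓ}` of the chain. -/
def sites (ℓ : ℕ) : Finset ℤ := Finset.Icc (-(ℓ : ℤ) + 1) ℓ

/-- The nearest-neighbour edges; `x` stands for the edge `{x, x+1}`. -/
def edges (ℓ : ℕ) : Finset ℤ := Finset.Icc (-(ℓ : ℤ) + 1) ((ℓ : ℤ) - 1)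

/-- The edges `{x, x+1}` with `x ∈ {-ℓ+1, -ℓ+3, …, ℓ-1}`. -/
def edges₁ (ℓ : ℕ) : Finset ℤ := (edges ℓ).filter (fun x => (2 : ℤ) ∣ x - (-(ℓ : ℤ) + 1))

/-- All the other edges. -/
def edges₂ (ℓ : ℕ) : Finset ℤ := edges ℓ \ edges₁ ℓ

/-- The discrete times. -/
def times (β n : ℕ) : Finset ℤ := Finset.Ico (-((β : ℤ) * n)) ((β : ℤ) * n)

/-- The next discrete time on the circle. -/
def succTime (β n : ℕ) (j : ℤ) : ℤ :=
  if j + 1 = (β : ℤ) * n then -((β : ℤ) * n) else j + 1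

/-- Configurations: sets of double bars `(x, j)`, at the edge `{x, x+1}` and the time `j / n`,
with no double bar at time `0` and at most one double bar at any time. -/
def configs (ℓ β n : ℕ) : Finset (Finset (ℤ × ℤ)) :=
  open scoped Classical in
  (edges ℓ ×ˢ times β n).powerset.filter (fun ω =>
    (∀ b ∈ ω, b.2 ≠ 0) ∧ ∀ b ∈ ω, ∀ c ∈ ω, b.2 = c.2 → b = c)

/-- The discrete times in `[α, α+1]` (on the circle, hence up to multiples of the period). -/
def window (β n : ℕ) (α : ℤ) : Finset ℤ :=
  open scoped Classical in
  (times β n).filter (fun j => ∃ m : ℤ,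
    α * n ≤ j + 2 * (β : ℤ) * n * m ∧ j + 2 * (β : ℤ) * n * m ≤ (α + 1) * n)

/-- The set `Ω^α`: for times in `[α, α+1]` there is at least one double bar at each edge
of `edges₁` and no double bar at the edges of `edges₂`. -/
def configsAt (ℓ β n : ℕ) (α : ℤ) : Finset (Finset (ℤ × ℤ)) :=
  open scoped Classical in
  (configs ℓ β n).filter (fun ω =>
    (∀ x ∈ edges₁ ℓ, ∃ j ∈ window β n α, (x, j) ∈ ω) ∧
    ∀ x ∈ edges₂ ℓ, ∀ j ∈ window β n α, (x, j) ∉ ω)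

/-- The legs: `(x, j)` is the vertical segment above the site `x` between the time `j / n`
and the next discrete time. -/
def legs (ℓ β n : ℕ) : Finset (ℤ × ℤ) := sites ℓ ×ˢ times β n

/-- How the trajectories run through the legs.  At a discrete time without a double bar at `x`
the leg below is continued by the leg above.  At a double bar `{x, x+1} × t` the trajectory jumps
to the other site and reverses its direction: the two legs that end at the bar from below are
joined, and so are the two legs that start at the bar. -/
def legGraph (ℓ β n : ℕ) (ω : Finset (ℤ × ℤ)) : SimpleGraph (ℤ × ℤ) :=
  SimpleGraph.fromRel (fun p q => p ∈ legs ℓ β n ∧ q ∈ legs ℓ β n ∧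
    ((q = (p.1, succTime β n p.2) ∧
        (p.1, succTime β n p.2) ∉ ω ∧ (p.1 - 1, succTime β n p.2) ∉ ω) ∨
      (q = (p.1 + 1, p.2) ∧ ((p.1, p.2) ∈ ω ∨ (p.1, succTime β n p.2) ∈ ω))))

/-- The loops of a configuration, each given by its support, that is, as the set of legs that
it runs through. -/
def loops (ℓ β n : ℕ) (ω : Finset (ℤ × ℤ)) : Finset (Finset (ℤ × ℤ)) :=
  open scoped Classical in
  (legs ℓ β n).image (fun p => (legs ℓ β n).filter (fun q => (legGraph ℓ β n ω).Reachable p q))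

/-- A loop is long if it visits more than two sites. -/
def IsLong (γ : Finset (ℤ × ℤ)) : Prop := 2 < (γ.image Prod.fst).card

/-- The leg `p` lies in the interior of the loop `γ`: it is not on `γ`, and the horizontal ray
that starts in `p` and runs to the left crosses `γ` an odd number of times.  (For a closed curve
without self-intersections that does not wind around the time circle this is the interior in the
sense of Jordan curves; the loops of the configurations in `Ω^α` are such curves.) -/
def IsInside (γ : Finset (ℤ × ℤ)) (p : ℤ × ℤ) : Prop :=
  p ∉ γ ∧ Odd (γ.filter (fun q => q.2 = p.2 ∧ q.1 < p.1)).card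

/-- The event that `(x, 0)` belongs to a long loop or to the interior of a long loop.  There is no
double bar at time `0`, so the position of the point `(x, 0)` is that of the leg above it. -/
def surrounded (ℓ β n : ℕ) (x : ℤ) : Finset (Finset (ℤ × ℤ)) :=
  open scoped Classical in
  (configs ℓ β n).filter (fun ω =>
    ∃ γ ∈ loops ℓ β n ω, IsLong γ ∧ ((x, 0) ∈ γ ∨ IsInside γ (x, 0)))

/-- The weight `(1/n)^|ω| (2S+1)^(𝓛(ω) - |ω|)`, where `𝓛(ω)` is the number of loops. -/
def weight (S : ℝ) (ℓ β n : ℕ) (ω : Finset (ℤ × ℤ)) : ℝ :=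
  (1 / (n : ℝ)) ^ ω.card * (2 * S + 1) ^ (((loops ℓ β n ω).card : ℤ) - (ω.card : ℤ))

/-- The partition function. -/
def partitionFunction (S : ℝ) (ℓ β n : ℕ) : ℝ := ∑ ω ∈ configs ℓ β n, weight S ℓ β n ω

/-- The probability of an event `A` (a subset of `configs ℓ β n`). -/
def prob (S : ℝ) (ℓ β n : ℕ) (A : Finset (Finset (ℤ × ℤ))) : ℝ :=
  ∑ ω ∈ A, weight S ℓ β n ω / partitionFunction S ℓ β n

/-- The conditional probability of `A` given `B`. -/
def condProb (S : ℝ) (ℓ β n : ℕ) (A B : Finset (Finset (ℤ × ℤ))) : ℝ :=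
  open scoped Classical in
  prob S ℓ β n (A ∩ B) / prob S ℓ β n B

end SpinLoops

end

/-! A Peierls argument, in which the loops of a random configuration of double bars play the part of
contours.

Put `θ = 2S + 1` and `M = 2βn`. With times counted from the start of the window `[α, α + 1]` and
sites counted from the left end of the chain, a configuration is a function `c : Bars M`, which
assigns to each time in `ZMod M` at most one edge (`ofBars`, `sum_weight_eq`). A loop is a class of
legs `(a, j)`, the leg being the piece of the column `a` between the times `j` and `j + 1`. A leg
lies inside a loop when an odd number of legs of the loop are to its left.

*Gain.* Let the walk along a long loop make `2h` turns. Push every site inside the loop one step to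
the left, and insert any double bars in the room that this vacates outside the window, one edge at
each time for every second leg of the loop. The vacated room falls apart into loops, one for each
double bar that closes it from above; these are the `h` double bars at which the loop turned from
below, and the inserted ones. Only the original loop is lost (`loopCount_add_le_shift`). Finally
remove the double bars of the original loop outside the window; this does not decrease the power of
`θ`, since the removal of a double bar removes at most one loop. The new configuration
(`replaceLoop`) thus has gained a factor `θ ^ (h - 1)`, apart from the powers of `1/n` of the double
bars removed and inserted (`circleWeight_replaceLoop`). The old configuration and the inserted double
bars can be recovered from the new configuration, the old double bars of the window and the walk
along the loop (`replaceLoop_injective`).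

*Entropy.* Summing over the inserted double bars produces a factor close to `exp (d / n)` at each
time outside the window at which the loop has `2 d` legs. This pays for a decay `exp (-1 / (2n))`
along every leg of the loop (`exp_le_decay_mul_insertions`), and with this decay, and the weight `1/n`
for a new double bar, a turn costs `∫ exp (-t / 2) dt = 2`. The walks with a given sequence of `2h`
turns to the left and to the right thus have total weight at most `4 ^ h` (`sum_pathWeight_le`).

*Counting.* If a long loop passes through or surrounds `(x, 0)`, then it has a leg `(x - d, 0)` with
`d ≥ 0`, and when `d > 0` the walk that starts there gets beyond `x`. This restricts the sequences of
turns (`Surrounded.exists_turnSeq`), and the sum over `d` of their numbers is the sum over all closed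
sequences of their largest displacement, or `1` (`sum_card_reachingSeqs_le`). The double bars of the
window pair the columns, which forces `h ≥ 3` (`six_le_length_turnSeq`). For `h = 3` there are `27`
sequences, and `27 · 4³ / θ²` is at most the two explicit terms of the bound plus the term `k = 7` of
the series; for `h ≥ 4` the contribution is at most the term `k = 2h` (`sum_contour_le`).

*Limit.* The number of loops does not change when times without double bars are removed
(`IsCollapse.sameLoops`). The weights therefore depend only on the words formed by the successive
double bars before, in and after the window, and a word of length `m` is read from `N` times in
`N.choose m` ways (`sum_windowConfigs`). As each `N` is asymptotically proportional to `n`,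
dominated convergence gives the limits of numerator and denominator, and the limit of the latter is
positive (`exists_limits`). -/

noncomputable section

namespace SpinLoops

/-! ### Counting sequences of turns -/

/-- The displacement of a turn: one step to the right for `true`, one to the left for `false`. -/
def sgn (d : Bool) : ℤ := if d then 1 else -1

/-- The total displacement of a sequence of turns. -/
def disp : List Bool → ℤ
  | [] => 0
  | d :: s => sgn d + disp s

/-- The largest displacement of an initial segment of a sequence of turns. -/
def maxDisp : List Bool → ℤ
  | [] => 0
  | d :: s => max 0 (sgn d + maxDisp s)

/-- The sequences of `k` turns. -/
def turnSeqs : ℕ → Finset (List Bool)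
  | 0 => {[]}
  | k + 1 => (turnSeqs k).image (List.cons true) ∪ (turnSeqs k).image (List.cons false)

theorem mem_turnSeqs {k : ℕ} {s : List Bool} : s ∈ turnSeqs k ↔ s.length = k := by
  induction k generalizing s with
  | zero => simp [turnSeqs]
  | succ k ih =>
    simp only [turnSeqs, Finset.mem_union, Finset.mem_image]
    constructor
    · rintro (⟨t, ht, rfl⟩ | ⟨t, ht, rfl⟩) <;> simpa using ih.1 ht
    · intro h
      cases s with
      | nil => simp at h
      | cons d s =>
        have hs : s ∈ turnSeqs k := ih.2 (by simpa using h)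
        cases d
        · exact Or.inr ⟨s, hs, rfl⟩
        · exact Or.inl ⟨s, hs, rfl⟩

theorem disp_append (s t : List Bool) : disp (s ++ t) = disp s + disp t := by
  induction s with
  | nil => simp [disp]
  | cons d s ih => simp [disp, ih, add_assoc]

theorem maxDisp_nonneg (s : List Bool) : 0 ≤ maxDisp s := by
  cases s with
  | nil => exact le_rfl
  | cons d s => exact le_max_left _ _

theorem disp_le_maxDisp_of_prefix {s t : List Bool} (h : s <+: t) : disp s ≤ maxDisp t := by
  induction s generalizing t with
  | nil => exact maxDisp_nonneg t
  | cons d s ih =>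
    obtain ⟨u, rfl⟩ := h
    simp only [disp, List.cons_append, maxDisp]
    have := ih (t := s ++ u) (List.prefix_append _ _)
    exact le_max_of_le_right (by linarith)

theorem exists_split_maxDisp (s : List Bool) : ∃ t u, s = t ++ u ∧ disp t = maxDisp s := by
  induction s with
  | nil => exact ⟨[], [], rfl, rfl⟩
  | cons d s ih =>
    obtain ⟨t, u, rfl, h⟩ := ih
    rcases le_total 0 (sgn d + maxDisp (t ++ u)) with h0 | h0
    · exact ⟨d :: t, u, rfl, by simp only [disp, maxDisp]; rw [max_eq_right h0, h]⟩
    · exact ⟨[], d :: (t ++ u), rfl, by simp only [disp, maxDisp]; rw [max_eq_left h0]⟩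

theorem disp_eq_count (s : List Bool) : disp s = s.count true - s.count false := by
  induction s with
  | nil => simp [disp]
  | cons d s ih => cases d <;> simp [disp, sgn, ih] <;> ring

theorem disp_map_not (s : List Bool) : disp (s.map not) = -disp s := by
  induction s with
  | nil => simp [disp]
  | cons d s ih => cases d <;> simp [disp, sgn, ih] <;> ring

theorem count_true_add_count_false (s : List Bool) :
    s.count true + s.count false = s.length := by
  induction s with
  | nil => simp
  | cons d s ih => cases d <;> simp <;> omega

theorem length_eq_of_disp_eq_zero {s : List Bool} (h : disp s = 0) :
    s.length = 2 * s.count true ∧ s.count false = s.count true := by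
  have h1 := disp_eq_count s
  have h2 := count_true_add_count_false s
  omega

/-- A closed sequence of `2h` turns covers a range of at most `h` steps. -/
theorem maxDisp_add_maxDisp_le {s : List Bool} {h : ℕ} (hs : s.length = 2 * h)
    (hd : disp s = 0) : maxDisp s + maxDisp (s.map not) ≤ h := by
  obtain ⟨h1, h2⟩ := length_eq_of_disp_eq_zero hd
  obtain ⟨t, u, e1, e2⟩ := exists_split_maxDisp s
  obtain ⟨t', u', e3, e4⟩ := exists_split_maxDisp (s.map not)
  have e5 : s = t'.map not ++ u'.map not := by
    rw [← List.map_append, ← e3, List.map_map]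
    have : (not ∘ not) = id := by funext b; simp
    rw [this, List.map_id]
  have e6 : disp (t'.map not) = -maxDisp (s.map not) := by rw [disp_map_not, e4]
  generalize t'.map not = v at *
  generalize u'.map not = v' at *
  rw [e1] at e5
  have key : ∀ (a b w : List Bool), s = a ++ b → a ++ w <+: s →
      disp (a ++ w) - disp a ≤ h ∧ disp a - disp (a ++ w) ≤ h := by
    intro a b w _ hw
    obtain ⟨z, hz⟩ := hw
    have c1 := congrArg (List.count true) hz
    have c2 := congrArg (List.count false) hz
    simp only [List.count_append] at c1 c2
    rw [disp_append]
    have := disp_eq_count w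
    constructor <;> omega
  rcases List.append_eq_append_iff.1 e5 with ⟨w, hw, -⟩ | ⟨w, hw, -⟩
  · have := (key t u w e1 ⟨v', by rw [← hw, e1, e5]⟩).2
    rw [← hw, e2, e6] at this
    linarith
  · have := (key v v' w (by rw [e1, e5]) ⟨u, by rw [← hw, e1]⟩).1
    rw [← hw, e2, e6] at this
    linarith

/-- The closed sequences of `k` turns. -/
def closedSeqs (k : ℕ) : Finset (List Bool) := (turnSeqs k).filter (fun s => disp s = 0)

theorem card_filter_count (k h : ℕ) :
    ((turnSeqs k).filter (fun s => s.count true = h)).card = k.choose h := by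
  induction k generalizing h with
  | zero =>
    cases h with
    | zero => rfl
    | succ h => simp [turnSeqs, Finset.filter_singleton]
  | succ k ih =>
    simp only [turnSeqs]
    rw [Finset.filter_union, Finset.card_union_of_disjoint, Finset.filter_image,
      Finset.filter_image, Finset.card_image_of_injective _ List.cons_injective,
      Finset.card_image_of_injective _ List.cons_injective]
    · cases h with
      | zero => simp [ih]
      | succ h => simp [ih, Nat.choose_succ_succ]
    · rw [Finset.disjoint_left]
      intro s h1 h2
      simp only [Finset.mem_filter, Finset.mem_image] at h1 h2
      obtain ⟨⟨a, -, rfl⟩, -⟩ := h1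
      obtain ⟨⟨b, -, h3⟩, -⟩ := h2
      simp at h3

theorem card_closedSeqs (h : ℕ) : (closedSeqs (2 * h)).card = h.centralBinom := by
  rw [Nat.centralBinom_eq_two_mul_choose, ← card_filter_count]
  congr 1
  ext s
  simp only [closedSeqs, Finset.mem_filter, mem_turnSeqs]
  refine and_congr_right fun hs => ?_
  have h1 := disp_eq_count s
  have h2 := count_true_add_count_false s
  omega

/-- The closed sequences of `k` turns with an initial segment of displacement more than `d`, without
this condition for `d = 0`. -/
def reachingSeqs (k d : ℕ) : Finset (List Bool) :=
  (closedSeqs k).filter (fun s => d = 0 ∨ (d : ℤ) + 1 ≤ maxDisp s)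

/-- A sequence whose largest displacement is `m` is counted for `d = 0` and for `0 < d < m`. -/
theorem sum_card_reachingSeqs_le (k D : ℕ) :
    ∑ d ∈ Finset.range D, (reachingSeqs k d).card ≤
      ∑ s ∈ closedSeqs k, max 1 (maxDisp s).toNat := by
  simp only [reachingSeqs, Finset.card_filter]
  rw [Finset.sum_comm]
  refine Finset.sum_le_sum fun s _ => ?_
  rw [← Finset.card_filter]
  refine (Finset.card_le_card (t := Finset.range (max 1 (maxDisp s).toNat)) ?_).trans_eq
    (Finset.card_range _)
  intro d hd
  obtain ⟨-, hd⟩ := Finset.mem_filter.1 hd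
  rw [Finset.mem_range]
  omega

theorem sum_closedSeqs_six : ∑ s ∈ closedSeqs 6, max 1 (maxDisp s).toNat = 27 := by
  decide +kernel

/-- Pairing each closed sequence with its mirror image. -/
theorem two_mul_sum_closedSeqs_le {h : ℕ} (hh : 1 ≤ h) :
    2 * ∑ s ∈ closedSeqs (2 * h), max 1 (maxDisp s).toNat ≤ (h + 1) * h.centralBinom := by
  have e : ∑ s ∈ closedSeqs (2 * h), max 1 (maxDisp s).toNat =
      ∑ s ∈ closedSeqs (2 * h), max 1 (maxDisp (s.map not)).toNat := by
    have hinv : ∀ s : List Bool, (s.map not).map not = s := by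
      intro s
      rw [List.map_map]
      have : (not ∘ not) = id := by funext b; simp
      rw [this, List.map_id]
    have hm : ∀ s ∈ closedSeqs (2 * h), s.map not ∈ closedSeqs (2 * h) := by
      intro s hs
      simp only [closedSeqs, Finset.mem_filter, mem_turnSeqs, List.length_map] at hs ⊢
      exact ⟨hs.1, by rw [disp_map_not, hs.2, neg_zero]⟩
    refine Finset.sum_nbij' (fun s => s.map not) (fun s => s.map not) hm hm
      (fun s _ => hinv s) (fun s _ => hinv s) (fun s _ => by rw [hinv])
  rw [two_mul]
  nth_rewrite 2 [e]
  rw [← Finset.sum_add_distrib, ← card_closedSeqs, mul_comm (h + 1)]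
  refine Finset.sum_le_card_nsmul (closedSeqs (2 * h)) _ (h + 1) fun s hs => ?_
  simp only [closedSeqs, Finset.mem_filter, mem_turnSeqs] at hs
  have h1 := maxDisp_add_maxDisp_le hs.1 hs.2
  have h2 := maxDisp_nonneg s
  have h3 := maxDisp_nonneg (s.map not)
  omega

/-- The condition `4 ≤ h` is needed: for `h = 3` the bound fails. -/
theorem centralBinom_bound {h : ℕ} (hh : 4 ≤ h) :
    6 * (h + 1) * h.centralBinom ≤ (2 * h + 1) * 4 ^ h := by
  induction h, hh using Nat.le_induction with
  | base => decide
  | succ h hh ih =>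
    have h1 := Nat.succ_mul_centralBinom_succ h
    have h2 : (h + 1) * (6 * (h + 1 + 1) * (h + 1).centralBinom) * (h + 1) =
        2 * (2 * h + 1) * (h + 2) * (6 * (h + 1) * h.centralBinom) := by
      calc _ = 6 * (h + 1 + 1) * ((h + 1) * (h + 1).centralBinom) * (h + 1) := by ring
        _ = _ := by rw [h1]; ring
    have h3 : 2 * (2 * h + 1) * (h + 2) * (6 * (h + 1) * h.centralBinom) ≤
        2 * (2 * h + 1) * (h + 2) * ((2 * h + 1) * 4 ^ h) := Nat.mul_le_mul_left _ ih
    have h4 : 2 * (2 * h + 1) * (h + 2) * ((2 * h + 1) * 4 ^ h) ≤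
        (h + 1) * ((2 * (h + 1) + 1) * 4 ^ (h + 1)) * (h + 1) := by
      have : 2 * (2 * h + 1) * (h + 2) * (2 * h + 1) ≤
          (h + 1) * (2 * (h + 1) + 1) * 4 * (h + 1) := by nlinarith
      calc _ = 2 * (2 * h + 1) * (h + 2) * (2 * h + 1) * 4 ^ h := by ring
        _ ≤ (h + 1) * (2 * (h + 1) + 1) * 4 * (h + 1) * 4 ^ h := Nat.mul_le_mul_right _ this
        _ = _ := by ring
    have h5 : (h + 1) * (h + 1) * (6 * (h + 1 + 1) * (h + 1).centralBinom) ≤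
        (h + 1) * (h + 1) * ((2 * (h + 1) + 1) * 4 ^ (h + 1)) := by nlinarith
    exact Nat.le_of_mul_le_mul_left h5 (by positivity)

theorem twelve_mul_sum_card_reachingSeqs_le {h : ℕ} (hh : 4 ≤ h) (D : ℕ) :
    12 * ∑ d ∈ Finset.range D, (reachingSeqs (2 * h) d).card ≤ (2 * h + 1) * 4 ^ h := by
  have h1 := sum_card_reachingSeqs_le (2 * h) D
  have h2 := two_mul_sum_closedSeqs_le (h := h) (by omega)
  have h3 := centralBinom_bound hh
  have : 6 * (h + 1) * h.centralBinom = 6 * ((h + 1) * h.centralBinom) := by ring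
  omega

open scoped Classical

set_option linter.unusedSectionVars false

/-! ### Double bars on a discrete circle and their loops -/

/-- A configuration of double bars on the time circle `ZMod M`, with at most one double bar at any
time: `c j = some y` means that the double bar at time `j` sits at the edge `{y, y+1}`. -/
abbrev Bars (M : ℕ) := ZMod M → Option ℤ

/-- The double bar `o`, if there is one, has an end at the site `a`. -/
def Touches (o : Option ℤ) (a : ℤ) : Prop := o = some a ∨ o = some (a - 1)

/-- The leg `(a, j)` is the vertical segment above the site `a` between the times `j` and `j + 1`.
Two legs are linked when a trajectory passes directly from one to the other. -/
def Link {M : ℕ} (c : Bars M) (p q : ℤ × ZMod M) : Prop :=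
  (q = (p.1, p.2 + 1) ∧ ¬ Touches (c (p.2 + 1)) p.1) ∨
  (q = (p.1 + 1, p.2) ∧ (c p.2 = some p.1 ∨ c (p.2 + 1) = some p.1))

/-- The equivalence relation on legs of lying on the same loop. -/
def loopSetoid {M : ℕ} (c : Bars M) : Setoid (ℤ × ZMod M) := Relation.EqvGen.setoid (Link c)

/-- Two legs lie on the same loop. -/
def Conn {M : ℕ} (c : Bars M) (p q : ℤ × ZMod M) : Prop := Relation.EqvGen (Link c) p q

/-- The loop through a leg, as an element of the quotient. -/
def loopOf {M : ℕ} (c : Bars M) (p : ℤ × ZMod M) : Quotient (loopSetoid c) :=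
  Quotient.mk (loopSetoid c) p

/-- The legs above the sites `0, …, 2ℓ-1`. -/
def circleLegs (ℓ M : ℕ) [NeZero M] : Finset (ℤ × ZMod M) :=
  Finset.Ico (0 : ℤ) (2 * ℓ) ×ˢ Finset.univ

/-- The number of loops above the sites `0, …, 2ℓ-1`. -/
def loopCount (ℓ : ℕ) {M : ℕ} [NeZero M] (c : Bars M) : ℕ :=
  ((circleLegs ℓ M).image (loopOf c)).card

/-- The number of double bars. -/
def barCount {M : ℕ} [NeZero M] (c : Bars M) : ℕ := (Finset.univ.filter (fun j => c j ≠ none)).card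

/-- All double bars sit at edges of the chain `0, …, 2ℓ-1`. -/
def OnChain (ℓ : ℕ) {M : ℕ} (c : Bars M) : Prop := ∀ j y, c j = some y → 0 ≤ y ∧ y + 1 < 2 * ℓ

section basic

variable {M : ℕ}

theorem mem_circleLegs {ℓ : ℕ} [NeZero M] {p : ℤ × ZMod M} :
    p ∈ circleLegs ℓ M ↔ 0 ≤ p.1 ∧ p.1 < 2 * ℓ := by
  simp [circleLegs]

theorem loopOf_eq {c : Bars M} {p q : ℤ × ZMod M} : loopOf c p = loopOf c q ↔ Conn c p q :=
  Quotient.eq (r := loopSetoid c)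

theorem Conn.refl (c : Bars M) (p : ℤ × ZMod M) : Conn c p p := Relation.EqvGen.refl _

theorem Conn.symm {c : Bars M} {p q : ℤ × ZMod M} (h : Conn c p q) : Conn c q p :=
  Relation.EqvGen.symm _ _ h

theorem Conn.trans {c : Bars M} {p q r : ℤ × ZMod M} (h : Conn c p q) (h' : Conn c q r) :
    Conn c p r := Relation.EqvGen.trans _ _ _ h h'

theorem Link.conn {c : Bars M} {p q : ℤ × ZMod M} (h : Link c p q) : Conn c p q :=
  Relation.EqvGen.rel _ _ h

theorem link_up {c : Bars M} {a : ℤ} {j : ZMod M} (h : ¬ Touches (c (j + 1)) a) :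
    Link c (a, j) (a, j + 1) := Or.inl ⟨rfl, h⟩

theorem link_below {c : Bars M} {y : ℤ} {j : ZMod M} (h : c (j + 1) = some y) :
    Link c (y, j) (y + 1, j) := Or.inr ⟨rfl, Or.inr h⟩

theorem link_above {c : Bars M} {y : ℤ} {j : ZMod M} (h : c j = some y) :
    Link c (y, j) (y + 1, j) := Or.inr ⟨rfl, Or.inl h⟩

/-- A function of legs that is constant along links is constant on loops. -/
theorem Conn.map_eq {c : Bars M} {X : Type*} (f : ℤ × ZMod M → X)
    (hv : ∀ a j, ¬ Touches (c (j + 1)) a → f (a, j) = f (a, j + 1))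
    (hb : ∀ y j, c (j + 1) = some y → f (y, j) = f (y + 1, j))
    (ha : ∀ y j, c j = some y → f (y, j) = f (y + 1, j))
    {p q : ℤ × ZMod M} (h : Conn c p q) : f p = f q := by
  induction h with
  | rel p q h =>
    obtain ⟨a, j⟩ := p
    rcases h with ⟨rfl, h⟩ | ⟨rfl, h | h⟩
    · exact hv _ _ h
    · exact ha _ _ h
    · exact hb _ _ h
  | refl => rfl
  | symm _ _ _ ih => exact ih.symm
  | trans _ _ _ _ _ ih1 ih2 => exact ih1.trans ih2

/-- There are at least as many loops as values of a function that is constant along links. -/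
theorem card_image_le_loopCount {ℓ : ℕ} [NeZero M] {c : Bars M} {X : Type*}
    [DecidableEq X] (f : ℤ × ZMod M → X)
    (hv : ∀ a j, ¬ Touches (c (j + 1)) a → f (a, j) = f (a, j + 1))
    (hb : ∀ y j, c (j + 1) = some y → f (y, j) = f (y + 1, j))
    (ha : ∀ y j, c j = some y → f (y, j) = f (y + 1, j)) :
    ((circleLegs ℓ M).image f).card ≤ loopCount ℓ c := by
  let g : Quotient (loopSetoid c) → X :=
    Quotient.lift f (fun p q h => Conn.map_eq f hv hb ha h)
  have : (circleLegs ℓ M).image f = ((circleLegs ℓ M).image (loopOf c)).image g := by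
    rw [Finset.image_image]; rfl
  rw [this]
  exact Finset.card_image_le

/-- Erasing one double bar merges at most two loops into one. -/
theorem loopCount_le_update_none {ℓ : ℕ} [NeZero M] (c : Bars M) (t : ZMod M) :
    loopCount ℓ c ≤ loopCount ℓ (Function.update c t none) + 1 := by
  cases hy : c t with
  | none =>
    have : Function.update c t none = c := by rw [← hy]; exact Function.update_eq_self t c
    rw [this]; omega
  | some y =>
    set lo := loopOf c (y, t - 1)
    set up := loopOf c (y, t)
    let f : ℤ × ZMod M → Quotient (loopSetoid c) :=
      fun p => if loopOf c p = lo then up else loopOf c p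
    have key : ∀ p q, loopOf c p = loopOf c q → f p = f q := by
      intro p q h; simp only [f, h]
    have h1 : ((circleLegs ℓ M).image f).card ≤ loopCount ℓ (Function.update c t none) := by
      refine card_image_le_loopCount f ?_ ?_ ?_
      · intro a j h
        by_cases hj : j + 1 = t
        · by_cases hT : Touches (c (j + 1)) a
          · have e1 : loopOf c (a, j) = lo := by
              have hj' : j = t - 1 := by rw [← hj]; ring
              rw [hj, hy] at hT
              rcases hT with h1 | h1
              · simp only [Option.some.injEq] at h1; rw [← h1, hj']
              · simp only [Option.some.injEq] at h1
                have : a = y + 1 := by omega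
                rw [this, hj']
                refine (loopOf_eq.2 (link_below ?_).conn).symm
                rw [sub_add_cancel, hy]
            have e2 : loopOf c (a, j + 1) = up := by
              rw [hj, hy] at hT
              rw [hj]
              rcases hT with h1 | h1
              · simp only [Option.some.injEq] at h1; rw [← h1]
              · simp only [Option.some.injEq] at h1
                have : a = y + 1 := by omega
                rw [this]
                exact (loopOf_eq.2 (link_above hy).conn).symm
            simp only [f, e1, e2, if_true, ite_self]
          · exact key _ _ (loopOf_eq.2 (link_up hT).conn)
        · rw [Function.update_of_ne hj] at h
          exact key _ _ (loopOf_eq.2 (link_up h).conn)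
      · intro z j h
        by_cases hj : j + 1 = t
        · rw [hj, Function.update_self] at h; cases h
        · rw [Function.update_of_ne hj] at h
          exact key _ _ (loopOf_eq.2 (link_below h).conn)
      · intro z j h
        by_cases hj : j = t
        · rw [hj, Function.update_self] at h; cases h
        · rw [Function.update_of_ne hj] at h
          exact key _ _ (loopOf_eq.2 (link_above h).conn)
    have h2 : (circleLegs ℓ M).image (loopOf c) ⊆ insert lo ((circleLegs ℓ M).image f) := by
      intro x hx
      obtain ⟨p, hp, rfl⟩ := Finset.mem_image.1 hx
      by_cases h : loopOf c p = lo
      · rw [h]; exact Finset.mem_insert_self _ _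
      · refine Finset.mem_insert_of_mem (Finset.mem_image.2 ⟨p, hp, ?_⟩)
        simp only [f, if_neg h]
    have h3 := (Finset.card_le_card h2).trans (Finset.card_insert_le _ _)
    unfold loopCount at h1 ⊢
    omega

/-- The configuration without the double bars at the times in `J`. -/
def eraseBars (c : Bars M) (J : Finset (ZMod M)) : Bars M := fun j => if j ∈ J then none else c j

theorem loopCount_le_eraseBars {ℓ : ℕ} [NeZero M] (c : Bars M) (J : Finset (ZMod M)) :
    loopCount ℓ c ≤ loopCount ℓ (eraseBars c J) + J.card := by
  induction J using Finset.induction_on with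
  | empty =>
    have : eraseBars c ∅ = c := by funext j; simp [eraseBars]
    simp [this]
  | insert t J ht ih =>
    have : eraseBars c (insert t J) = Function.update (eraseBars c J) t none := by
      funext j
      by_cases h : j = t
      · subst h; simp [eraseBars]
      · simp [eraseBars, h]
    rw [this, Finset.card_insert_of_notMem ht]
    have := loopCount_le_update_none (ℓ := ℓ) (eraseBars c J) t
    omega

theorem barCount_eraseBars [NeZero M] (c : Bars M) (J : Finset (ZMod M))
    (hJ : ∀ j ∈ J, c j ≠ none) : barCount (eraseBars c J) + J.card = barCount c := by
  unfold barCount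
  have : (Finset.univ.filter (fun j => c j ≠ none)) =
      (Finset.univ.filter (fun j => eraseBars c J j ≠ none)) ∪ J := by
    ext j
    by_cases h : j ∈ J
    · simp [h, hJ j h]
    · simp [h, eraseBars]
  rw [this, Finset.card_union_of_disjoint]
  rw [Finset.disjoint_left]
  intro j hj hj'
  simp [eraseBars, hj'] at hj

/-- Without double bars every loop is a whole column. -/
theorem conn_of_empty [NeZero M] {c : Bars M} (hc : ∀ j, c j = none) (a : ℤ) (i : ℕ) :
    Conn c (a, 0) (a, (i : ZMod M)) := by
  induction i with
  | zero => simpa using Conn.refl c (a, 0)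
  | succ i ih =>
    refine ih.trans ?_
    have := (link_up (c := c) (a := a) (j := (i : ZMod M)) (by simp [Touches, hc])).conn
    simpa using this

/-- Removing the double bars one by one changes the number of loops by at most one each time, and
the `2 * ℓ` columns remain. -/
theorem loopCount_le [NeZero M] (ℓ : ℕ) (c : Bars M) : loopCount ℓ c ≤ barCount c + 2 * ℓ := by
  have h1 := loopCount_le_eraseBars (ℓ := ℓ) c (Finset.univ.filter (fun j => c j ≠ none))
  set e := eraseBars c (Finset.univ.filter (fun j => c j ≠ none)) with he
  have h0 : ∀ j, e j = none := by
    intro j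
    rw [he]
    by_cases h : c j = none <;> simp [eraseBars, h]
  have h2 : loopCount ℓ e ≤ 2 * ℓ := by
    have : (circleLegs ℓ M).image (loopOf e) ⊆
        (Finset.Ico (0 : ℤ) (2 * ℓ)).image (fun a => loopOf e (a, 0)) := by
      intro x hx
      obtain ⟨⟨a, j⟩, hp, rfl⟩ := Finset.mem_image.1 hx
      have hp' := mem_circleLegs.1 hp
      refine Finset.mem_image.2 ⟨a, Finset.mem_Ico.2 hp', loopOf_eq.2 ?_⟩
      have := conn_of_empty h0 a j.val
      rwa [ZMod.natCast_zmod_val] at this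
    refine (Finset.card_le_card this).trans (Finset.card_image_le.trans ?_)
    simp
  unfold barCount
  omega

end basic

/-! ### Parity of the crossings to the left of a leg -/

section parity

variable {M : ℕ}

/-- A set of legs that is a union of loops. -/
def Closed (c : Bars M) (γ : Set (ℤ × ZMod M)) : Prop := ∀ p q, Conn c p q → (p ∈ γ ↔ q ∈ γ)

/-- The indicator of a set of legs, modulo two. -/
def ind (γ : Set (ℤ × ZMod M)) (p : ℤ × ZMod M) : ZMod 2 := if p ∈ γ then 1 else 0

/-- The parity of the number of legs of `γ` to the left of the site `a` in the time slot `j`. -/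
def par (γ : Set (ℤ × ZMod M)) (a : ℤ) (j : ZMod M) : ZMod 2 :=
  ∑ z ∈ Finset.Ico 0 a, ind γ (z, j)

theorem par_zero (γ : Set (ℤ × ZMod M)) {a : ℤ} (ha : a ≤ 0) (j : ZMod M) : par γ a j = 0 := by
  simp [par, Finset.Ico_eq_empty_of_le ha]

theorem par_succ (γ : Set (ℤ × ZMod M)) {a : ℤ} (ha : 0 ≤ a) (j : ZMod M) :
    par γ (a + 1) j = par γ a j + ind γ (a, j) := by
  unfold par
  have : Finset.Ico 0 (a + 1) = insert a (Finset.Ico 0 a) := by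
    ext z; simp only [Finset.mem_Ico, Finset.mem_insert]; omega
  rw [this, Finset.sum_insert (by simp), add_comm]

theorem two_values (x : ZMod 2) : x = 0 ∨ x = 1 := by
  revert x; decide

theorem ind_of_mem {γ : Set (ℤ × ZMod M)} {p : ℤ × ZMod M} (h : p ∈ γ) : ind γ p = 1 := if_pos h

theorem ind_of_notMem {γ : Set (ℤ × ZMod M)} {p : ℤ × ZMod M} (h : p ∉ γ) : ind γ p = 0 :=
  if_neg h

theorem add_self_two (x : ZMod 2) : x + x = 0 := by revert x; decide

theorem ind_eq {c : Bars M} {γ : Set (ℤ × ZMod M)} (hγ : Closed c γ) {p q : ℤ × ZMod M}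
    (h : Conn c p q) : ind γ p = ind γ q := by
  unfold ind; simp only [hγ p q h]

/-- Crossings are created and removed in neighbouring pairs, so that the parity to the left of `a`
changes with time only at a double bar at the edge `{a-1, a}`. -/
theorem par_add_par {ℓ : ℕ} {c : Bars M} (hc : OnChain ℓ c) {γ : Set (ℤ × ZMod M)}
    (hγ : Closed c γ) (j : ZMod M) {a : ℤ} (ha : 0 ≤ a) :
    par γ a j + par γ a (j + 1) =
      if c (j + 1) = some (a - 1) then ind γ (a - 1, j) + ind γ (a - 1, j + 1) else 0 := by
  induction a, ha using Int.leInduction with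
  | base =>
    rw [par_zero _ le_rfl, par_zero _ le_rfl, if_neg]; · simp
    intro h
    have := (hc _ _ h).1
    omega
  | succ a ha ih =>
    rw [par_succ _ ha, par_succ _ ha]
    have e : par γ a j + ind γ (a, j) + (par γ a (j + 1) + ind γ (a, j + 1)) =
      (par γ a j + par γ a (j + 1)) + (ind γ (a, j) + ind γ (a, j + 1)) := by ring
    rw [e, ih]
    by_cases h1 : c (j + 1) = some (a - 1)
    · have e1 := ind_eq hγ (link_below h1).conn
      have e2 := ind_eq hγ (link_above h1).conn
      rw [sub_add_cancel] at e1 e2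
      have h2 : c (j + 1) ≠ some (a + 1 - 1) := by rw [h1]; simp
      rw [if_pos h1, if_neg h2, e1, e2, add_self_two]
    · rw [if_neg h1, zero_add]
      by_cases h2 : c (j + 1) = some a
      · rw [if_pos (by simpa using h2)]; simp
      · rw [if_neg (by simpa using h2)]
        rw [ind_eq hγ (link_up (c := c) (a := a) (j := j) (by simp [Touches, h1, h2])).conn,
          add_self_two]

theorem par_step {ℓ : ℕ} {c : Bars M} (hc : OnChain ℓ c) {γ : Set (ℤ × ZMod M)}
    (hγ : Closed c γ) {j : ZMod M} {a : ℤ} (h : c (j + 1) ≠ some (a - 1)) :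
    par γ a j = par γ a (j + 1) := by
  by_cases ha : 0 ≤ a
  · have := par_add_par hc hγ j ha
    rw [if_neg h] at this
    generalize par γ a j = x at *
    generalize par γ a (j + 1) = y at *
    revert x y; decide
  · rw [par_zero _ (by omega), par_zero _ (by omega)]

theorem par_eq_one_pos {γ : Set (ℤ × ZMod M)} {a : ℤ} {j : ZMod M} (h : par γ a j = 1) :
    1 ≤ a := by
  by_contra h'
  rw [par_zero _ (by omega)] at h
  exact absurd h (by decide)

end parity

/-! ### Shifting the interior of a loop -/

section shift

variable {M : ℕ}

/-- The double bars whose left end has an odd number of crossings of `γ` to its left (those inside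
`γ`, and those at which `γ` turns with its interior on the other side) are moved one step to the
left, the others stay.  At times without a double bar those of `A` are inserted. -/
def shiftBars (γ : Set (ℤ × ZMod M)) (c A : Bars M) : Bars M := fun j =>
  match c j with
  | some y => if par γ y j = 1 then some (y - 1) else some y
  | none => A j

/-- The leg before the shift that corresponds to a leg after the shift.  It is a bijection from the
legs that it maps outside `γ` to the legs outside `γ`.  The remaining legs form neighbouring pairs:
the room of one leg of `γ` and of the one to its right is taken by the pair of columns that ends at
the latter. -/
def unshift (γ : Set (ℤ × ZMod M)) (p : ℤ × ZMod M) : ℤ × ZMod M :=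
  if par γ (p.1 + 1) p.2 = 1 then (p.1 + 1, p.2) else p

/-- The first time after the slot `j` with a double bar at the edge `e`, as a set that is empty if
there is none. -/
def nextBar (c : Bars M) (e : ℤ) (j : ZMod M) : Set (ZMod M) :=
  {t | ∃ l : ℕ, t = j + 1 + l ∧ c t = some e ∧ ∀ l' < l, c (j + 1 + (l' : ℕ)) ≠ some e}

theorem some_ne_sub_one (y : ℤ) : some y ≠ some (y - 1) := by
  simp only [ne_eq, Option.some.injEq]; omega

theorem nextBar_self {c : Bars M} {e : ℤ} {j : ZMod M} (h : c (j + 1) = some e) :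
    nextBar c e j = {j + 1} := by
  ext t
  simp only [nextBar, Set.mem_ofPred_eq, Set.mem_singleton_iff]
  constructor
  · rintro ⟨l, rfl, -, h2⟩
    rcases Nat.eq_zero_or_pos l with rfl | hl
    · simp
    · exact absurd (by simpa using h) (h2 0 hl)
  · rintro rfl
    exact ⟨0, by simp, h, by simp⟩

theorem nextBar_step {c : Bars M} {e : ℤ} {j : ZMod M} (h : c (j + 1) ≠ some e) :
    nextBar c e j = nextBar c e (j + 1) := by
  ext t
  simp only [nextBar, Set.mem_ofPred_eq]
  constructor
  · rintro ⟨l, rfl, h1, h2⟩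
    cases l with
    | zero => exact absurd (by simpa using h1) h
    | succ l =>
      refine ⟨l, by push_cast; ring, h1, fun l' hl' => ?_⟩
      have := h2 (l' + 1) (by omega)
      push_cast at this
      rwa [show j + 1 + 1 + (l' : ZMod M) = j + 1 + ((l' : ZMod M) + 1) by ring]
  · rintro ⟨l, rfl, h1, h2⟩
    refine ⟨l + 1, by push_cast; ring, h1, fun l' hl' => ?_⟩
    cases l' with
    | zero => simpa using h
    | succ l' =>
      have := h2 l' (by omega)
      push_cast
      rwa [show j + 1 + ((l' : ZMod M) + 1) = j + 1 + 1 + (l' : ZMod M) by ring]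

/-- The label of a leg after the shift.  Legs of the old loops other than `γ` are labelled by their
old loop; the others by their column and by the double bar that closes their column from above. -/
def shiftLabel (γ : Set (ℤ × ZMod M)) (c d : Bars M) (p : ℤ × ZMod M) :
    Quotient (loopSetoid c) ⊕ (ℤ × Set (ZMod M)) :=
  if unshift γ p ∈ γ then Sum.inr ((unshift γ p).1, nextBar d ((unshift γ p).1 - 1) p.2)
  else Sum.inl (loopOf c (unshift γ p))

variable {ℓ : ℕ} {c A : Bars M} {γ : Set (ℤ × ZMod M)}

theorem unshift_of_one {a : ℤ} {j : ZMod M} (h : par γ (a + 1) j = 1) :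
    unshift γ (a, j) = (a + 1, j) := if_pos h

theorem unshift_of_zero {a : ℤ} {j : ZMod M} (h : par γ (a + 1) j = 0) :
    unshift γ (a, j) = (a, j) := by
  unfold unshift
  rw [if_neg]
  simp only [h]; decide

theorem shiftLabel_eq_of_unshift_eq {d : Bars M} {p q : ℤ × ZMod M} (h : unshift γ p = unshift γ q)
    (hj : p.2 = q.2) : shiftLabel γ c d p = shiftLabel γ c d q := by
  unfold shiftLabel; rw [h, hj]

theorem shiftLabel_eq_of_conn {d : Bars M} {p q : ℤ × ZMod M}
    (h : Conn c (unshift γ p) (unshift γ q)) (hp : unshift γ p ∉ γ) (hq : unshift γ q ∉ γ) :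
    shiftLabel γ c d p = shiftLabel γ c d q := by
  unfold shiftLabel; rw [if_neg hp, if_neg hq, loopOf_eq.2 h]

/-- The two legs on the same side of a double bar get the same label. -/
theorem shiftLabel_pair (hc : OnChain ℓ c) (hγ : Closed c γ)
    (hA : ∀ t e, A t = some e → c t = none → (e + 1, t) ∈ γ ∧ par γ (e + 1) t = 1)
    {s t : ZMod M} {y : ℤ} (d : Bars M)
    (h1 : ∀ y0, c t = some y0 → Conn c (y0, s) (y0 + 1, s) ∧ par γ y0 s = par γ y0 t)
    (h2 : c t = none → ∀ a, (par γ a s = par γ a t ∧ ((a, s) ∈ γ ↔ (a, t) ∈ γ)))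
    (h : shiftBars γ c A t = some y) :
    shiftLabel γ c d (y, s) = shiftLabel γ c d (y + 1, s) := by
  cases ht : c t with
  | none =>
    simp only [shiftBars, ht] at h
    obtain ⟨hm, hp⟩ := hA _ _ h ht
    obtain ⟨h3, -⟩ := h2 ht (y + 1)
    have hm' : (y + 1, s) ∈ γ := (h2 ht (y + 1)).2.2 hm
    rw [hp] at h3
    have hy := par_eq_one_pos h3
    refine shiftLabel_eq_of_unshift_eq ?_ rfl
    rw [unshift_of_one h3, unshift_of_zero]
    rw [par_succ _ (by omega), h3, ind_of_mem hm', add_self_two]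
  | some y0 =>
    obtain ⟨hcn, hp⟩ := h1 y0 ht
    have hy0 := (hc _ _ ht).1
    have hmem := hγ _ _ hcn
    have hs := par_succ γ hy0 s
    have hs2 := par_succ γ (show 0 ≤ y0 + 1 by omega) s
    rw [← ind_eq hγ hcn] at hs2
    rcases two_values (par γ y0 t) with h0 | h0
    · have : y = y0 := by
        simp only [shiftBars, ht, h0] at h
        simpa using h.symm
      subst this
      rw [hp, h0, zero_add] at hs
      by_cases hm : (y, s) ∈ γ
      · rw [ind_of_mem hm] at hs hs2
        refine shiftLabel_eq_of_unshift_eq ?_ rfl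
        rw [unshift_of_one hs, unshift_of_zero]
        rw [hs2, hs, add_self_two]
      · rw [ind_of_notMem hm] at hs hs2
        have e1 := unshift_of_zero hs
        have e2 := unshift_of_zero (γ := γ) (a := y + 1) (j := s) (by rw [hs2, hs, add_zero])
        apply shiftLabel_eq_of_conn
        · rwa [e1, e2]
        · rwa [e1]
        · rw [e2]; exact fun h => hm (hmem.2 h)
    · have : y = y0 - 1 := by
        simp only [shiftBars, ht, h0] at h
        simpa using h.symm
      subst this
      rw [hp, h0] at hs
      have e1 := unshift_of_one (γ := γ) (a := y0 - 1) (j := s)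
        (by rw [sub_add_cancel, hp, h0])
      rw [sub_add_cancel] at e1 ⊢
      by_cases hm : (y0, s) ∈ γ
      · rw [ind_of_mem hm, add_self_two] at hs
        refine shiftLabel_eq_of_unshift_eq ?_ rfl
        rw [e1, unshift_of_zero hs]
      · rw [ind_of_notMem hm, add_zero] at hs
        have e2 := unshift_of_one hs
        apply shiftLabel_eq_of_conn
        · rwa [e1, e2]
        · rwa [e1]
        · rw [e2]; exact fun h => hm (hmem.2 h)

/-- The label does not change along a column that has no double bar after the shift. -/
theorem shiftLabel_up (hc : OnChain ℓ c) (hγ : Closed c γ) {a : ℤ} {j : ZMod M}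
    (h : ¬ Touches (shiftBars γ c A (j + 1)) a) :
    shiftLabel γ c (shiftBars γ c A) (a, j) = shiftLabel γ c (shiftBars γ c A) (a, j + 1) := by
  have key : c (j + 1) ≠ some a ∧
      ¬ Touches (c (j + 1)) (unshift γ (a, j)).1 ∧
      (unshift γ (a, j) ∈ γ → shiftBars γ c A (j + 1) ≠ some ((unshift γ (a, j)).1 - 1)) := by
    have hu : (par γ (a + 1) j = 0 ∧ unshift γ (a, j) = (a, j)) ∨
        (par γ (a + 1) j = 1 ∧ unshift γ (a, j) = (a + 1, j)) := by
      rcases two_values (par γ (a + 1) j) with h0 | h0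
      · exact Or.inl ⟨h0, unshift_of_zero h0⟩
      · exact Or.inr ⟨h0, unshift_of_one h0⟩
    cases hj : c (j + 1) with
    | none =>
      refine ⟨by simp, by simp [Touches], fun _ h' => h ?_⟩
      rcases hu with ⟨-, hu⟩ | ⟨-, hu⟩
      · rw [hu] at h'; exact Or.inr h'
      · rw [hu] at h'; exact Or.inl (by simpa using h')
    | some y0 =>
      have hy0 := (hc _ _ hj).1
      have hp0 : par γ y0 j = par γ y0 (j + 1) := par_step hc hγ (by rw [hj]; exact some_ne_sub_one y0)
      have hs := par_succ γ hy0 j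
      have hs2 := par_succ γ (show 0 ≤ y0 + 1 by omega) j
      rw [← ind_eq hγ (link_below hj).conn, hs, add_assoc (par γ y0 j), add_self_two,
        add_zero] at hs2
      rcases two_values (par γ y0 (j + 1)) with h0 | h0
      · have hb : shiftBars γ c A (j + 1) = some y0 := by
          simp only [shiftBars, hj, h0]; simp
        rw [hb] at h ⊢
        simp only [Touches, Option.some.injEq, not_or, ne_eq] at h ⊢
        rw [hp0, h0] at hs2
        have hz : (unshift γ (a, j)).1 ≠ y0 ∧ (unshift γ (a, j)).1 ≠ y0 + 1 := by
          rcases hu with ⟨h3, hu⟩ | ⟨h3, hu⟩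
          · rw [hu]; exact ⟨fun h' => h.1 h'.symm, fun h' => h.2 (by simp at h'; omega)⟩
          · rw [hu]
            refine ⟨fun h' => ?_, fun h' => h.1 (by simp at h'; omega)⟩
            simp only at h'
            rw [h', hp0, h0] at h3
            exact absurd h3 (by decide)
        exact ⟨by omega, by omega, by omega⟩
      · have hb : shiftBars γ c A (j + 1) = some (y0 - 1) := by
          simp only [shiftBars, hj, h0]; simp
        rw [hb] at h ⊢
        simp only [Touches, Option.some.injEq, not_or, ne_eq] at h ⊢
        rw [hp0, h0] at hs2
        have hz : (unshift γ (a, j)).1 ≠ y0 ∧ (unshift γ (a, j)).1 ≠ y0 + 1 := by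
          rcases hu with ⟨h3, hu⟩ | ⟨h3, hu⟩
          · rw [hu]
            refine ⟨fun h' => h.2 (by simp at h'; omega), fun h' => ?_⟩
            simp only at h'
            rw [h', hs2] at h3
            exact absurd h3 (by decide)
          · rw [hu]
            exact ⟨fun h' => h.1 (by simp at h'; omega), fun h' => h.2 (by simp at h'; omega)⟩
        exact ⟨by omega, by omega, by omega⟩
  obtain ⟨k1, k2, k3⟩ := key
  have hp : par γ (a + 1) j = par γ (a + 1) (j + 1) := par_step hc hγ (by simpa using k1)
  have hu : unshift γ (a, j + 1) = ((unshift γ (a, j)).1, j + 1) := by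
    unfold unshift; simp only [hp]; split_ifs <;> rfl
  have hu' : unshift γ (a, j) = ((unshift γ (a, j)).1, j) := by
    unfold unshift; split_ifs <;> rfl
  have hcn : Conn c (unshift γ (a, j)) (unshift γ (a, j + 1)) := by
    rw [hu, hu']; exact (link_up k2).conn
  by_cases hm : unshift γ (a, j) ∈ γ
  · have hm' := (hγ _ _ hcn).1 hm
    unfold shiftLabel
    rw [if_pos hm, if_pos hm', nextBar_step (k3 hm), hu]
  · exact shiftLabel_eq_of_conn hcn hm (fun h' => hm ((hγ _ _ hcn).2 h'))

/-- Shifting the interior of the loop `γ` to the left preserves the other loops, and `γ` is replaced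
by short loops between two neighbouring columns, one below each double bar at which `γ` turns from
below and one more for each double bar of `A`. -/
theorem loopCount_add_le_shift [NeZero M] (hc : OnChain ℓ c) {p : ℤ × ZMod M}
    (hγ : ∀ q, q ∈ γ ↔ Conn c p q)
    (hA : ∀ t e, A t = some e → c t = none → (e + 1, t) ∈ γ ∧ par γ (e + 1) t = 1)
    (hℓ : ∀ q ∈ γ, 0 ≤ q.1 ∧ q.1 < 2 * ℓ)
    (T : Finset (ZMod M)) (hT : ∀ t ∈ T, (∃ y, c t = some y ∧ (y, t - 1) ∈ γ) ∨
      (c t = none ∧ A t ≠ none)) :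
    loopCount ℓ c + T.card ≤ loopCount ℓ (shiftBars γ c A) + 1 := by
  have hcl : Closed c γ := fun q r h => by
    rw [hγ, hγ]; exact ⟨fun h' => h'.trans h, fun h' => h'.trans h.symm⟩
  set d := shiftBars γ c A with hd
  have hlow : ((circleLegs ℓ M).image (shiftLabel γ c d)).card ≤ loopCount ℓ d := by
    refine card_image_le_loopCount _ ?_ ?_ ?_
    · intro a j h
      exact shiftLabel_up hc hcl h
    · intro y j h
      refine shiftLabel_pair (t := j + 1) hc hcl hA d ?_ ?_ h
      · intro y0 h0
        exact ⟨(link_below h0).conn, par_step hc hcl (by rw [h0]; exact some_ne_sub_one y0)⟩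
      · intro h0 a
        exact ⟨par_step hc hcl (by rw [h0]; simp),
          hcl _ _ (link_up (by simp [h0, Touches])).conn⟩
    · intro y j h
      refine shiftLabel_pair (t := j) hc hcl hA d ?_ ?_ h
      · intro y0 h0
        exact ⟨(link_above h0).conn, rfl⟩
      · intro h0 a
        exact ⟨rfl, Iff.rfl⟩
  -- the column and the slot of the short loop that ends at the time `t`
  have hb : ∀ t ∈ T, ∃ b : ℤ, Sum.inr (b, {t}) ∈ (circleLegs ℓ M).image (shiftLabel γ c d) := by
    intro t ht
    have main : ∃ b : ℤ, (b, t - 1) ∈ γ ∧ par γ b (t - 1) = 1 ∧ d t = some (b - 1) := by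
      rcases hT t ht with ⟨y, h1, h2⟩ | ⟨h1, h2⟩
      · have hy := (hc _ _ h1).1
        have h1' : c (t - 1 + 1) = some y := by rwa [sub_add_cancel]
        have hp : par γ y (t - 1) = par γ y t := by
          have := par_step hc hcl (j := t - 1) (a := y) (by rw [h1']; exact some_ne_sub_one y)
          rwa [sub_add_cancel] at this
        rcases two_values (par γ y t) with h0 | h0
        · refine ⟨y + 1, (hcl _ _ (link_below h1').conn).1 h2, ?_, ?_⟩
          · rw [par_succ _ hy, hp, h0, ind_of_mem h2, zero_add]
          · simp only [hd, shiftBars, h1, h0]; simp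
        · refine ⟨y, h2, by rw [hp, h0], ?_⟩
          simp only [hd, shiftBars, h1, h0]; simp
      · obtain ⟨e, he⟩ := Option.ne_none_iff_exists'.1 h2
        obtain ⟨h3, h4⟩ := hA _ _ he h1
        have h1' : c (t - 1 + 1) = none := by rwa [sub_add_cancel]
        refine ⟨e + 1, ?_, ?_, ?_⟩
        · have := hcl _ _ (link_up (c := c) (a := e + 1) (j := t - 1)
            (by rw [h1']; simp [Touches])).conn
          rw [sub_add_cancel] at this
          exact this.2 h3
        · have := par_step hc hcl (j := t - 1) (a := e + 1) (by rw [h1']; simp)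
          rw [sub_add_cancel] at this
          rw [this, h4]
        · simp [hd, shiftBars, h1, he]
    obtain ⟨b, h1, h2, h3⟩ := main
    have hbl := hℓ _ h1
    refine ⟨b, Finset.mem_image.2 ⟨(b, t - 1), mem_circleLegs.2 hbl, ?_⟩⟩
    have hu : unshift γ (b, t - 1) = (b, t - 1) := by
      apply unshift_of_zero
      rw [par_succ _ hbl.1, h2, ind_of_mem h1, add_self_two]
    unfold shiftLabel
    rw [hu, if_pos h1, nextBar_self (by simpa using h3)]
    simp
  choose! b hb using hb
  have hin : ∀ x ∈ ((circleLegs ℓ M).image (loopOf c)).erase (loopOf c p),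
      Sum.inl x ∈ (circleLegs ℓ M).image (shiftLabel γ c d) := by
    intro x hx
    obtain ⟨hne, hx⟩ := Finset.mem_erase.1 hx
    obtain ⟨⟨a, j⟩, hq, rfl⟩ := Finset.mem_image.1 hx
    have hqγ : (a, j) ∉ γ := fun h => hne (loopOf_eq.2 ((hγ _).1 h).symm)
    have hq' := mem_circleLegs.1 hq
    simp only at hq'
    rcases two_values (par γ a j) with h0 | h0
    · refine Finset.mem_image.2 ⟨(a, j), hq, ?_⟩
      have hu : unshift γ (a, j) = (a, j) := by
        apply unshift_of_zero
        rw [par_succ _ hq'.1, h0, ind_of_notMem hqγ, add_zero]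
      unfold shiftLabel
      rw [hu, if_neg hqγ]
    · have ha := par_eq_one_pos h0
      refine Finset.mem_image.2 ⟨(a - 1, j), mem_circleLegs.2 ⟨by simp; omega, by simp; omega⟩, ?_⟩
      have hu : unshift γ (a - 1, j) = (a, j) := by
        rw [unshift_of_one (by rwa [sub_add_cancel]), sub_add_cancel]
      unfold shiftLabel
      rw [hu, if_neg hqγ]
  have hsub : (((circleLegs ℓ M).image (loopOf c)).erase (loopOf c p)).disjSum
      (T.image (fun t => (b t, ({t} : Set (ZMod M))))) ⊆
      (circleLegs ℓ M).image (shiftLabel γ c d) := by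
    intro x hx
    rcases Finset.mem_disjSum.1 hx with ⟨x, hx, rfl⟩ | ⟨x, hx, rfl⟩
    · exact hin x (Finset.inl_mem_disjSum.1 hx)
    · obtain ⟨t, ht, rfl⟩ := Finset.mem_image.1 (Finset.inr_mem_disjSum.1 hx)
      exact hb t ht
  have hcard := Finset.card_le_card hsub
  rw [Finset.card_disjSum, Finset.card_image_of_injOn] at hcard
  · have := Finset.pred_card_le_card_erase (s := (circleLegs ℓ M).image (loopOf c))
      (a := loopOf c p)
    unfold loopCount at hlow ⊢
    omega
  · intro s _ t _ h
    simpa using congrArg Prod.snd h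

end shift

/-! ### The time window -/

section window

variable {M : ℕ}

/-- For the times `0, …, n` there is a double bar at each even edge and none at the odd edges. -/
def Windowed (ℓ n : ℕ) (c : Bars M) : Prop :=
  (∀ y : ℤ, 0 ≤ y → y + 1 < 2 * ℓ → Even y → ∃ j : ZMod M, j.val ≤ n ∧ c j = some y) ∧
    ∀ (j : ZMod M) (y : ℤ), j.val ≤ n → c j = some y → Even y

variable {ℓ n : ℕ} [NeZero M] {c : Bars M} {γ : Set (ℤ × ZMod M)}

theorem Windowed.even (hw : Windowed ℓ n c) (hn : n < M) {i : ℕ} (hi : i ≤ n) {y : ℤ}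
    (h : c (i : ZMod M) = some y) : Even y :=
  hw.2 _ y (by rwa [ZMod.val_natCast_of_lt (by omega)]) h

/-- In the window the two columns of an even edge belong to the same loop. -/
theorem Windowed.conn_pair (hw : Windowed ℓ n c) (hn : n < M) {a : ℤ} (h0 : 0 ≤ a)
    (h1 : a + 1 < 2 * ℓ) (ha : Even a) : Conn c (a, 0) (a + 1, 0) := by
  have hex : ∃ i : ℕ, i ≤ n ∧ c (i : ZMod M) = some a := by
    obtain ⟨j, hj, hc⟩ := hw.1 a h0 h1 ha
    exact ⟨j.val, hj, by rwa [ZMod.natCast_zmod_val]⟩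
  obtain ⟨hin, hia⟩ := Nat.find_spec hex
  have hmin : ∀ k < Nat.find hex, c (k : ZMod M) ≠ some a := fun k hk h =>
    Nat.find_min hex hk ⟨by omega, h⟩
  generalize Nat.find hex = i at *
  have hodd1 : ¬ Even (a - 1) := by rw [Int.not_even_iff_odd]; exact ha.sub_odd odd_one
  have hodd2 : ¬ Even (a + 1) := by rw [Int.not_even_iff_odd]; exact ha.add_odd odd_one
  have hup : ∀ k : ℕ, k < i → Conn c (a, 0) (a, (k : ZMod M)) ∧
      Conn c (a + 1, 0) (a + 1, (k : ZMod M)) := by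
    intro k
    induction k with
    | zero => intro _; simpa using ⟨Conn.refl c _, Conn.refl c _⟩
    | succ k ih =>
      intro hk
      obtain ⟨ih1, ih2⟩ := ih (by omega)
      have hno : ∀ y, c ((k : ZMod M) + 1) = some y → Even y ∧ y ≠ a := by
        intro y hy
        have hy' : c ((k + 1 : ℕ) : ZMod M) = some y := by push_cast; exact hy
        refine ⟨hw.even hn (by omega) hy', ?_⟩
        rintro rfl
        exact hmin _ hk hy'
      push_cast
      constructor
      · refine ih1.trans (link_up ?_).conn
        rintro (h | h)
        · exact (hno _ h).2 rfl
        · exact hodd1 (hno _ h).1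
      · refine ih2.trans (link_up ?_).conn
        rintro (h | h)
        · exact hodd2 (hno _ h).1
        · exact (hno _ h).2 (by ring)
  rcases Nat.eq_zero_or_pos i with rfl | hi
  · simpa using (link_above hia).conn
  · obtain ⟨h2, h3⟩ := hup (i - 1) (by omega)
    refine h2.trans (Conn.trans (link_below ?_).conn h3.symm)
    rw [← hia]; congr 1
    have : i = (i - 1) + 1 := by omega
    conv_rhs => rw [this]
    push_cast; ring

/-- The sites `0` to `2k - 1` form `k` pairs of columns of the same loop. -/
theorem Windowed.par_start (hw : Windowed ℓ n c) (hn : n < M) (hγ : Closed c γ) (k : ℕ)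
    (hk : k ≤ ℓ) : par γ (2 * k) 0 = 0 := by
  induction k with
  | zero => exact par_zero _ (by simp) _
  | succ k ih =>
    have e : (2 * ((k + 1 : ℕ) : ℤ)) = 2 * (k : ℤ) + 1 + 1 := by push_cast; ring
    rw [e, par_succ _ (by omega), par_succ _ (by omega), ih (by omega),
      ind_eq hγ (hw.conn_pair hn (a := 2 * (k : ℤ)) (by omega) (by omega) (by simp)), zero_add,
      add_self_two]

/-- In the window nothing separates the columns to the left of an even site from each other but
even edges, so that no loop has an odd number of legs there. -/
theorem Windowed.par_even (hw : Windowed ℓ n c) (hc : OnChain ℓ c) (hn : n < M)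
    (hγ : Closed c γ) {a : ℤ} (ha : Even a) (ha2 : a ≤ 2 * ℓ) {j : ZMod M} (hj : j.val ≤ n) :
    par γ a j = 0 := by
  have hodd1 : ¬ Even (a - 1) := by rw [Int.not_even_iff_odd]; exact ha.sub_odd odd_one
  have : ∀ i : ℕ, i ≤ n → par γ a (i : ZMod M) = 0 := by
    intro i
    induction i with
    | zero =>
      intro _
      rcases le_or_gt a 0 with h | h
      · exact par_zero _ h _
      · obtain ⟨k, hk⟩ := ha
        have := hw.par_start hn hγ k.toNat (by omega)
        rw [show (2 * ((k.toNat : ℕ) : ℤ)) = a by omega] at this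
        simpa using this
    | succ i ih =>
      intro hi
      rw [← ih (by omega)]
      push_cast
      refine (par_step hc hγ fun h => hodd1 ?_).symm
      refine hw.even hn hi ?_
      push_cast; exact h
  have h := this j.val hj
  rwa [ZMod.natCast_zmod_val] at h

/-- At every time a loop has an even number of legs. -/
theorem Windowed.par_total (hw : Windowed ℓ n c) (hc : OnChain ℓ c) (hn : n < M)
    (hγ : Closed c γ) (j : ZMod M) : par γ (2 * ℓ) j = 0 := by
  have : ∀ i : ℕ, par γ (2 * ℓ) (i : ZMod M) = 0 := by
    intro i
    induction i with
    | zero => simpa using hw.par_start hn hγ ℓ le_rfl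
    | succ i ih =>
      rw [← ih]
      push_cast
      refine (par_step hc hγ fun h => ?_).symm
      have := (hc _ _ h).2
      omega
  have h := this j.val
  rwa [ZMod.natCast_zmod_val] at h

/-- The sites `a` such that the leg `(a, j)` belongs to `γ`. -/
def slice (ℓ : ℕ) (γ : Set (ℤ × ZMod M)) (j : ZMod M) : Finset ℤ :=
  (Finset.Ico (0 : ℤ) (2 * ℓ)).filter (fun a => (a, j) ∈ γ)

/-- The sites `a` such that the leg `(a, j)` belongs to `γ` and has the interior of `γ` to its
left. -/
def rightSlice (ℓ : ℕ) (γ : Set (ℤ × ZMod M)) (j : ZMod M) : Finset ℤ :=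
  (Finset.Ico (0 : ℤ) (2 * ℓ)).filter (fun a => (a, j) ∈ γ ∧ par γ a j = 1)

/-- From left to right, the legs of `γ` have the interior on their right and on their left in turn. -/
theorem card_slice_aux (γ : Set (ℤ × ZMod M)) (j : ZMod M) (k : ℕ) :
    ((Finset.Ico (0 : ℤ) k).filter (fun a => (a, j) ∈ γ)).card =
      2 * ((Finset.Ico (0 : ℤ) k).filter (fun a => (a, j) ∈ γ ∧ par γ a j = 1)).card +
        (par γ k j).val := by
  induction k with
  | zero => simp [par_zero]
  | succ k ih =>
    have e : Finset.Ico (0 : ℤ) ((k + 1 : ℕ) : ℤ) = insert (k : ℤ) (Finset.Ico (0 : ℤ) k) := by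
      ext z; simp only [Finset.mem_Ico, Finset.mem_insert]; omega
    rw [e, Finset.filter_insert, Finset.filter_insert]
    push_cast
    rw [par_succ _ (by omega)]
    by_cases hm : ((k : ℤ), j) ∈ γ
    · rw [if_pos hm, Finset.card_insert_of_notMem (by simp), ih, ind_of_mem hm]
      rcases two_values (par γ k j) with h0 | h0
      · rw [if_neg (by rw [h0]; simp), h0]
        simp [ZMod.val_one]
      · rw [if_pos ⟨hm, h0⟩, Finset.card_insert_of_notMem (by simp), h0]
        have : ((1 : ZMod 2) + 1).val = 0 := rfl
        have h1 : ((1 : ZMod 2)).val = 1 := rfl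
        omega
    · rw [if_neg hm, if_neg (fun h => hm h.1), ih, ind_of_notMem hm, add_zero]

theorem Windowed.card_slice (hw : Windowed ℓ n c) (hc : OnChain ℓ c) (hn : n < M)
    (hγ : Closed c γ) (j : ZMod M) : (slice ℓ γ j).card = 2 * (rightSlice ℓ γ j).card := by
  have := card_slice_aux γ j (2 * ℓ)
  push_cast at this
  rw [hw.par_total hc hn hγ j] at this
  simpa [slice, rightSlice] using this

end window

/-! ### Walking along a loop -/

section walk

variable {M : ℕ}

/-- The time at which a trajectory leaves a leg.  Trajectories run upwards above the even sites and
downwards above the odd sites. -/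
def ahead (q : ℤ × ZMod M) : ZMod M := if Even q.1 then q.2 + 1 else q.2

/-- The time at which a trajectory enters a leg. -/
def behind (q : ℤ × ZMod M) : ZMod M := if Even q.1 then q.2 else q.2 + 1

/-- The next leg on the same column. -/
def fwd (q : ℤ × ZMod M) : ℤ × ZMod M := if Even q.1 then (q.1, q.2 + 1) else (q.1, q.2 - 1)

/-- The previous leg on the same column. -/
def back (q : ℤ × ZMod M) : ℤ × ZMod M := if Even q.1 then (q.1, q.2 - 1) else (q.1, q.2 + 1)

/-- The leg on the next column to the right (`true`) or to the left (`false`). -/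
def side (q : ℤ × ZMod M) (d : Bool) : ℤ × ZMod M := (if d then q.1 + 1 else q.1 - 1, q.2)

/-- The edge to the right (`true`) or to the left (`false`) of a leg. -/
def edgeAt (q : ℤ × ZMod M) (d : Bool) : ℤ := if d then q.1 else q.1 - 1

/-- The move of the trajectory at the end of a leg: straight on (`none`), or a turn to the column on
the right (`some true`) or on the left (`some false`). -/
def move (c : Bars M) (q : ℤ × ZMod M) : Option Bool :=
  if c (ahead q) = some q.1 then some true
  else if c (ahead q) = some (q.1 - 1) then some false else none

/-- The leg that is reached by a move. -/
def follow (q : ℤ × ZMod M) : Option Bool → ℤ × ZMod M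
  | none => fwd q
  | some d => side q d

/-- The next leg of the trajectory. -/
def next (c : Bars M) (q : ℤ × ZMod M) : ℤ × ZMod M := follow q (move c q)

/-- The previous leg of the trajectory. -/
def prev (c : Bars M) (q : ℤ × ZMod M) : ℤ × ZMod M :=
  if c (behind q) = some q.1 then side q true
  else if c (behind q) = some (q.1 - 1) then side q false else back q

theorem not_even_add_one {a : ℤ} (h : Even a) : ¬ Even (a + 1) := by
  rw [Int.not_even_iff_odd]; exact h.add_odd odd_one

theorem not_even_sub_one {a : ℤ} (h : Even a) : ¬ Even (a - 1) := by
  rw [Int.not_even_iff_odd]; exact h.sub_odd odd_one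

theorem even_add_one {a : ℤ} (h : ¬ Even a) : Even (a + 1) :=
  (Int.not_even_iff_odd.1 h).add_odd odd_one

theorem even_sub_one {a : ℤ} (h : ¬ Even a) : Even (a - 1) :=
  (Int.not_even_iff_odd.1 h).sub_odd odd_one

theorem ahead_of_even {a : ℤ} (h : Even a) (j : ZMod M) : ahead (a, j) = j + 1 := if_pos h

theorem ahead_of_odd {a : ℤ} (h : ¬ Even a) (j : ZMod M) : ahead (a, j) = j := if_neg h

theorem behind_of_even {a : ℤ} (h : Even a) (j : ZMod M) : behind (a, j) = j := if_pos h

theorem behind_of_odd {a : ℤ} (h : ¬ Even a) (j : ZMod M) : behind (a, j) = j + 1 := if_neg h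

theorem fwd_of_even {a : ℤ} (h : Even a) (j : ZMod M) : fwd (a, j) = (a, j + 1) := if_pos h

theorem fwd_of_odd {a : ℤ} (h : ¬ Even a) (j : ZMod M) : fwd (a, j) = (a, j - 1) := if_neg h

theorem back_of_even {a : ℤ} (h : Even a) (j : ZMod M) : back (a, j) = (a, j - 1) := if_pos h

theorem back_of_odd {a : ℤ} (h : ¬ Even a) (j : ZMod M) : back (a, j) = (a, j + 1) := if_neg h

theorem behind_side (q : ℤ × ZMod M) (d : Bool) : behind (side q d) = ahead q := by
  obtain ⟨a, j⟩ := q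
  by_cases he : Even a
  · rw [ahead_of_even he]
    cases d
    · exact behind_of_odd (not_even_sub_one he) j
    · exact behind_of_odd (not_even_add_one he) j
  · rw [ahead_of_odd he]
    cases d
    · exact behind_of_even (even_sub_one he) j
    · exact behind_of_even (even_add_one he) j

theorem behind_fwd (q : ℤ × ZMod M) : behind (fwd q) = ahead q := by
  obtain ⟨a, j⟩ := q
  by_cases he : Even a
  · rw [ahead_of_even he, fwd_of_even he, behind_of_even he]
  · rw [ahead_of_odd he, fwd_of_odd he, behind_of_odd he, sub_add_cancel]

theorem back_fwd (q : ℤ × ZMod M) : back (fwd q) = q := by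
  obtain ⟨a, j⟩ := q
  by_cases he : Even a
  · rw [fwd_of_even he, back_of_even he, add_sub_cancel_right]
  · rw [fwd_of_odd he, back_of_odd he, sub_add_cancel]

theorem fwd_fst (q : ℤ × ZMod M) : (fwd q).1 = q.1 := by unfold fwd; split_ifs <;> rfl

/-- The three possible moves. -/
theorem move_cases (c : Bars M) (q : ℤ × ZMod M) :
    (∃ d, move c q = some d ∧ c (ahead q) = some (edgeAt q d)) ∨
      (move c q = none ∧ ¬ Touches (c (ahead q)) q.1) := by
  unfold move Touches
  split_ifs with h1 h2
  · exact Or.inl ⟨true, rfl, by simpa [edgeAt] using h1⟩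
  · exact Or.inl ⟨false, rfl, by simpa [edgeAt] using h2⟩
  · exact Or.inr ⟨rfl, by tauto⟩

theorem move_eq_some {c : Bars M} {q : ℤ × ZMod M} {d : Bool} :
    move c q = some d ↔ c (ahead q) = some (edgeAt q d) := by
  rcases move_cases c q with ⟨e, h1, h2⟩ | ⟨h1, h2⟩
  · rw [h1, h2]
    simp only [Option.some.injEq, edgeAt]
    have : q.1 ≠ q.1 - 1 := by omega
    cases d <;> cases e <;> simp [this, this.symm]
  · rw [h1]
    simp only [reduceCtorEq, false_iff]
    intro h
    apply h2
    rw [h]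
    cases d
    · exact Or.inr rfl
    · exact Or.inl rfl

theorem move_eq_none {c : Bars M} {q : ℤ × ZMod M} :
    move c q = none ↔ ¬ Touches (c (ahead q)) q.1 := by
  rcases move_cases c q with ⟨e, h1, h2⟩ | ⟨h1, h2⟩
  · rw [h1]
    simp only [reduceCtorEq, false_iff, not_not]
    rw [h2]
    cases e
    · exact Or.inr rfl
    · exact Or.inl rfl
  · exact ⟨fun _ => h2, fun _ => h1⟩

theorem prev_next (c : Bars M) (q : ℤ × ZMod M) : prev c (next c q) = q := by
  unfold next
  rcases move_cases c q with ⟨d, h1, h2⟩ | ⟨h1, h2⟩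
  · rw [h1]
    simp only [follow, prev, behind_side, h2]
    cases d
    · simp [edgeAt, side]
    · have : q.1 ≠ q.1 + 1 := by omega
      simp [edgeAt, side, this]
  · rw [h1]
    simp only [follow, prev, behind_fwd, fwd_fst, back_fwd]
    rw [if_neg (fun h => h2 (Or.inl h)), if_neg (fun h => h2 (Or.inr h))]

theorem next_injective (c : Bars M) : Function.Injective (next c) :=
  Function.LeftInverse.injective (prev_next c)

theorem conn_next (c : Bars M) (q : ℤ × ZMod M) : Conn c q (next c q) := by
  obtain ⟨a, j⟩ := q
  unfold next
  rcases move_cases c (a, j) with ⟨d, h1, h2⟩ | ⟨h1, h2⟩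
  · rw [h1]
    have h3 : Conn c (edgeAt (a, j) d, j) (edgeAt (a, j) d + 1, j) := by
      by_cases he : Even a
      · rw [ahead_of_even he] at h2; exact (link_below h2).conn
      · rw [ahead_of_odd he] at h2; exact (link_above h2).conn
    cases d
    · simp only [edgeAt, Bool.false_eq_true, if_false, sub_add_cancel] at h3
      exact h3.symm
    · exact h3
  · rw [h1]
    by_cases he : Even a
    · simp only [ahead, he, if_true] at h2
      simpa [follow, fwd, he] using (link_up h2).conn
    · simp only [ahead, he, if_false] at h2
      have := (link_up (c := c) (a := a) (j := j - 1) (by simpa using h2)).conn.symm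
      simpa [follow, fwd, he] using this

theorem conn_iterate_next (c : Bars M) (q : ℤ × ZMod M) (i : ℕ) : Conn c q ((next c)^[i] q) := by
  induction i with
  | zero => exact Conn.refl _ _
  | succ i ih => rw [Function.iterate_succ_apply']; exact ih.trans (conn_next c _)

/-- The walk uses every link, in one of the two directions. -/
theorem Link.next_eq {c : Bars M} {p q : ℤ × ZMod M} (h : Link c p q) :
    next c p = q ∨ next c q = p := by
  obtain ⟨a, j⟩ := p
  rcases h with ⟨rfl, h⟩ | ⟨rfl, h⟩
  · by_cases he : Even a
    · left
      have : move c (a, j) = none := by rw [move_eq_none]; simpa [ahead, he] using h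
      unfold next; rw [this]; simp [follow, fwd, he]
    · right
      have : move c (a, j + 1) = none := by rw [move_eq_none]; simpa [ahead, he] using h
      unfold next; rw [this]; simp [follow, fwd, he]
  · have e : ∀ (p q : ℤ × ZMod M) (d : Bool), c (ahead p) = some (edgeAt p d) → q = side p d →
        next c p = q := by
      intro p q d h1 h2
      unfold next; rw [move_eq_some.2 h1, h2]; rfl
    by_cases he : Even a
    · have e1 := not_even_add_one he
      rcases h with h | h
      · right; exact e _ _ false (by simpa [ahead, e1, edgeAt] using h) (by simp [side])
      · left; exact e _ _ true (by simpa [ahead, he, edgeAt] using h) (by simp [side])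
    · have e1 := even_add_one he
      rcases h with h | h
      · left; exact e _ _ true (by simpa [ahead, he, edgeAt] using h) (by simp [side])
      · right; exact e _ _ false (by simpa [ahead, e1, edgeAt] using h) (by simp [side])

theorem next_mem_circleLegs [NeZero M] {ℓ : ℕ} {c : Bars M} (hc : OnChain ℓ c) {q : ℤ × ZMod M}
    (hq : q ∈ circleLegs ℓ M) : next c q ∈ circleLegs ℓ M := by
  rw [mem_circleLegs] at *
  unfold next
  rcases move_cases c q with ⟨d, h1, h2⟩ | ⟨h1, h2⟩
  · rw [h1]
    have := hc _ _ h2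
    cases d <;> simp [edgeAt, follow, side] at * <;> omega
  · rw [h1]
    unfold follow fwd
    split_ifs <;> exact hq

/-- The length of the loop through a leg. -/
def loopLength (c : Bars M) (p : ℤ × ZMod M) : ℕ := Function.minimalPeriod (next c) p

theorem loopLength_pos [NeZero M] {ℓ : ℕ} {c : Bars M} (hc : OnChain ℓ c) {p : ℤ × ZMod M}
    (hp : p ∈ circleLegs ℓ M) : 0 < loopLength c p := by
  apply Function.minimalPeriod_pos_of_mem_periodicPts
  have hmem : ∀ i, (next c)^[i] p ∈ circleLegs ℓ M := by
    intro i
    induction i with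
    | zero => exact hp
    | succ i ih => rw [Function.iterate_succ_apply']; exact next_mem_circleLegs hc ih
  obtain ⟨i, j, hij, h⟩ := Finite.exists_ne_map_eq_of_infinite
    (fun i : ℕ => (⟨(next c)^[i] p, hmem i⟩ : circleLegs ℓ M))
  simp only [Subtype.mk.injEq] at h
  wlog hlt : i < j generalizing i j
  · exact this j i hij.symm h.symm (by omega)
  refine ⟨j - i, by omega, ?_⟩
  have : (next c)^[i] ((next c)^[j - i] p) = (next c)^[i] p := by
    rw [← Function.iterate_add_apply, h]; congr 1; omega
  exact (next_injective c).iterate i this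

theorem iterate_loopLength (c : Bars M) (p : ℤ × ZMod M) : (next c)^[loopLength c p] p = p :=
  Function.iterate_minimalPeriod

theorem iterate_injOn (c : Bars M) (p : ℤ × ZMod M) {i j : ℕ} (hi : i < loopLength c p)
    (hj : j < loopLength c p) (h : (next c)^[i] p = (next c)^[j] p) : i = j :=
  Function.iterate_injOn_Iio_minimalPeriod hi hj h

/-- The walk that starts in a leg runs through the whole loop. -/
theorem Conn.exists_iterate [NeZero M] {ℓ : ℕ} {c : Bars M} (hc : OnChain ℓ c)
    {p q : ℤ × ZMod M} (hp : p ∈ circleLegs ℓ M) (h : Conn c p q) :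
    ∃ i < loopLength c p, (next c)^[i] p = q := by
  have hpos := loopLength_pos hc hp
  set S : Set (ℤ × ZMod M) := {q | ∃ i < loopLength c p, (next c)^[i] p = q} with hS
  have hnext : ∀ q, q ∈ S ↔ next c q ∈ S := by
    intro q
    constructor
    · rintro ⟨i, hi, rfl⟩
      rcases Nat.lt_or_ge (i + 1) (loopLength c p) with h1 | h1
      · exact ⟨i + 1, h1, Function.iterate_succ_apply' _ _ _⟩
      · refine ⟨0, hpos, ?_⟩
        rw [← Function.iterate_succ_apply' (next c), show i.succ = loopLength c p by omega,
          iterate_loopLength]; rfl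
    · rintro ⟨i, hi, h1⟩
      cases i with
      | zero =>
        refine ⟨loopLength c p - 1, by omega, next_injective c ?_⟩
        rw [← Function.iterate_succ_apply' (next c), ← h1,
          show (loopLength c p - 1).succ = loopLength c p by omega, iterate_loopLength]; rfl
      | succ i =>
        refine ⟨i, by omega, next_injective c ?_⟩
        rw [← Function.iterate_succ_apply' (next c), h1]
  have key : ∀ p q, Conn c p q → (p ∈ S ↔ q ∈ S) := by
    intro p q h
    induction h with
    | rel p q h =>
      rcases h.next_eq with rfl | rfl
      · exact hnext p
      · exact (hnext q).symm
    | refl => rfl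
    | symm _ _ _ ih => exact ih.symm
    | trans _ _ _ _ _ ih1 ih2 => exact ih1.trans ih2
  exact (key p q h).1 ⟨0, hpos, rfl⟩

/-- The first `r` moves of the walk from `q`. -/
def code (c : Bars M) : (ℤ × ZMod M) → ℕ → List (Option Bool)
  | _, 0 => []
  | q, r + 1 => move c q :: code c (next c q) r

/-- The times of the turns among the first `r` moves of the walk from `q`. -/
def turnTimes (c : Bars M) : (ℤ × ZMod M) → ℕ → Finset (ZMod M)
  | _, 0 => ∅
  | q, r + 1 => if move c q = none then turnTimes c (next c q) r
      else insert (ahead q) (turnTimes c (next c q) r)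

theorem length_code (c : Bars M) (q : ℤ × ZMod M) (r : ℕ) : (code c q r).length = r := by
  induction r generalizing q with
  | zero => rfl
  | succ r ih => simp [code, ih]

theorem take_code (c : Bars M) (q : ℤ × ZMod M) {r s : ℕ} (h : r ≤ s) :
    (code c q s).take r = code c q r := by
  induction r generalizing q s with
  | zero => rfl
  | succ r ih =>
    cases s with
    | zero => omega
    | succ s => simp [code, ih (next c q) (show r ≤ s by omega)]

/-- The walk can be recovered from its moves. -/
theorem code_determines {c c' : Bars M} {q : ℤ × ZMod M} {r : ℕ}
    (h : code c q r = code c' q r) :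
    (∀ i ≤ r, (next c)^[i] q = (next c')^[i] q) ∧ turnTimes c q r = turnTimes c' q r ∧
      ∀ t ∈ turnTimes c q r, c t = c' t := by
  induction r generalizing q with
  | zero =>
    refine ⟨fun i hi => ?_, rfl, by simp [turnTimes]⟩
    rw [show i = 0 by omega]; rfl
  | succ r ih =>
    simp only [code, List.cons.injEq] at h
    have hn : next c q = next c' q := by unfold next; rw [h.1]
    obtain ⟨h1, h2, h3⟩ := ih (q := next c q) (by rw [h.2, hn])
    refine ⟨fun i hi => ?_, ?_, ?_⟩
    · cases i with
      | zero => rfl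
      | succ i =>
        rw [Function.iterate_succ_apply, Function.iterate_succ_apply, ← hn, h1 i (by omega)]
    · simp only [turnTimes, ← h.1, ← hn, h2]
    · intro t ht
      simp only [turnTimes] at ht
      split_ifs at ht with hm
      · exact h3 t ht
      · rcases Finset.mem_insert.1 ht with rfl | ht
        · obtain ⟨d, hd⟩ := Option.ne_none_iff_exists'.1 hm
          have hd' : move c' q = some d := by rw [← h.1, hd]
          rw [move_eq_some.1 hd, move_eq_some.1 hd']
        · exact h3 t ht

theorem mem_turnTimes {c : Bars M} {q : ℤ × ZMod M} {r : ℕ} {t : ZMod M} :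
    t ∈ turnTimes c q r ↔
      ∃ i < r, move c ((next c)^[i] q) ≠ none ∧ ahead ((next c)^[i] q) = t := by
  induction r generalizing q with
  | zero => simp [turnTimes]
  | succ r ih =>
    have : (∃ i < r + 1, move c ((next c)^[i] q) ≠ none ∧ ahead ((next c)^[i] q) = t) ↔
        (move c q ≠ none ∧ ahead q = t) ∨
          ∃ i < r, move c ((next c)^[i] (next c q)) ≠ none ∧
            ahead ((next c)^[i] (next c q)) = t := by
      constructor
      · rintro ⟨i, hi, h⟩
        cases i with
        | zero => exact Or.inl h
        | succ i => exact Or.inr ⟨i, by omega, h⟩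
      · rintro (h | ⟨i, hi, h⟩)
        · exact ⟨0, by omega, h⟩
        · exact ⟨i + 1, by omega, h⟩
    rw [this, ← ih]
    simp only [turnTimes]
    split_ifs with hm
    · simp [hm]
    · simp [hm, eq_comm]

end walk

/-! ### The total weight of the walks with a given sequence of turns -/

section pathWeight

variable {M : ℕ}

/-- The factor for walking through a leg outside the window. -/
def decay (n : ℕ) (q : ℤ × ZMod M) : ℝ := if n ≤ q.2.val then Real.exp (-(1 / (2 * n))) else 1

/-- The weight of a walk that starts in `q`, given by its moves, when the double bars of `s` are
known already: a factor `1/n` for each newly met double bar, and a decay for each leg outside the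
window.  It vanishes if the walk is not consistent with the known double bars, or finds a new one in
the window. -/
def pathWeight (n : ℕ) : (ℤ × ZMod M) → Bars M → List (Option Bool) → ℝ
  | _, _, [] => 1
  | q, s, none :: l =>
    if Touches (s (ahead q)) q.1 then 0 else decay n q * pathWeight n (fwd q) s l
  | q, s, some d :: l =>
    if s (ahead q) = some (edgeAt q d) then decay n q * pathWeight n (side q d) s l
    else if Touches (s (ahead q)) q.1 ∨ (ahead q).val ≤ n then 0
    else decay n q * (1 / n) *
      pathWeight n (side q d) (Function.update s (ahead q) (some (edgeAt q d))) l

theorem decay_pos (n : ℕ) (q : ℤ × ZMod M) : 0 < decay n q := by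
  unfold decay; split_ifs <;> positivity

theorem decay_le_one (n : ℕ) (q : ℤ × ZMod M) : decay n q ≤ 1 := by
  unfold decay; split_ifs
  · apply Real.exp_le_one_iff.2; simp
  · exact le_rfl

theorem pathWeight_nonneg (n : ℕ) (q : ℤ × ZMod M) (s : Bars M) (l : List (Option Bool)) :
    0 ≤ pathWeight n q s l := by
  induction l generalizing q s with
  | nil => simp [pathWeight]
  | cons o l ih =>
    have hd := (decay_pos n q).le
    cases o with
    | none => simp only [pathWeight]; split_ifs; exacts [le_rfl, mul_nonneg hd (ih _ _)]
    | some d =>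
      simp only [pathWeight]
      split_ifs
      · exact mul_nonneg hd (ih _ _)
      · exact le_rfl
      · exact mul_nonneg (mul_nonneg hd (by positivity)) (ih _ _)

/-- The exponential decay along a leg compensates for the density of new double bars. -/
theorem decay_mul_le [NeZero M] {n : ℕ} {q : ℤ × ZMod M} (h : n < (ahead q).val) :
    decay n q * (1 + 1 / (2 * n)) ≤ 1 := by
  have hq : n ≤ q.2.val := by
    unfold ahead at h
    split_ifs at h
    · have := ZMod.val_add_le q.2 1
      have h1 : (1 : ZMod M).val ≤ 1 := by
        rw [ZMod.val_one_eq_one_mod]; exact Nat.mod_le _ _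
      omega
    · omega
  unfold decay
  rw [if_pos hq, Real.exp_neg]
  have h1 := Real.add_one_le_exp (1 / (2 * (n : ℝ)))
  rw [inv_mul_le_iff₀ (Real.exp_pos _)]
  linarith

/-- Summing over lists by their first entry. -/
theorem sum_lists_eq {X : Type*} [Fintype X] [DecidableEq X] (C : Finset (List X))
    (h0 : [] ∉ C) (f : List X → ℝ) :
    ∑ l ∈ C, f l =
      ∑ o : X, ∑ l ∈ C.preimage (List.cons o) (List.cons_injective.injOn), f (o :: l) := by
  have h1 : ∀ o : X, ∑ l ∈ C.preimage (List.cons o) (List.cons_injective.injOn), f (o :: l) =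
      ∑ l ∈ C.filter (fun l => l.head? = some o), f l := by
    intro o
    refine Finset.sum_bij (fun l _ => o :: l) ?_ ?_ ?_ ?_
    · intro l hl; simpa using hl
    · intro l _ l' _ h; simpa using h
    · intro l hl
      obtain ⟨h1, h2⟩ := Finset.mem_filter.1 hl
      cases l with
      | nil => simp at h2
      | cons o' l =>
        simp only [List.head?_cons, Option.some.injEq] at h2
        subst h2
        exact ⟨l, by simpa using h1, rfl⟩
    · intro l _; rfl
  simp only [h1]
  rw [← Finset.sum_fiberwise_of_maps_to (s := C) (t := Finset.univ.image (some : X → Option X))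
    (g := fun l => l.head?)]
  · rw [Finset.sum_image (by intro a _ b _ h; simpa using h)]
  · intro l hl
    cases l with
    | nil => exact absurd hl h0
    | cons o l => simp

/-- The total weight of walks with `k` given turns is at most `2 ^ k`, whatever is known at the
start: in a family without proper prefixes every run between two turns contributes at most
`∑ (1/n) e^{-i/(2n)} ≤ 2`. -/
theorem sum_pathWeight_le [NeZero M] {n : ℕ} (hn : 0 < n) (b : ℕ) :
    ∀ (q : ℤ × ZMod M) (s : Bars M) (ds : List Bool) (C : Finset (List (Option Bool))),
      (∀ l ∈ C, l.length ≤ b ∧ l.reduceOption = ds) →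
      (∀ l ∈ C, ∀ l' ∈ C, l <+: l' → l = l') →
      ∑ l ∈ C, pathWeight n q s l ≤ 2 ^ ds.length := by
  have hpow : ∀ ds : List Bool, (1 : ℝ) ≤ 2 ^ ds.length := fun ds =>
    one_le_pow₀ (by norm_num)
  have hnil : ∀ (q : ℤ × ZMod M) (s : Bars M) (C : Finset (List (Option Bool))),
      C ⊆ {[]} → ∑ l ∈ C, pathWeight n q s l ≤ 1 := by
    intro q s C h
    refine (Finset.sum_le_sum_of_subset_of_nonneg h
      (fun _ _ _ => pathWeight_nonneg _ _ _ _)).trans ?_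
    simp [pathWeight]
  induction b with
  | zero =>
    intro q s ds C h1 _
    refine (hnil q s C ?_).trans (hpow ds)
    intro l hl
    simpa using (h1 l hl).1
  | succ b ih =>
    intro q s ds C h1 h2
    by_cases h0 : [] ∈ C
    · refine (hnil q s C ?_).trans (hpow ds)
      intro l hl
      have := h2 _ h0 l hl List.nil_prefix
      simp [← this]
    rw [sum_lists_eq C h0]
    set P : Option Bool → Finset (List (Option Bool)) :=
      fun o => C.preimage (List.cons o) (List.cons_injective.injOn) with hP
    have hmem : ∀ o l, l ∈ P o ↔ o :: l ∈ C := fun o l => Finset.mem_preimage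
    have hpre : ∀ o, ∀ l ∈ P o, ∀ l' ∈ P o, l <+: l' → l = l' := by
      intro o l hl l' hl' h
      have := h2 _ ((hmem _ _).1 hl) _ ((hmem _ _).1 hl') ((List.prefix_cons_inj o).2 h)
      simpa using this
    have hlen : ∀ o, ∀ l ∈ P o, l.length ≤ b := by
      intro o l hl
      have := (h1 _ ((hmem _ _).1 hl)).1
      simpa using this
    have hnone : ∀ (q : ℤ × ZMod M) (s : Bars M),
        ∑ l ∈ P none, pathWeight n q s l ≤ 2 ^ ds.length := by
      intro q s
      refine ih q s ds _ (fun l hl => ⟨hlen _ l hl, ?_⟩) (hpre _)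
      have := (h1 _ ((hmem _ _).1 hl)).2
      simpa using this
    have hempty : ∀ d ds', ds = d :: ds' → P (some (!d)) = ∅ := by
      intro d ds' h
      apply Finset.eq_empty_of_forall_notMem
      intro l hl
      have := (h1 _ ((hmem _ _).1 hl)).2
      rw [h] at this
      simp at this
    have hsome : ∀ (q : ℤ × ZMod M) (s : Bars M) (d : Bool) (ds' : List Bool), ds = d :: ds' →
        ∑ l ∈ P (some d), pathWeight n q s l ≤ 2 ^ ds'.length := by
      intro q s d ds' h
      refine ih q s ds' _ (fun l hl => ⟨hlen _ l hl, ?_⟩) (hpre _)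
      have := (h1 _ ((hmem _ _).1 hl)).2
      rw [h] at this
      simpa using this
    have hd := (decay_pos n q).le
    have hd1 := decay_le_one n q
    have hstraight : ∑ l ∈ P none, pathWeight n q s (none :: l) ≤
        if Touches (s (ahead q)) q.1 then 0 else decay n q * 2 ^ ds.length := by
      simp only [pathWeight]
      split_ifs
      · simp
      · rw [← Finset.mul_sum]
        exact mul_le_mul_of_nonneg_left (hnone _ _) hd
    have hbound : decay n q * 2 ^ ds.length ≤ 2 ^ ds.length :=
      mul_le_of_le_one_left (by positivity) hd1
    rw [Fintype.sum_option, Fintype.sum_bool]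
    rcases ds with _ | ⟨d, ds'⟩
    · have e : ∀ d, P (some d) = ∅ := by
        intro d
        apply Finset.eq_empty_of_forall_notMem
        intro l hl
        have := (h1 _ ((hmem _ _).1 hl)).2
        simp at this
      change ∑ l ∈ P none, _ + (∑ l ∈ P (some true), _ + ∑ l ∈ P (some false), _) ≤ _
      rw [e, e, Finset.sum_empty, Finset.sum_empty, add_zero, add_zero]
      refine hstraight.trans ?_
      split_ifs
      · exact zero_le_one.trans (hpow _)
      · exact hbound
    · have e : ∑ l ∈ P (some true), pathWeight n q s (some true :: l) +
          ∑ l ∈ P (some false), pathWeight n q s (some false :: l) =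
          ∑ l ∈ P (some d), pathWeight n q s (some d :: l) := by
        have := hempty d ds' rfl
        cases d
        · rw [show P (some true) = ∅ from this]; simp
        · rw [show P (some false) = ∅ from this]; simp
      rw [e]
      have hlen2 : (2 : ℝ) ^ (d :: ds').length = 2 * 2 ^ ds'.length := by
        simp [pow_succ, mul_comm]
      have hp0 : (0 : ℝ) < 2 ^ ds'.length := by positivity
      by_cases hT : Touches (s (ahead q)) q.1
      · rw [if_pos hT] at hstraight
        have : ∑ l ∈ P (some d), pathWeight n q s (some d :: l) ≤ 2 ^ ds'.length := by
          simp only [pathWeight, hT, true_or, if_true]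
          split_ifs
          · rw [← Finset.mul_sum]
            exact (mul_le_mul_of_nonneg_left (hsome _ _ d ds' rfl) hd).trans
              (mul_le_of_le_one_left hp0.le hd1)
          · simp
        rw [hlen2]; linarith
      · rw [if_neg hT] at hstraight
        have hne : s (ahead q) ≠ some (edgeAt q d) := by
          intro h; apply hT; rw [h]
          cases d
          · exact Or.inr rfl
          · exact Or.inl rfl
        by_cases hw : (ahead q).val ≤ n
        · have : ∑ l ∈ P (some d), pathWeight n q s (some d :: l) = 0 := by
            simp only [pathWeight, if_neg hne, if_pos (Or.inr hw), Finset.sum_const_zero]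
          linarith
        · have h3 : ∑ l ∈ P (some d), pathWeight n q s (some d :: l) ≤
              decay n q * (1 / n) * 2 ^ ds'.length := by
            simp only [pathWeight, if_neg hne, if_neg (not_or.2 ⟨hT, hw⟩)]
            rw [← Finset.mul_sum]
            exact mul_le_mul_of_nonneg_left (hsome _ _ d ds' rfl)
              (mul_nonneg hd (by positivity))
          have h4 := decay_mul_le (n := n) (q := q) (by omega)
          have h5 : decay n q * 2 ^ (d :: ds').length + decay n q * (1 / n) * 2 ^ ds'.length =
              2 ^ (d :: ds').length * (decay n q * (1 + 1 / (2 * n))) := by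
            rw [hlen2]; field_simp
          have h6 : 2 ^ (d :: ds').length * (decay n q * (1 + 1 / (2 * n))) ≤
              (2 : ℝ) ^ (d :: ds').length := mul_le_of_le_one_right (by positivity) h4
          linarith

/-- The part of a configuration at the times in `D`. -/
def maskBars (c : Bars M) (D : Finset (ZMod M)) : Bars M := fun j => if j ∈ D then c j else none

/-- The weight of a walk along a loop of a configuration. -/
theorem pathWeight_code {n : ℕ} (c : Bars M) (q : ℤ × ZMod M) (r : ℕ) (D : Finset (ZMod M))
    (hD : ∀ j : ZMod M, j.val ≤ n → j ∈ D) :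
    pathWeight n q (maskBars c D) (code c q r) =
      (1 / n) ^ (turnTimes c q r \ D).card * ∏ i ∈ Finset.range r, decay n ((next c)^[i] q) := by
  induction r generalizing q D with
  | zero => simp [code, pathWeight, turnTimes]
  | succ r ih =>
    rw [Finset.prod_range_succ']
    simp only [Function.iterate_succ_apply, Function.iterate_zero, id]
    rcases move_cases c q with ⟨d, h1, h2⟩ | ⟨h1, h2⟩
    · have hn : next c q = side q d := by unfold next; rw [h1]; rfl
      simp only [code, turnTimes, h1, reduceCtorEq, if_false, pathWeight]
      rw [← hn]
      by_cases hm : ahead q ∈ D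
      · rw [if_pos (by simp [maskBars, hm, h2]), ih _ _ hD, Finset.insert_sdiff_of_mem _ hm]
        ring
      · have hnw : ¬ (ahead q).val ≤ n := fun h => hm (hD _ h)
        have e0 : maskBars c D (ahead q) = none := by simp [maskBars, hm]
        rw [if_neg (by rw [e0]; simp), if_neg (by rw [e0]; simp [Touches, hnw])]
        have e1 : Function.update (maskBars c D) (ahead q) (some (edgeAt q d)) =
            maskBars c (insert (ahead q) D) := by
          funext j
          by_cases hj : j = ahead q
          · subst hj; simp [maskBars, h2]
          · simp [maskBars, hj]
        rw [e1, ih _ _ (fun j hj => Finset.mem_insert_of_mem (hD j hj))]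
        have e2 : (insert (ahead q) (turnTimes c (next c q) r) \ D).card =
            (turnTimes c (next c q) r \ insert (ahead q) D).card + 1 := by
          rw [← Finset.card_insert_of_notMem (a := ahead q)
            (s := turnTimes c (next c q) r \ insert (ahead q) D) (by simp)]
          congr 1
          ext j
          simp only [Finset.mem_sdiff, Finset.mem_insert]
          by_cases hj : j = ahead q
          · simp [hj, hm]
          · simp [hj]
        rw [e2, pow_succ]
        ring
    · have hn : next c q = fwd q := by unfold next; rw [h1]; rfl
      simp only [code, turnTimes, h1, if_true, pathWeight]
      rw [if_neg, ← hn, ih _ _ hD]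
      · ring
      · unfold maskBars
        split_ifs
        · exact h2
        · simp [Touches]

end pathWeight

/-! ### The turns of a long loop -/

section turns

variable {M : ℕ}

theorem follow_fst (q : ℤ × ZMod M) (d : Bool) : (side q d).1 = q.1 + sgn d := by
  cases d <;> simp [side, sgn, sub_eq_add_neg]

theorem fst_iterate_next (c : Bars M) (q : ℤ × ZMod M) (r : ℕ) :
    ((next c)^[r] q).1 = q.1 + disp (code c q r).reduceOption := by
  induction r generalizing q with
  | zero => simp [code, disp]
  | succ r ih =>
    rw [Function.iterate_succ_apply, ih]
    simp only [code]
    cases h : move c q with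
    | none =>
      have : (next c q).1 = q.1 := by unfold next; rw [h]; exact fwd_fst q
      rw [this]; simp
    | some d =>
      have : (next c q).1 = q.1 + sgn d := by unfold next; rw [h]; exact follow_fst q d
      rw [this]; simp [disp]; ring

/-- The turns of the walk along the loop through `p`. -/
def turnSeq (c : Bars M) (p : ℤ × ZMod M) : List Bool := (code c p (loopLength c p)).reduceOption

theorem disp_turnSeq (c : Bars M) (p : ℤ × ZMod M) : disp (turnSeq c p) = 0 := by
  have := fst_iterate_next c p (loopLength c p)
  rw [iterate_loopLength] at this
  unfold turnSeq
  omega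

theorem reduceOption_prefix {X : Type*} {l l' : List (Option X)} (h : l <+: l') :
    l.reduceOption <+: l'.reduceOption := by
  obtain ⟨t, rfl⟩ := h
  rw [List.reduceOption_append]
  exact List.prefix_append _ _

theorem code_prefix (c : Bars M) (q : ℤ × ZMod M) {r s : ℕ} (h : r ≤ s) :
    code c q r <+: code c q s := by
  rw [← take_code c q h]; exact List.take_prefix _ _

/-- The turns of the walk that are taken above the even sites, that is, from below. -/
def evenTurns (c : Bars M) (q : ℤ × ZMod M) (r : ℕ) : Finset ℕ :=
  (Finset.range r).filter
    (fun i => move c ((next c)^[i] q) ≠ none ∧ Even ((next c)^[i] q).1)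

/-- The walk changes the parity of its site with each turn, so that turns at even and at odd sites
alternate. -/
theorem length_reduceOption_code (c : Bars M) (q : ℤ × ZMod M) (r : ℕ) :
    ((code c q r).reduceOption.length : ℤ) = 2 * (evenTurns c q r).card -
      (if Even q.1 then 1 else 0) + (if Even ((next c)^[r] q).1 then 1 else 0) := by
  induction r with
  | zero => by_cases he : Even q.1 <;> simp [code, evenTurns, he]
  | succ r ih =>
    have e1 : code c q (r + 1) = code c q r ++ [move c ((next c)^[r] q)] := by
      clear ih
      induction r generalizing q with
      | zero => rfl
      | succ r ih =>
        rw [code, ih (next c q)]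
        rfl
    have e2 : evenTurns c q (r + 1) =
        if move c ((next c)^[r] q) ≠ none ∧ Even ((next c)^[r] q).1 then
          insert r (evenTurns c q r) else evenTurns c q r := by
      unfold evenTurns
      rw [Finset.range_add_one, Finset.filter_insert]
    have e3 : r ∉ evenTurns c q r := by simp [evenTurns]
    rw [e1, List.reduceOption_append, List.length_append, e2, Function.iterate_succ_apply']
    push_cast
    rw [ih]
    generalize (next c)^[r] q = p
    cases h : move c p with
    | none =>
      have : (next c p).1 = p.1 := by unfold next; rw [h]; exact fwd_fst p
      rw [this]; simp
    | some d =>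
      have : (next c p).1 = p.1 + sgn d := by unfold next; rw [h]; exact follow_fst p d
      have hp : Even (next c p).1 ↔ ¬ Even p.1 := by
        rw [this]
        by_cases he : Even p.1
        · simp only [he, not_true, iff_false]
          cases d
          · exact not_even_sub_one he
          · exact not_even_add_one he
        · simp only [he, not_false_eq_true, iff_true]
          cases d
          · exact even_sub_one he
          · exact even_add_one he
      simp only [hp]
      by_cases he : Even p.1
      · simp [he, Finset.card_insert_of_notMem e3]; ring
      · simp [he]

theorem length_turnSeq (c : Bars M) (p : ℤ × ZMod M) :
    (turnSeq c p).length = 2 * (evenTurns c p (loopLength c p)).card := by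
  have := length_reduceOption_code c p (loopLength c p)
  rw [iterate_loopLength] at this
  unfold turnSeq
  omega

variable [NeZero M]

/-- The times of the double bars at which a set of legs turns from below. -/
def topTimes (c : Bars M) (γ : Set (ℤ × ZMod M)) : Finset (ZMod M) :=
  Finset.univ.filter (fun t => ∃ y, c t = some y ∧ (y, t - 1) ∈ γ)

/-- Half of the turns of a loop are turns from below. -/
theorem card_evenTurns_le (c : Bars M) (p : ℤ × ZMod M) {γ : Set (ℤ × ZMod M)}
    (hγ : ∀ q, q ∈ γ ↔ Conn c p q) :
    (evenTurns c p (loopLength c p)).card ≤ (topTimes c γ).card := by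
  refine Finset.card_le_card_of_injOn (fun i => ahead ((next c)^[i] p)) ?_ ?_
  · intro i hi
    obtain ⟨-, hm, he⟩ := Finset.mem_filter.1 hi
    obtain ⟨d, hd⟩ := Option.ne_none_iff_exists'.1 hm
    have hq : (next c)^[i] p ∈ γ := (hγ _).2 (conn_iterate_next c p i)
    rw [move_eq_some] at hd
    refine Finset.mem_coe.2 (Finset.mem_filter.2 ⟨Finset.mem_univ _, ?_⟩)
    change ∃ y, c (ahead ((next c)^[i] p)) = some y ∧ (y, ahead ((next c)^[i] p) - 1) ∈ γ
    generalize (next c)^[i] p = q at *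
    obtain ⟨a, j⟩ := q
    refine ⟨edgeAt (a, j) d, hd, ?_⟩
    · rw [ahead_of_even he] at hd
      simp only [ahead_of_even he, add_sub_cancel_right]
      cases d
      · have := (link_below hd).conn
        simp only [edgeAt, Bool.false_eq_true, if_false, sub_add_cancel] at this ⊢
        rw [hγ] at hq ⊢
        exact hq.trans this.symm
      · exact hq
  · intro i hi i' hi' h
    obtain ⟨h1, hm, he⟩ := Finset.mem_filter.1 hi
    obtain ⟨h1', hm', he'⟩ := Finset.mem_filter.1 hi'
    apply iterate_injOn c p (Finset.mem_range.1 h1) (Finset.mem_range.1 h1')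
    obtain ⟨d, hd⟩ := Option.ne_none_iff_exists'.1 hm
    obtain ⟨d', hd'⟩ := Option.ne_none_iff_exists'.1 hm'
    rw [move_eq_some] at hd hd'
    simp only at h
    generalize (next c)^[i] p = q at *
    generalize (next c)^[i'] p = q' at *
    rw [← h, hd] at hd'
    obtain ⟨a, j⟩ := q
    obtain ⟨a', j'⟩ := q'
    rw [ahead_of_even he, ahead_of_even he'] at h
    have hj : j = j' := add_right_cancel h
    have he1 : edgeAt (a, j) d = edgeAt (a', j') d' := by simpa using hd'
    have : a = a' := by
      simp only at he he'
      obtain ⟨x, hx⟩ := he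
      obtain ⟨y, hy⟩ := he'
      cases d <;> cases d' <;> simp [edgeAt] at he1 <;> omega
    rw [this, hj]

/-- A loop with `k > 0` turns visits at most `k` sites. -/
theorem card_columns_le {ℓ : ℕ} {c : Bars M} (hc : OnChain ℓ c) {p : ℤ × ZMod M}
    (hp : p ∈ circleLegs ℓ M) (X : Finset ℤ) (hX : ∀ a ∈ X, ∃ j, Conn c p (a, j)) :
    X.card ≤ max 1 (turnSeq c p).length := by
  set k := (turnSeq c p).length with hk
  have hsub : X ⊆ (Finset.range (max 1 k)).image
      (fun i => p.1 + disp ((turnSeq c p).take i)) := by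
    intro a ha
    obtain ⟨j, hj⟩ := hX a ha
    obtain ⟨i, hi, h⟩ := hj.exists_iterate hc hp
    have h1 := fst_iterate_next c p i
    rw [h] at h1
    have h2 := reduceOption_prefix (code_prefix c p hi.le)
    have h3 := List.prefix_iff_eq_take.1 h2
    change _ = List.take _ (turnSeq c p) at h3
    have h4 := h2.length_le
    change _ ≤ (turnSeq c p).length at h4
    rcases Nat.lt_or_ge (code c p i).reduceOption.length (max 1 k) with h5 | h5
    · exact Finset.mem_image.2 ⟨_, Finset.mem_range.2 h5, by rw [← h3, ← h1]⟩
    · refine Finset.mem_image.2 ⟨0, by simp, ?_⟩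
      have : (code c p i).reduceOption = turnSeq c p := by
        rw [h3]; exact List.take_of_length_le (by omega)
      rw [this, disp_turnSeq] at h1
      simp [disp]
      simpa using h1.symm
  refine (Finset.card_le_card hsub).trans (Finset.card_image_le.trans ?_)
  simp

end turns

/-! ### No loop has exactly four turns -/

section lift

variable {M : ℕ}

/-- The time of a leg on the time line that is obtained by cutting the circle, above the column `a`,
at the time `w a`. -/
def lift (w : ℤ → ZMod M) (q : ℤ × ZMod M) : ℤ :=
  if (w q.1).val ≤ q.2.val then q.2.val else q.2.val + M

/-- The direction of the trajectories above a site. -/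
def dir (a : ℤ) : ℤ := if Even a then 1 else -1

theorem dir_add_sgn (a : ℤ) (d : Bool) : dir (a + sgn d) = -dir a := by
  unfold dir
  by_cases he : Even a
  · cases d
    · rw [if_pos he, if_neg]; exact not_even_sub_one he
    · rw [if_pos he, if_neg]; exact not_even_add_one he
  · cases d
    · rw [if_neg he, if_pos]
      · simp
      · exact even_sub_one he
    · rw [if_neg he, if_pos]
      · simp
      · exact even_add_one he

variable [NeZero M]

/-- The cuts sit at double bars of the window, one for each even edge. -/
structure IsCut (ℓ n : ℕ) (c : Bars M) (w : ℤ → ZMod M) : Prop where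
  val_le : ∀ a, (w a).val ≤ n
  touches : ∀ a : ℤ, 0 ≤ a → a < 2 * ℓ → Touches (c (w a)) a
  even : ∀ a : ℤ, Even a → w (a + 1) = w a

theorem Windowed.exists_cut {ℓ n : ℕ} {c : Bars M} (hw : Windowed ℓ n c) :
    ∃ w, IsCut ℓ n c w := by
  have : ∀ y : ℤ, ∃ t : ZMod M, t.val ≤ n ∧
      (0 ≤ y → y + 1 < 2 * ℓ → Even y → c t = some y) := by
    intro y
    by_cases h : 0 ≤ y ∧ y + 1 < 2 * ℓ ∧ Even y
    · obtain ⟨t, h1, h2⟩ := hw.1 y h.1 h.2.1 h.2.2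
      exact ⟨t, h1, fun _ _ _ => h2⟩
    · exact ⟨0, by simp, fun h1 h2 h3 => absurd ⟨h1, h2, h3⟩ h⟩
  choose f hf1 hf2 using this
  refine ⟨fun a => f (if Even a then a else a - 1), fun a => hf1 _, ?_, ?_⟩
  · intro a h0 h1
    by_cases he : Even a
    · rw [if_pos he]
      refine Or.inl (hf2 a h0 ?_ he)
      obtain ⟨x, hx⟩ := he
      omega
    · rw [if_neg he]
      refine Or.inr (hf2 _ ?_ (by omega) (even_sub_one he))
      have := Int.not_even_iff_odd.1 he
      obtain ⟨x, hx⟩ := this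
      omega
  · intro a he
    simp [he, not_even_add_one he]

theorem val_add_one' {j : ZMod M} (h : j.val + 1 < M) : (j + 1).val = j.val + 1 := by
  have : j + 1 = ((j.val + 1 : ℕ) : ZMod M) := by push_cast; rw [ZMod.natCast_zmod_val]
  rw [this, ZMod.val_natCast_of_lt h]

theorem val_add_one_of_last {j : ZMod M} (h : j.val + 1 = M) : j + 1 = 0 := by
  have : j + 1 = ((j.val + 1 : ℕ) : ZMod M) := by push_cast; rw [ZMod.natCast_zmod_val]
  rw [this, h, ZMod.natCast_self]

variable {ℓ n : ℕ} {c : Bars M} {w : ℤ → ZMod M}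

/-- The cut is at a double bar that touches the column, so that a trajectory cannot cross it. -/
theorem lift_up (hw : IsCut ℓ n c w) (hn : n < M) {a : ℤ} (h0 : 0 ≤ a) (h1 : a < 2 * ℓ)
    {j : ZMod M} (h : ¬ Touches (c (j + 1)) a) : lift w (a, j + 1) = lift w (a, j) + 1 := by
  have hne : w a ≠ j + 1 := fun h' => h (h' ▸ hw.touches a h0 h1)
  have hne' : (w a).val ≠ (j + 1).val := fun h' => hne (ZMod.val_injective M h')
  have hwn := hw.val_le a
  have hj := ZMod.val_lt j
  unfold lift
  simp only
  rcases Nat.lt_or_ge (j.val + 1) M with h2 | h2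
  · have h3 := val_add_one' h2
    rw [h3] at hne' ⊢
    split_ifs <;> push_cast <;> omega
  · have h3 : j + 1 = 0 := val_add_one_of_last (by omega)
    have h4 : (j + 1).val = 0 := by rw [h3, ZMod.val_zero]
    rw [h4] at hne' ⊢
    split_ifs <;> push_cast <;> omega

/-- Both ends of a double bar lie on the same sheet: in the window the two columns are cut at the
same time, and outside it both times are past the cuts. -/
theorem lift_pair (hw : IsCut ℓ n c w) (hwin : Windowed ℓ n c) {y : ℤ} {j t : ZMod M}
    (h : c t = some y) (hj : t = j ∨ t = j + 1) : lift w (y + 1, j) = lift w (y, j) := by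
  by_cases he : Even y
  · unfold lift; simp only [hw.even y he]
  · have ht : n < t.val := by
      by_contra h'
      exact he (hwin.2 t y (by omega) h)
    have hjn : n ≤ j.val := by
      rcases hj with rfl | rfl
      · exact ht.le
      · have := ZMod.val_add_le j 1
        have h1 : (1 : ZMod M).val ≤ 1 := by
          rw [ZMod.val_one_eq_one_mod]; exact Nat.mod_le _ _
        omega
    unfold lift
    simp only
    rw [if_pos ((hw.val_le _).trans hjn), if_pos ((hw.val_le _).trans hjn)]

/-- The walk has a well-defined height on the time line: it is constant at turns, increases by one
along even columns, and decreases by one along odd columns. -/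
theorem lift_move (hw : IsCut ℓ n c w) (hwin : Windowed ℓ n c) (hn : n < M) {q : ℤ × ZMod M}
    (hq : q ∈ circleLegs ℓ M) :
    lift w (next c q) = lift w q + if move c q = none then dir q.1 else 0 := by
  have hq' := mem_circleLegs.1 hq
  obtain ⟨a, j⟩ := q
  simp only at hq'
  rcases move_cases c (a, j) with ⟨d, h1, h2⟩ | ⟨h1, h2⟩
  · have hn : next c (a, j) = side (a, j) d := by unfold next; rw [h1]; rfl
    rw [hn, h1]
    simp only [reduceCtorEq, if_false, add_zero]
    have hj : ahead (a, j) = j ∨ ahead (a, j) = j + 1 := by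
      unfold ahead; split_ifs
      · exact Or.inr rfl
      · exact Or.inl rfl
    have := lift_pair hw hwin h2 hj
    cases d
    · simp only [edgeAt, Bool.false_eq_true, if_false, sub_add_cancel] at this
      simpa [side] using this.symm
    · simpa [side, edgeAt] using this
  · have hn' : next c (a, j) = fwd (a, j) := by unfold next; rw [h1]; rfl
    rw [hn', h1]
    simp only [if_true]
    by_cases he : Even a
    · rw [fwd_of_even he]
      rw [ahead_of_even he] at h2
      rw [lift_up hw hn hq'.1 hq'.2 h2]
      simp [dir, he]
    · rw [fwd_of_odd he]
      rw [ahead_of_odd he] at h2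
      have := lift_up hw hn hq'.1 hq'.2 (j := j - 1) (by simpa using h2)
      rw [sub_add_cancel] at this
      rw [this]
      simp only [dir, if_neg he]
      ring

theorem lift_cast (w : ℤ → ZMod M) (q : ℤ × ZMod M) : ((lift w q : ℤ) : ZMod M) = q.2 := by
  unfold lift
  split_ifs <;> push_cast <;> simp

/-- The run of a walk up to its first turn. -/
theorem exists_run (hw : IsCut ℓ n c w) (hwin : Windowed ℓ n c) (hc : OnChain ℓ c) (hn : n < M)
    (r : ℕ) {q : ℤ × ZMod M} (hq : q ∈ circleLegs ℓ M) :
    ((code c q r).reduceOption = [] → ∀ i ≤ r, ((next c)^[i] q).1 = q.1 ∧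
        lift w ((next c)^[i] q) = lift w q + dir q.1 * i) ∧
      ∀ d ds, (code c q r).reduceOption = d :: ds → ∃ l < r,
        (∀ i ≤ l, ((next c)^[i] q).1 = q.1 ∧
          lift w ((next c)^[i] q) = lift w q + dir q.1 * i) ∧
        ((next c)^[l + 1] q).1 = q.1 + sgn d ∧
        lift w ((next c)^[l + 1] q) = lift w q + dir q.1 * l ∧
        (next c)^[l + 1] q ∈ circleLegs ℓ M ∧
        (code c ((next c)^[l + 1] q) (r - (l + 1))).reduceOption = ds := by
  induction r generalizing q with
  | zero =>
    refine ⟨fun _ i hi => ?_, fun d ds h => by simp [code] at h⟩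
    rw [show i = 0 by omega]; simp
  | succ r ih =>
    have hm := lift_move hw hwin hn hq
    have hq1 := next_mem_circleLegs hc hq
    obtain ⟨ih1, ih2⟩ := ih hq1
    cases h : move c q with
    | none =>
      have h1 : (next c q).1 = q.1 := by unfold next; rw [h]; exact fwd_fst q
      rw [h] at hm
      simp only [if_true] at hm
      have e : (code c q (r + 1)).reduceOption = (code c (next c q) r).reduceOption := by
        simp [code, h]
      have step : ∀ i : ℕ, (((next c)^[i] (next c q)).1 = (next c q).1 ∧
          lift w ((next c)^[i] (next c q)) = lift w (next c q) + dir (next c q).1 * i) →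
          (((next c)^[i + 1] q).1 = q.1 ∧
          lift w ((next c)^[i + 1] q) = lift w q + dir q.1 * ((i + 1 : ℕ) : ℤ)) := by
        intro i hi
        rw [Function.iterate_succ_apply]
        rw [h1, hm] at hi
        refine ⟨hi.1, ?_⟩
        rw [hi.2]; push_cast; ring
      rw [e]
      refine ⟨fun h0 i hi => ?_, fun d ds h0 => ?_⟩
      · cases i with
        | zero => simp
        | succ i => exact step i (ih1 h0 i (by omega))
      · obtain ⟨l, hl, h2, h3, h4, h5, h6⟩ := ih2 d ds h0
        refine ⟨l + 1, by omega, fun i hi => ?_, ?_, ?_, ?_, ?_⟩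
        · cases i with
          | zero => simp
          | succ i => exact step i (h2 i (by omega))
        · rw [Function.iterate_succ_apply, h3, h1]
        · rw [Function.iterate_succ_apply, h4, h1, hm]; push_cast; ring
        · rw [Function.iterate_succ_apply]; exact h5
        · rw [Function.iterate_succ_apply, ← h6]
          congr 2; omega
    | some d' =>
      have h1 : (next c q).1 = q.1 + sgn d' := by unfold next; rw [h]; exact follow_fst q d'
      rw [h] at hm
      simp only [reduceCtorEq, if_false, add_zero] at hm
      have e : (code c q (r + 1)).reduceOption = d' :: (code c (next c q) r).reduceOption := by
        simp [code, h]
      rw [e]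
      refine ⟨fun h0 => by simp at h0, fun d ds h0 => ?_⟩
      simp only [List.cons.injEq] at h0
      obtain ⟨rfl, rfl⟩ := h0
      refine ⟨0, by omega, fun i hi => ?_, ?_, ?_, ?_, ?_⟩
      · rw [show i = 0 by omega]; simp
      · simpa using h1
      · simpa using hm
      · simpa using hq1
      · simp

/-- The four runs of a loop with four turns would all run through the same time slot.  A closed
sequence of four steps visits some column twice, so the loop would visit some leg twice. -/
theorem length_turnSeq_ne_four (hwin : Windowed ℓ n c) (hc : OnChain ℓ c) (hn : n < M)
    {p : ℤ × ZMod M} (hp : p ∈ circleLegs ℓ M) : (turnSeq c p).length ≠ 4 := by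
  intro h4
  obtain ⟨w, hw⟩ := hwin.exists_cut
  have hd := disp_turnSeq c p
  set L := loopLength c p with hL
  obtain ⟨d1, d2, d3, d4, hs⟩ : ∃ d1 d2 d3 d4, turnSeq c p = [d1, d2, d3, d4] :=
    List.length_eq_four.1 h4
  rw [hs] at hd
  obtain ⟨l1, hl1, r1, x1, y1, m1, s1⟩ := (exists_run hw hwin hc hn L hp).2 _ _ hs
  obtain ⟨l2, hl2, r2, x2, y2, m2, s2⟩ := (exists_run hw hwin hc hn _ m1).2 _ _ s1
  obtain ⟨l3, hl3, r3, x3, y3, m3, s3⟩ := (exists_run hw hwin hc hn _ m2).2 _ _ s2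
  obtain ⟨l4, hl4, r4, x4, y4, m4, s4⟩ := (exists_run hw hwin hc hn _ m3).2 _ _ s3
  have r5 := (exists_run hw hwin hc hn _ m4).1 s4
  simp only [← Function.iterate_add_apply] at r2 x2 y2 r3 x3 y3 r4 x4 y4 r5
  rw [x1, y1, dir_add_sgn] at r2 y2
  rw [x1] at x2
  rw [x2, y2, dir_add_sgn, dir_add_sgn, neg_neg] at r3 y3
  rw [x2] at x3
  rw [x3, y3, dir_add_sgn, dir_add_sgn, dir_add_sgn, neg_neg] at r4 y4
  rw [x3] at x4
  rw [x4, y4, dir_add_sgn, dir_add_sgn, dir_add_sgn, dir_add_sgn, neg_neg, neg_neg] at r5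
  -- the heights are counted in the direction of the first run
  have hσ : dir p.1 * dir p.1 = 1 := by unfold dir; split_ifs <;> norm_num
  have hend := (r5 (L - (l1 + 1) - (l2 + 1) - (l3 + 1) - (l4 + 1)) le_rfl).2
  rw [show (L - (l1 + 1) - (l2 + 1) - (l3 + 1) - (l4 + 1)) + ((l4 + 1) + ((l3 + 1) + ((l2 + 1) +
    (l1 + 1)))) = L by omega, hL, iterate_loopLength, ← hL] at hend
  obtain ⟨l5, hl5⟩ : ∃ l5, l5 = L - (l1 + 1) - (l2 + 1) - (l3 + 1) - (l4 + 1) := ⟨_, rfl⟩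
  rw [← hl5] at hend r5
  generalize hσ' : dir p.1 = σ at *
  have hsum : (l1 : ℤ) - l2 + l3 - l4 + l5 = 0 := by
    have : σ * ((l1 : ℤ) - l2 + l3 - l4 + l5) = 0 := by linarith
    have h2 : σ * (σ * ((l1 : ℤ) - l2 + l3 - l4 + l5)) = 0 := by rw [this, mul_zero]
    rwa [← mul_assoc, hσ, one_mul] at h2
  have same : ∀ i j : ℕ, i < L → j < L → ((next c)^[i] p).1 = ((next c)^[j] p).1 →
      lift w ((next c)^[i] p) = lift w ((next c)^[j] p) → i = j := by
    intro i j hi hj h1 h2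
    refine iterate_injOn c p hi hj (Prod.ext h1 ?_)
    rw [← lift_cast w, h2, lift_cast w]
  -- the common height, relative to the start
  obtain ⟨m, hm⟩ : ∃ m : ℤ, m = max ((l1 : ℤ) - l2) ((l1 : ℤ) - l2 + l3 - l4) := ⟨_, rfl⟩
  have hma := le_max_left ((l1 : ℤ) - l2) ((l1 : ℤ) - l2 + l3 - l4)
  have hmb := le_max_right ((l1 : ℤ) - l2) ((l1 : ℤ) - l2 + l3 - l4)
  have hmc := max_choice ((l1 : ℤ) - l2) ((l1 : ℤ) - l2 + l3 - l4)
  rw [← hm] at hma hmb hmc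
  have b1 : ∃ i < L, (i ≤ l1 ∨ l1 + l2 + l3 + l4 + 4 ≤ i) ∧ ((next c)^[i] p).1 = p.1 ∧
      lift w ((next c)^[i] p) = lift w p + σ * m := by
    rcases le_or_gt 0 m with h0 | h0
    · have := r1 m.toNat (by omega)
      refine ⟨m.toNat, by omega, Or.inl (by omega), this.1, ?_⟩
      rw [this.2, Int.toNat_of_nonneg h0]
    · obtain ⟨i, hi⟩ : ∃ i : ℕ, (i : ℤ) = m - ((l1 : ℤ) - l2 + l3 - l4) :=
        ⟨(m - ((l1 : ℤ) - l2 + l3 - l4)).toNat, Int.toNat_of_nonneg (by omega)⟩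
      have := r5 i (by omega)
      refine ⟨_, by omega, Or.inr (by omega), this.1.trans ?_, this.2.trans ?_⟩
      · simp only [disp] at hd; linarith
      · rw [hi]; ring
  have b2 : ∃ i < L, l1 + 1 ≤ i ∧ i ≤ l1 + l2 + 1 ∧ ((next c)^[i] p).1 = p.1 + sgn d1 ∧
      lift w ((next c)^[i] p) = lift w p + σ * m := by
    obtain ⟨i, hi⟩ : ∃ i : ℕ, (i : ℤ) = l1 - m :=
      ⟨(l1 - m).toNat, Int.toNat_of_nonneg (by omega)⟩
    have := r2 i (by omega)
    refine ⟨_, by omega, by omega, by omega, this.1, this.2.trans ?_⟩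
    rw [hi]; ring
  have b3 : ∃ i < L, l1 + l2 + 2 ≤ i ∧ i ≤ l1 + l2 + l3 + 2 ∧
      ((next c)^[i] p).1 = p.1 + sgn d1 + sgn d2 ∧
      lift w ((next c)^[i] p) = lift w p + σ * m := by
    obtain ⟨i, hi⟩ : ∃ i : ℕ, (i : ℤ) = m - (l1 - l2) :=
      ⟨(m - (l1 - l2)).toNat, Int.toNat_of_nonneg (by omega)⟩
    have := r3 i (by omega)
    refine ⟨_, by omega, by omega, by omega, this.1, this.2.trans ?_⟩
    rw [hi]; ring
  have b4 : ∃ i < L, l1 + l2 + l3 + 3 ≤ i ∧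
      ((next c)^[i] p).1 = p.1 + sgn d1 + sgn d2 + sgn d3 ∧
      lift w ((next c)^[i] p) = lift w p + σ * m := by
    obtain ⟨i, hi⟩ : ∃ i : ℕ, (i : ℤ) = l1 - l2 + l3 - m :=
      ⟨(l1 - l2 + l3 - m).toNat, Int.toNat_of_nonneg (by omega)⟩
    have := r4 i (by omega)
    refine ⟨_, by omega, by omega, this.1, this.2.trans ?_⟩
    rw [hi]; ring
  obtain ⟨i1, k1, o1, u1, v1⟩ := b1
  obtain ⟨i2, k2, o2, o2', u2, v2⟩ := b2
  obtain ⟨i3, k3, o3, o3', u3, v3⟩ := b3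
  obtain ⟨i4, k4, o4, u4, v4⟩ := b4
  simp only [disp] at hd
  have hcase : sgn d1 + sgn d2 = 0 ∨ sgn d2 + sgn d3 = 0 := by
    revert hd
    cases d1 <;> cases d2 <;> cases d3 <;> cases d4 <;> simp [sgn]
  rcases hcase with h | h
  · have := same i1 i3 k1 k3 (by rw [u1, u3]; linarith) (by rw [v1, v3])
    omega
  · have := same i2 i4 k2 k4 (by rw [u2, u4]; linarith) (by rw [v2, v4])
    omega

/-- A long loop has `2h` turns with `h ≥ 3`. -/
theorem six_le_length_turnSeq (hwin : Windowed ℓ n c) (hc : OnChain ℓ c) (hn : n < M)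
    {p : ℤ × ZMod M} (hp : p ∈ circleLegs ℓ M) (X : Finset ℤ)
    (hX : ∀ a ∈ X, ∃ j, Conn c p (a, j)) (hlong : 2 < X.card) :
    3 ≤ (evenTurns c p (loopLength c p)).card := by
  have h1 := card_columns_le hc hp X hX
  have h2 := length_turnSeq_ne_four hwin hc hn hp
  have h3 := length_turnSeq c p
  omega

end lift

/-! ### Weights on the circle -/

section peierls

variable {M : ℕ} [NeZero M]

/-- The possible configurations, without double bar at the time `t₀`. -/
def circleConfigs (ℓ M : ℕ) [NeZero M] (t₀ : ZMod M) : Finset (Bars M) :=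
  Fintype.piFinset (fun j =>
    if j = t₀ then {none} else Finset.insertNone (Finset.Ico (0 : ℤ) (2 * ℓ - 1)))

theorem mem_circleConfigs {ℓ : ℕ} {t₀ : ZMod M} {c : Bars M} :
    c ∈ circleConfigs ℓ M t₀ ↔ OnChain ℓ c ∧ c t₀ = none := by
  simp only [circleConfigs, Fintype.mem_piFinset]
  constructor
  · intro h
    have h0 : c t₀ = none := by simpa using h t₀
    refine ⟨fun j y hy => ?_, h0⟩
    have hj := h j
    by_cases hjt : j = t₀
    · rw [hjt, h0] at hy; cases hy
    · rw [if_neg hjt, hy] at hj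
      simp at hj
      omega
  · rintro ⟨h1, h2⟩ j
    by_cases hjt : j = t₀
    · simp [hjt, h2]
    · rw [if_neg hjt, Finset.mem_insertNone]
      intro y hy
      have := h1 j y hy
      rw [Finset.mem_Ico]
      omega

/-- The weight of a configuration. -/
def circleWeight (θ : ℝ) (ℓ n : ℕ) (c : Bars M) : ℝ :=
  (1 / (n : ℝ)) ^ barCount c * θ ^ ((loopCount ℓ c : ℤ) - (barCount c : ℤ))

/-- The configurations that satisfy the condition on the window. -/
def windowConfigs (ℓ n : ℕ) (t₀ : ZMod M) : Finset (Bars M) :=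
  (circleConfigs ℓ M t₀).filter (Windowed ℓ n)

/-- The legs on the loop through `p`. -/
def loopSet (c : Bars M) (p : ℤ × ZMod M) : Set (ℤ × ZMod M) := {q | Conn c p q}

/-- The loop through `p` visits more than two sites. -/
def LongLoop (ℓ : ℕ) (c : Bars M) (p : ℤ × ZMod M) : Prop :=
  2 < ((Finset.Ico (0 : ℤ) (2 * ℓ)).filter (fun a => ∃ j, Conn c p (a, j))).card

/-- The leg `(x, t₀)` is on a long loop or inside it. -/
def Surrounded (ℓ : ℕ) (t₀ : ZMod M) (x : ℤ) (c : Bars M) : Prop :=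
  ∃ p ∈ circleLegs ℓ M, LongLoop ℓ c p ∧
    ((x, t₀) ∈ loopSet c p ∨ (x, t₀) ∉ loopSet c p ∧ par (loopSet c p) x t₀ = 1)

theorem mem_loopSet {c : Bars M} {p q : ℤ × ZMod M} : q ∈ loopSet c p ↔ Conn c p q := Iff.rfl

theorem loopSet_closed (c : Bars M) (p : ℤ × ZMod M) : Closed c (loopSet c p) := fun _ _ h =>
  ⟨fun h' => Conn.trans h' h, fun h' => Conn.trans h' h.symm⟩

theorem loopSet_subset {ℓ : ℕ} {c : Bars M} (hc : OnChain ℓ c) {p : ℤ × ZMod M}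
    (hp : p ∈ circleLegs ℓ M) {q : ℤ × ZMod M} (hq : q ∈ loopSet c p) : q ∈ circleLegs ℓ M := by
  obtain ⟨i, -, rfl⟩ := Conn.exists_iterate hc hp hq
  clear hq
  induction i with
  | zero => exact hp
  | succ i ih => rw [Function.iterate_succ_apply']; exact next_mem_circleLegs hc ih

theorem circleWeight_nonneg {θ : ℝ} (hθ : 1 ≤ θ) (ℓ n : ℕ) (c : Bars M) :
    0 ≤ circleWeight θ ℓ n c := by
  unfold circleWeight
  have : (0 : ℝ) ≤ θ := by linarith
  positivity

theorem pow_barCount (u : ℝ) (c : Bars M) :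
    u ^ barCount c = ∏ j, if c j = none then 1 else u := by
  unfold barCount
  rw [Finset.prod_ite]
  simp

/-! ### Removing a long loop -/

variable {ℓ n : ℕ} {t₀ : ZMod M} {c A : Bars M} {p : ℤ × ZMod M}

/-- The times of the window. -/
def windowTimes (n M : ℕ) [NeZero M] : Finset (ZMod M) := Finset.univ.filter (fun j => j.val ≤ n)

theorem mem_windowTimes {j : ZMod M} : j ∈ windowTimes n M ↔ j.val ≤ n := by simp [windowTimes]

/-- The times at which a new double bar may be inserted. -/
def FreeTime (n : ℕ) (t₀ : ZMod M) (c : Bars M) (j : ZMod M) : Prop :=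
  n < j.val ∧ j ≠ t₀ ∧ c j = none

/-- The sets of double bars that may be inserted into the room of the loop through `p`. -/
def insertions (ℓ n : ℕ) (t₀ : ZMod M) (c : Bars M) (p : ℤ × ZMod M) : Finset (Bars M) :=
  Fintype.piFinset (fun j => if FreeTime n t₀ c j then
    Finset.insertNone ((rightSlice ℓ (loopSet c p) j).image (fun b => b - 1)) else {none})

/-- The configuration in which the interior of the loop through `p` is shifted to the left, the
double bars of the loop outside the window are removed, and those of `A` are inserted. -/
def replaceLoop (n : ℕ) (p : ℤ × ZMod M) (c A : Bars M) : Bars M :=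
  eraseBars (shiftBars (loopSet c p) c A) (turnTimes c p (loopLength c p) \ windowTimes n M)

theorem mem_insertions (hA : A ∈ insertions ℓ n t₀ c p) {j : ZMod M} {e : ℤ} (h : A j = some e) :
    FreeTime n t₀ c j ∧ e + 1 ∈ rightSlice ℓ (loopSet c p) j := by
  have := Fintype.mem_piFinset.1 hA j
  by_cases hf : FreeTime n t₀ c j
  · rw [if_pos hf, h, Finset.some_mem_insertNone] at this
    obtain ⟨b, hb, rfl⟩ := Finset.mem_image.1 this
    exact ⟨hf, by rwa [sub_add_cancel]⟩
  · rw [if_neg hf, h] at this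
    simp at this

theorem mem_rightSlice {γ : Set (ℤ × ZMod M)} {j : ZMod M} {b : ℤ} :
    b ∈ rightSlice ℓ γ j ↔ (0 ≤ b ∧ b < 2 * ℓ) ∧ (b, j) ∈ γ ∧ par γ b j = 1 := by
  simp [rightSlice]

/-- All double bars that a loop touches are met by the walk along it. -/
theorem mem_turnTimes_of_touch (hc : OnChain ℓ c) (hp : p ∈ circleLegs ℓ M) {j : ZMod M} {y : ℤ}
    (h : c j = some y) (hm : (y, j) ∈ loopSet c p ∨ (y + 1, j) ∈ loopSet c p) :
    j ∈ turnTimes c p (loopLength c p) := by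
  have key : ∀ q, q ∈ loopSet c p → ahead q = j → Touches (c j) q.1 →
      j ∈ turnTimes c p (loopLength c p) := by
    intro q hq h1 h2
    obtain ⟨i, hi, rfl⟩ := Conn.exists_iterate hc hp hq
    refine mem_turnTimes.2 ⟨i, hi, fun h3 => ?_, h1⟩
    rw [move_eq_none, h1] at h3
    exact h3 h2
  have hl := loopSet_closed c p _ _ (link_above h).conn
  by_cases he : Even y
  · refine key (y + 1, j) (by tauto) (ahead_of_odd (not_even_add_one he) j) ?_
    rw [h]; exact Or.inr (by simp)
  · refine key (y, j) (by tauto) (ahead_of_odd he j) ?_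
    rw [h]; exact Or.inl rfl

theorem ne_none_of_mem_turnTimes {r : ℕ} {j : ZMod M} (h : j ∈ turnTimes c p r) : c j ≠ none := by
  obtain ⟨i, -, h1, h2⟩ := mem_turnTimes.1 h
  obtain ⟨d, hd⟩ := Option.ne_none_iff_exists'.1 h1
  rw [move_eq_some, h2] at hd
  rw [hd]; simp

theorem shiftBars_eq_none {γ : Set (ℤ × ZMod M)} {j : ZMod M} :
    shiftBars γ c A j = none ↔ c j = none ∧ A j = none := by
  cases h : c j with
  | none => simp [shiftBars, h]
  | some y =>
    simp only [shiftBars, h]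
    split_ifs <;> simp

theorem barCount_shiftBars (hA : ∀ j, A j ≠ none → c j = none) (γ : Set (ℤ × ZMod M)) :
    barCount (shiftBars γ c A) = barCount c + barCount A := by
  unfold barCount
  rw [← Finset.card_union_of_disjoint]
  · congr 1
    ext j
    simp only [Finset.mem_filter, Finset.mem_univ, true_and, Finset.mem_union, ne_eq,
      shiftBars_eq_none]
    tauto
  · rw [Finset.disjoint_left]
    intro j h1 h2
    simp only [Finset.mem_filter, Finset.mem_univ, true_and] at h1 h2
    exact h1 (hA j h2)

/-- Replacing a loop with `2h` turns gains the factor `θ ^ (h - 1)`, and a factor `n` for each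
double bar that is removed. -/
theorem circleWeight_replaceLoop {θ : ℝ} (hθ : 1 ≤ θ) (hn : 0 < n) (hc : OnChain ℓ c)
    (hp : p ∈ circleLegs ℓ M) (hA : A ∈ insertions ℓ n t₀ c p)
    (hh : 1 ≤ (evenTurns c p (loopLength c p)).card) :
    circleWeight θ ℓ n c * θ ^ ((evenTurns c p (loopLength c p)).card - 1) *
        (1 / (n : ℝ)) ^ barCount A ≤
      (1 / (n : ℝ)) ^ (turnTimes c p (loopLength c p) \ windowTimes n M).card *
        circleWeight θ ℓ n (replaceLoop n p c A) := by
  set γ := loopSet c p with hγ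
  set h := (evenTurns c p (loopLength c p)).card with hhdef
  set J := turnTimes c p (loopLength c p) \ windowTimes n M with hJ
  have hAfree : ∀ j, A j ≠ none → c j = none := by
    intro j hj
    obtain ⟨e, he⟩ := Option.ne_none_iff_exists'.1 hj
    exact (mem_insertions hA he).1.2.2
  have h1 : loopCount ℓ c + (h + barCount A) ≤ loopCount ℓ (shiftBars γ c A) + 1 := by
    have hT := loopCount_add_le_shift hc (γ := γ) (A := A) (fun q => mem_loopSet) ?_ ?_
      (topTimes c γ ∪ Finset.univ.filter (fun j => A j ≠ none)) ?_
    · rw [Finset.card_union_of_disjoint] at hT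
      · have := card_evenTurns_le c p (γ := γ) (fun q => mem_loopSet)
        unfold barCount
        omega
      · rw [Finset.disjoint_left]
        intro j h2 h3
        obtain ⟨-, y, h4, -⟩ := Finset.mem_filter.1 h2
        have := hAfree j (Finset.mem_filter.1 h3).2
        rw [h4] at this; cases this
    · intro t e he _
      have := mem_rightSlice.1 (mem_insertions hA he).2
      exact this.2
    · intro q hq
      exact mem_circleLegs.1 (loopSet_subset hc hp hq)
    · intro t ht
      rcases Finset.mem_union.1 ht with ht | ht
      · exact Or.inl (Finset.mem_filter.1 ht).2
      · have := (Finset.mem_filter.1 ht).2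
        exact Or.inr ⟨hAfree t this, this⟩
  have h2 := loopCount_le_eraseBars (ℓ := ℓ) (shiftBars γ c A) J
  have h3 := barCount_eraseBars (shiftBars γ c A) J (by
    intro j hj h
    exact ne_none_of_mem_turnTimes (Finset.mem_sdiff.1 hj).1 (shiftBars_eq_none.1 h).1)
  rw [barCount_shiftBars hAfree] at h3
  have hn' : (0 : ℝ) < 1 / n := by positivity
  have hθ0 : 0 < θ := by linarith
  unfold circleWeight replaceLoop
  rw [← hγ, ← hJ]
  set d := eraseBars (shiftBars γ c A) J
  have e1 : (1 / (n : ℝ)) ^ J.card * ((1 / (n : ℝ)) ^ barCount d *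
      θ ^ ((loopCount ℓ d : ℤ) - (barCount d : ℤ))) =
      (1 / (n : ℝ)) ^ (barCount c + barCount A) *
        θ ^ ((loopCount ℓ d : ℤ) - (barCount d : ℤ)) := by
    rw [← mul_assoc, ← pow_add]; congr 2; omega
  have e2 : (1 / (n : ℝ)) ^ barCount c * θ ^ ((loopCount ℓ c : ℤ) - (barCount c : ℤ)) *
      θ ^ (h - 1) * (1 / (n : ℝ)) ^ barCount A = (1 / (n : ℝ)) ^ (barCount c + barCount A) *
        θ ^ ((loopCount ℓ c : ℤ) - (barCount c : ℤ) + ((h - 1 : ℕ) : ℤ)) := by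
    rw [zpow_add₀ hθ0.ne', zpow_natCast, pow_add]; ring
  rw [e1, e2]
  refine mul_le_mul_of_nonneg_left ?_ (by positivity)
  refine zpow_le_zpow_right₀ hθ ?_
  omega

theorem maskBars_replaceLoop (hw : Windowed ℓ n c) (hc : OnChain ℓ c) (hnM : n < M)
    (hA : A ∈ insertions ℓ n t₀ c p) {j : ZMod M} (hj : j.val ≤ n) :
    replaceLoop n p c A j = c j := by
  unfold replaceLoop eraseBars
  rw [if_neg (by simp [mem_windowTimes, hj])]
  cases h : c j with
  | none =>
    simp only [shiftBars, h]
    by_contra h'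
    obtain ⟨e, he⟩ := Option.ne_none_iff_exists'.1 h'
    have := (mem_insertions hA he).1.1
    omega
  | some y =>
    have h1 := (hc j y h).2
    have := hw.par_even hc hnM (loopSet_closed c p) (hw.2 j y hj h) (by omega) hj
    simp [shiftBars, h, this]

end peierls

section peierls

variable {M : ℕ} [NeZero M] {ℓ n : ℕ} {t₀ : ZMod M} {c c' A A' : Bars M} {p : ℤ × ZMod M}

theorem Windowed.congr (hw : Windowed ℓ n c) (h : ∀ j : ZMod M, j.val ≤ n → c' j = c j) :
    Windowed ℓ n c' := by
  refine ⟨fun y h0 h1 h2 => ?_, fun j y hj hy => hw.2 j y hj (by rw [← h j hj, hy])⟩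
  obtain ⟨j, hj, hy⟩ := hw.1 y h0 h1 h2
  exact ⟨j, hj, by rw [h j hj, hy]⟩

theorem mem_windowConfigs : c ∈ windowConfigs ℓ n t₀ ↔
    (OnChain ℓ c ∧ c t₀ = none) ∧ Windowed ℓ n c := by
  rw [windowConfigs, Finset.mem_filter, mem_circleConfigs]

theorem replaceLoop_mem (hnM : n < M) (h : c ∈ windowConfigs ℓ n t₀)
    (hA : A ∈ insertions ℓ n t₀ c p) : replaceLoop n p c A ∈ windowConfigs ℓ n t₀ := by
  obtain ⟨⟨hc, h0⟩, hw⟩ := mem_windowConfigs.1 h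
  refine mem_windowConfigs.2 ⟨⟨fun j y hy => ?_, ?_⟩,
    hw.congr fun j hj => maskBars_replaceLoop hw hc hnM hA hj⟩
  · unfold replaceLoop eraseBars at hy
    split_ifs at hy
    cases h : c j with
    | none =>
      simp only [shiftBars, h] at hy
      have := mem_rightSlice.1 (mem_insertions hA hy).2
      have h1 := par_eq_one_pos this.2.2
      omega
    | some z =>
      simp only [shiftBars, h] at hy
      have h1 := hc j z h
      split_ifs at hy with h2
      · have h3 := par_eq_one_pos h2
        simp only [Option.some.injEq] at hy
        omega
      · simp only [Option.some.injEq] at hy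
        omega
  · unfold replaceLoop eraseBars
    split_ifs with h1
    · rfl
    · rw [shiftBars_eq_none]
      refine ⟨h0, ?_⟩
      by_contra h'
      obtain ⟨e, he⟩ := Option.ne_none_iff_exists'.1 h'
      exact (mem_insertions hA he).1.2.1 rfl

theorem insertions_eq_none (hA : A ∈ insertions ℓ n t₀ c p) {j : ZMod M}
    (h : ¬ FreeTime n t₀ c j) : A j = none := by
  by_contra h'
  obtain ⟨e, he⟩ := Option.ne_none_iff_exists'.1 h'
  exact h (mem_insertions hA he).1

theorem loopSet_eq_of_code_eq (hc : OnChain ℓ c) (hc' : OnChain ℓ c') (hp : p ∈ circleLegs ℓ M)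
    (h : code c p (loopLength c p) = code c' p (loopLength c' p)) :
    loopSet c p = loopSet c' p := by
  have hr : loopLength c p = loopLength c' p := by
    rw [← length_code c p (loopLength c p), h, length_code]
  rw [← hr] at h
  have hi := (code_determines h).1
  ext q
  rw [mem_loopSet, mem_loopSet]
  constructor
  · intro hq
    obtain ⟨i, h1, rfl⟩ := Conn.exists_iterate hc hp hq
    rw [hi i h1.le]; exact conn_iterate_next _ _ _
  · intro hq
    obtain ⟨i, h1, rfl⟩ := Conn.exists_iterate hc' hp hq
    rw [← hr] at h1
    rw [← hi i h1.le]; exact conn_iterate_next _ _ _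

/-- A double bar that the loop does not touch is not shifted to the place of an inserted one. -/
theorem shift_ne_inserted {γ : Set (ℤ × ZMod M)} {j : ZMod M} {y e : ℤ} (h1 : (y, j) ∉ γ)
    (h2 : (y + 1, j) ∉ γ) (he : e + 1 ∈ rightSlice ℓ γ j) :
    (if par γ y j = 1 then some (y - 1) else some y) ≠ some e := by
  have h3 := (mem_rightSlice.1 he).2.1
  split_ifs
  · rintro ⟨rfl⟩; exact h1 (by simpa using h3)
  · rintro ⟨rfl⟩; exact h2 h3

/-- The shift keeps the double bars that the loop does not touch apart. -/
theorem shift_injective {γ : Set (ℤ × ZMod M)} {j : ZMod M} {y z : ℤ} (hy : 0 ≤ y) (hz : 0 ≤ z)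
    (h1 : (y, j) ∉ γ) (h2 : (z, j) ∉ γ)
    (h : (if par γ y j = 1 then some (y - 1) else some y) =
      (if par γ z j = 1 then some (z - 1) else some z)) : y = z := by
  have e1 := par_succ γ hy j
  have e2 := par_succ γ hz j
  rw [ind_of_notMem h1, add_zero] at e1
  rw [ind_of_notMem h2, add_zero] at e2
  split_ifs at h with h3 h4 h4
  · simp only [Option.some.injEq] at h; omega
  · obtain rfl : y - 1 = z := by simpa using h
    rw [sub_add_cancel] at e2
    exact absurd (e2.symm.trans h3) h4
  · simp only [Option.some.injEq] at h
    rw [h, sub_add_cancel] at e1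
    rw [h] at h3
    exact absurd (e1.symm.trans h4) h3
  · simpa using h

/-- The original configuration and the inserted double bars are recovered from the walk along the
loop, the double bars in the window, and the configuration after the replacement. -/
theorem replaceLoop_injective (hc : OnChain ℓ c) (hc' : OnChain ℓ c') (hp : p ∈ circleLegs ℓ M)
    (h : code c p (loopLength c p) = code c' p (loopLength c' p))
    (hm : ∀ j : ZMod M, j.val ≤ n → c j = c' j) (hA : A ∈ insertions ℓ n t₀ c p)
    (hA' : A' ∈ insertions ℓ n t₀ c' p) (he : replaceLoop n p c A = replaceLoop n p c' A') :
    c = c' ∧ A = A' := by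
  have hγ := loopSet_eq_of_code_eq hc hc' hp h
  have hr : loopLength c p = loopLength c' p := by
    rw [← length_code c p (loopLength c p), h, length_code]
  rw [← hr] at h
  obtain ⟨-, hT, hTc⟩ := code_determines h
  have key : ∀ j, c j = c' j ∧ A j = A' j := by
    intro j
    by_cases hcj : c j = c' j ∧ (j.val ≤ n ∨ c j ≠ none)
    · obtain ⟨h1, h2⟩ := hcj
      refine ⟨h1, ?_⟩
      rw [insertions_eq_none hA, insertions_eq_none hA']
      · rintro ⟨h3, -, h4⟩
        rw [← h1] at h4
        rcases h2 with h2 | h2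
        · omega
        · exact h2 h4
      · rintro ⟨h3, -, h4⟩
        rcases h2 with h2 | h2
        · omega
        · exact h2 h4
    · have hjn : ¬ j.val ≤ n := fun h' => hcj ⟨hm j h', Or.inl h'⟩
      have hjT : j ∉ turnTimes c p (loopLength c p) := fun h' =>
        hcj ⟨hTc j h', Or.inr (ne_none_of_mem_turnTimes h')⟩
      have hjT' : j ∉ turnTimes c' p (loopLength c' p) := by rwa [← hr, ← hT]
      have hu : ∀ y, c j = some y → (y, j) ∉ loopSet c p ∧ (y + 1, j) ∉ loopSet c p := fun y hy =>
        ⟨fun h' => hjT (mem_turnTimes_of_touch hc hp hy (Or.inl h')),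
          fun h' => hjT (mem_turnTimes_of_touch hc hp hy (Or.inr h'))⟩
      have hu' : ∀ y, c' j = some y → (y, j) ∉ loopSet c p ∧ (y + 1, j) ∉ loopSet c p := by
        rw [hγ]
        exact fun y hy => ⟨fun h' => hjT' (mem_turnTimes_of_touch hc' hp hy (Or.inl h')),
          fun h' => hjT' (mem_turnTimes_of_touch hc' hp hy (Or.inr h'))⟩
      have he' := congrFun he j
      unfold replaceLoop eraseBars at he'
      rw [if_neg (by simp [hjT]), if_neg (by simp [hjT']), ← hγ] at he'
      cases hy : c j with
      | none =>
        cases hz : c' j with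
        | none => simp only [shiftBars, hy, hz] at he'; exact ⟨rfl, he'⟩
        | some z =>
          simp only [shiftBars, hy, hz] at he'
          exfalso
          cases hAj : A j with
          | none => rw [hAj] at he'; split_ifs at he'
          | some e =>
            rw [hAj] at he'
            exact shift_ne_inserted (hu' z hz).1 (hu' z hz).2 (mem_insertions hA hAj).2 he'.symm
      | some y =>
        cases hz : c' j with
        | none =>
          simp only [shiftBars, hy, hz] at he'
          exfalso
          cases hAj : A' j with
          | none => rw [hAj] at he'; split_ifs at he'
          | some e =>
            rw [hAj] at he'
            have := (mem_insertions hA' hAj).2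
            rw [← hγ] at this
            exact shift_ne_inserted (hu y hy).1 (hu y hy).2 this he'
        | some z =>
          simp only [shiftBars, hy, hz] at he'
          have := shift_injective (hc j y hy).1 (hc' j z hz).1 (hu y hy).1 (hu' z hz).1 he'
          exact absurd ⟨by rw [hy, hz, this], Or.inr (by simp [hy])⟩ hcj
  exact ⟨funext fun j => (key j).1, funext fun j => (key j).2⟩

/-! ### The room for new double bars -/

/-- The decays along a loop, collected by time. -/
theorem prod_decay (hw : Windowed ℓ n c) (hc : OnChain ℓ c) (hnM : n < M)
    (hp : p ∈ circleLegs ℓ M) :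
    ∏ i ∈ Finset.range (loopLength c p), decay n ((next c)^[i] p) =
      ∏ j : ZMod M, if n ≤ j.val then
        Real.exp (-(((rightSlice ℓ (loopSet c p) j).card : ℝ) * (1 / n))) else 1 := by
  have h1 : ∏ i ∈ Finset.range (loopLength c p), decay n ((next c)^[i] p) =
      ∏ q ∈ (circleLegs ℓ M).filter (fun q => q ∈ loopSet c p), decay n q := by
    refine Finset.prod_bij (fun i _ => (next c)^[i] p) ?_ ?_ ?_ ?_
    · intro i _
      have := conn_iterate_next c p i
      exact Finset.mem_filter.2 ⟨loopSet_subset hc hp this, this⟩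
    · intro i hi j hj h
      exact iterate_injOn c p (Finset.mem_range.1 hi) (Finset.mem_range.1 hj) h
    · intro q hq
      obtain ⟨i, hi, h⟩ := Conn.exists_iterate hc hp (Finset.mem_filter.1 hq).2
      exact ⟨i, Finset.mem_range.2 hi, h⟩
    · intro i _; rfl
  rw [h1, Finset.prod_filter, circleLegs, Finset.prod_product_right]
  refine Finset.prod_congr rfl fun j _ => ?_
  rw [← Finset.prod_filter]
  have h2 := hw.card_slice hc hnM (loopSet_closed c p) j
  rw [slice] at h2
  have h3 : ∀ a : ℤ, decay n (a, j) = if n ≤ j.val then Real.exp (-(1 / (2 * n))) else 1 :=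
    fun a => rfl
  simp only [h3]
  rw [Finset.prod_const, h2]
  split_ifs
  · rw [← Real.exp_nat_mul]
    congr 1
    push_cast
    by_cases hn : (n : ℝ) = 0
    · simp [hn]
    · field_simp
  · simp

/-- The double bars at different times are inserted independently of each other. -/
theorem sum_insertions (u : ℝ) :
    ∑ A ∈ insertions ℓ n t₀ c p, u ^ barCount A =
      ∏ j : ZMod M, if FreeTime n t₀ c j then
        1 + ((rightSlice ℓ (loopSet c p) j).card : ℝ) * u else 1 := by
  simp only [pow_barCount]
  unfold insertions
  rw [← Finset.prod_univ_sum (f := fun _ o => if o = none then 1 else u)]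
  refine Finset.prod_congr rfl fun j _ => ?_
  split_ifs with h
  · rw [Finset.sum_insertNone]
    simp only [if_true, reduceCtorEq, if_false, Finset.sum_const, nsmul_eq_mul]
    rw [Finset.card_image_of_injective _ (sub_left_injective)]
  · simp

/-- The inequality `1 + x ≥ exp (x - x ^ 2)`. -/
theorem exp_sub_sq_le {x : ℝ} (hx : 0 ≤ x) : Real.exp (-(x * x)) ≤ Real.exp (-x) * (1 + x) := by
  have h1 : (1 - (x - x * x)) * Real.exp (x - x * x) ≤ 1 := by
    have := Real.add_one_le_exp (-(x - x * x))
    calc (1 - (x - x * x)) * Real.exp (x - x * x)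
        ≤ Real.exp (-(x - x * x)) * Real.exp (x - x * x) :=
          mul_le_mul_of_nonneg_right (by linarith) (Real.exp_pos _).le
      _ = 1 := by rw [← Real.exp_add]; simp
  have h2 : Real.exp (x - x * x) ≤ 1 + x := by
    have h3 : 0 < 1 - (x - x * x) := by nlinarith [sq_nonneg (x - 1)]
    have h4 : 1 ≤ (1 - (x - x * x)) * (1 + x) := by
      have : (1 - (x - x * x)) * (1 + x) = 1 + x ^ 3 := by ring
      rw [this]; linarith [pow_nonneg hx 3]
    exact le_of_mul_le_mul_left (h1.trans h4) h3
  calc Real.exp (-(x * x)) = Real.exp (-x) * Real.exp (x - x * x) := by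
        rw [← Real.exp_add]; ring_nf
    _ ≤ _ := mul_le_mul_of_nonneg_left h2 (Real.exp_pos _).le

theorem card_rightSlice_le (hw : Windowed ℓ n c) (hc : OnChain ℓ c) (hnM : n < M) (j : ZMod M) :
    (rightSlice ℓ (loopSet c p) j).card ≤ ℓ := by
  have h1 := hw.card_slice hc hnM (loopSet_closed c p) j
  have h2 : (slice ℓ (loopSet c p) j).card ≤ 2 * ℓ := by
    refine (Finset.card_filter_le _ _).trans ?_
    simp
  omega

/-- The sum over the inserted double bars makes up for the decay along the loop, up to an error
that vanishes as `n → ∞`. -/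
theorem exp_le_decay_mul_insertions (hw : Windowed ℓ n c) (hc : OnChain ℓ c) (hn : 0 < n)
    (hnM : n < M) (hp : p ∈ circleLegs ℓ M) {B : ℕ} (hB : M ≤ B * n) :
    Real.exp (-((B * ℓ ^ 2 + 2 * ℓ : ℝ) * (barCount c + 1) * (1 / n))) ≤
      (∏ i ∈ Finset.range (loopLength c p), decay n ((next c)^[i] p)) *
        ∑ A ∈ insertions ℓ n t₀ c p, (1 / (n : ℝ)) ^ barCount A := by
  rw [prod_decay hw hc hnM hp, sum_insertions, ← Finset.prod_mul_distrib]
  set u : ℝ := 1 / n with hu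
  have hu0 : 0 < u := by positivity
  -- The times outside the window that are not available for a new double bar.
  set E : Finset (ZMod M) := Finset.univ.filter (fun j => c j ≠ none) ∪ {t₀, (n : ZMod M)}
    with hE
  have hEcard : E.card ≤ barCount c + 2 := by
    refine (Finset.card_union_le _ _).trans ?_
    have : ({t₀, (n : ZMod M)} : Finset (ZMod M)).card ≤ 2 := Finset.card_le_two
    unfold barCount
    omega
  have step : ∀ j : ZMod M, Real.exp (-((ℓ * u) * (ℓ * u) + if j ∈ E then ℓ * u else 0)) ≤
      (if n ≤ j.val then Real.exp (-(((rightSlice ℓ (loopSet c p) j).card : ℝ) * u)) else 1) *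
        (if FreeTime n t₀ c j then 1 + ((rightSlice ℓ (loopSet c p) j).card : ℝ) * u else 1) := by
    intro j
    have hd : ((rightSlice ℓ (loopSet c p) j).card : ℝ) ≤ ℓ := by
      exact_mod_cast card_rightSlice_le hw hc hnM j
    set d : ℝ := ((rightSlice ℓ (loopSet c p) j).card : ℝ)
    have hd0 : 0 ≤ d := Nat.cast_nonneg _
    have hdu : d * u ≤ ℓ * u := mul_le_mul_of_nonneg_right hd hu0.le
    have hdu0 : 0 ≤ d * u := by positivity
    have hsq : (d * u) * (d * u) ≤ (ℓ * u) * (ℓ * u) := mul_le_mul hdu hdu hdu0 (by positivity)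
    have hite : (0 : ℝ) ≤ if j ∈ E then ℓ * u else 0 := by split_ifs <;> positivity
    by_cases h1 : n ≤ j.val
    · rw [if_pos h1]
      by_cases h2 : FreeTime n t₀ c j
      · rw [if_pos h2]
        refine le_trans ?_ (exp_sub_sq_le hdu0)
        apply Real.exp_le_exp.2
        linarith
      · rw [if_neg h2, mul_one]
        have hjE : j ∈ E := by
          by_contra h3
          apply h2
          simp only [hE, Finset.mem_union, Finset.mem_filter, Finset.mem_univ, true_and,
            Finset.mem_insert, Finset.mem_singleton, not_or, not_not] at h3
          refine ⟨lt_of_le_of_ne h1 fun h4 => h3.2.2 ?_, h3.2.1, h3.1⟩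
          rw [h4, ZMod.natCast_zmod_val]
        rw [if_pos hjE]
        apply Real.exp_le_exp.2
        nlinarith
    · rw [if_neg h1, if_neg (fun h : FreeTime n t₀ c j => h1 h.1.le), mul_one]
      apply Real.exp_le_one_iff.2
      nlinarith
  refine le_trans ?_ (Finset.prod_le_prod (fun j _ => (Real.exp_pos _).le) fun j _ => step j)
  rw [← Real.exp_sum]
  apply Real.exp_le_exp.2
  rw [Finset.sum_neg_distrib, Finset.sum_add_distrib, Finset.sum_ite_mem, Finset.univ_inter]
  simp only [Finset.sum_const, nsmul_eq_mul, Finset.card_univ, ZMod.card]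
  have h1 : (M : ℝ) * u ≤ B := by
    have : (M : ℝ) ≤ B * n := by exact_mod_cast hB
    rw [hu, mul_one_div, div_le_iff₀ (by positivity)]; exact this
  have h2 : (E.card : ℝ) ≤ barCount c + 2 := by exact_mod_cast hEcard
  have h3 : (M : ℝ) * (ℓ * u * (ℓ * u)) ≤ B * ℓ ^ 2 * u := by
    calc (M : ℝ) * (ℓ * u * (ℓ * u)) = (M * u) * (ℓ ^ 2 * u) := by ring
      _ ≤ B * (ℓ ^ 2 * u) := mul_le_mul_of_nonneg_right h1 (by positivity)
      _ = _ := by ring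
  have h4 : (E.card : ℝ) * (ℓ * u) ≤ (barCount c + 2) * (ℓ * u) :=
    mul_le_mul_of_nonneg_right h2 (by positivity)
  have h5 : (0 : ℝ) ≤ B * ℓ ^ 2 * u * barCount c := by positivity
  have h6 : (0 : ℝ) ≤ ℓ * u * barCount c := by positivity
  nlinarith

end peierls

/-! ### The sum over contours -/

section peierls

variable {M : ℕ} [NeZero M] {ℓ n : ℕ} {t₀ : ZMod M} {c c' : Bars M} {p : ℤ × ZMod M}

/-- The configurations with a given walk along the loop through `p` and given double bars in the
window, with their weight lowered by a factor that tends to one. -/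
theorem sum_code_le {θ : ℝ} (hθ : 1 ≤ θ) (hn : 0 < n) (hnM : n < M) {B : ℕ} (hB : M ≤ B * n)
    (hp : p ∈ circleLegs ℓ M) (W : Bars M) {l : List (Option Bool)} {h : ℕ} (hh : 1 ≤ h)
    (hl : l.reduceOption.length = 2 * h) :
    ∑ c ∈ (windowConfigs ℓ n t₀).filter (fun c => maskBars c (windowTimes n M) = W ∧
        code c p (loopLength c p) = l),
      circleWeight θ ℓ n c *
        Real.exp (-((B * ℓ ^ 2 + 2 * ℓ : ℝ) * (barCount c + 1) * (1 / n))) * θ ^ (h - 1) ≤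
    pathWeight n p W l *
      ∑ c ∈ (windowConfigs ℓ n t₀).filter (fun c => maskBars c (windowTimes n M) = W),
        circleWeight θ ℓ n c := by
  set F := (windowConfigs ℓ n t₀).filter (fun c => maskBars c (windowTimes n M) = W ∧
        code c p (loopLength c p) = l) with hF
  have hmem : ∀ c ∈ F, (OnChain ℓ c ∧ Windowed ℓ n c) ∧ maskBars c (windowTimes n M) = W ∧
      code c p (loopLength c p) = l := by
    intro c hc
    obtain ⟨h1, h2⟩ := Finset.mem_filter.1 hc
    have := mem_windowConfigs.1 h1
    exact ⟨⟨this.1.1, this.2⟩, h2⟩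
  have step : ∀ c ∈ F, circleWeight θ ℓ n c *
        Real.exp (-((B * ℓ ^ 2 + 2 * ℓ : ℝ) * (barCount c + 1) * (1 / n))) * θ ^ (h - 1) ≤
      ∑ A ∈ insertions ℓ n t₀ c p, pathWeight n p W l *
        circleWeight θ ℓ n (replaceLoop n p c A) := by
    intro c hc
    obtain ⟨⟨h1, h2⟩, h3, h4⟩ := hmem c hc
    have h5 : (evenTurns c p (loopLength c p)).card = h := by
      have := length_turnSeq c p
      unfold turnSeq at this
      rw [h4] at this; omega
    have h6 := exp_le_decay_mul_insertions (t₀ := t₀) h2 h1 hn hnM hp hB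
    have hpw := pathWeight_code c p (loopLength c p) (windowTimes n M)
      (fun j hj => mem_windowTimes.2 hj)
    rw [h3, h4] at hpw
    set P := ∏ i ∈ Finset.range (loopLength c p), decay n ((next c)^[i] p)
    have hP : 0 ≤ P := Finset.prod_nonneg fun i _ => (decay_pos _ _).le
    have hwt := circleWeight_nonneg hθ ℓ n c
    have hθ0 : 0 ≤ θ := by linarith
    calc _ ≤ circleWeight θ ℓ n c * (P * ∑ A ∈ insertions ℓ n t₀ c p,
          (1 / (n : ℝ)) ^ barCount A) * θ ^ (h - 1) := by gcongr
      _ = ∑ A ∈ insertions ℓ n t₀ c p, P * (circleWeight θ ℓ n c * θ ^ (h - 1) *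
          (1 / (n : ℝ)) ^ barCount A) := by
        rw [Finset.mul_sum, Finset.mul_sum, Finset.sum_mul]
        exact Finset.sum_congr rfl fun A _ => by ring
      _ ≤ _ := by
        refine Finset.sum_le_sum fun A hA => ?_
        have := circleWeight_replaceLoop hθ hn h1 hp hA (by omega)
        rw [h5] at this
        rw [hpw]
        calc _ ≤ P * _ := mul_le_mul_of_nonneg_left this hP
          _ = _ := by ring
  refine (Finset.sum_le_sum step).trans ?_
  simp only [← Finset.mul_sum]
  refine mul_le_mul_of_nonneg_left ?_ (pathWeight_nonneg _ _ _ _)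
  rw [Finset.sum_sigma' F (fun c => insertions ℓ n t₀ c p)]
  rw [← Finset.sum_image (g := fun x : (_ : Bars M) × Bars M => replaceLoop n p x.1 x.2)
    (f := fun c => circleWeight θ ℓ n c)]
  · refine Finset.sum_le_sum_of_subset_of_nonneg ?_ fun c _ _ => circleWeight_nonneg hθ ℓ n c
    intro d hd
    obtain ⟨⟨c, A⟩, hx, rfl⟩ := Finset.mem_image.1 hd
    obtain ⟨hc, hA⟩ := Finset.mem_sigma.1 hx
    obtain ⟨⟨h1, h2⟩, h3, h4⟩ := hmem c hc
    refine Finset.mem_filter.2 ⟨replaceLoop_mem hnM (Finset.mem_filter.1 hc).1 hA, ?_⟩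
    rw [← h3]
    funext j
    unfold maskBars
    split_ifs with hj
    · exact maskBars_replaceLoop h2 h1 hnM hA (mem_windowTimes.1 hj)
    · rfl
  · rintro ⟨c, A⟩ hx ⟨c', A'⟩ hx' he
    obtain ⟨hc, hA⟩ := Finset.mem_sigma.1 hx
    obtain ⟨hc', hA'⟩ := Finset.mem_sigma.1 hx'
    obtain ⟨⟨h1, h2⟩, h3, h4⟩ := hmem c hc
    obtain ⟨⟨h1', h2'⟩, h3', h4'⟩ := hmem c' hc'
    obtain ⟨rfl, rfl⟩ := replaceLoop_injective h1 h1' hp (h4.trans h4'.symm) (fun j hj => by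
      have := congrFun (h3.trans h3'.symm) j
      unfold maskBars at this
      rwa [if_pos (mem_windowTimes.2 hj), if_pos (mem_windowTimes.2 hj)] at this) hA hA' he
    rfl

/-- A walk that returns to its starting leg for the first time is not an initial part of another
such walk. -/
theorem code_eq_of_prefix (hc : OnChain ℓ c) (hp : p ∈ circleLegs ℓ M)
    (h : code c p (loopLength c p) <+: code c' p (loopLength c' p)) :
    code c p (loopLength c p) = code c' p (loopLength c' p) := by
  have hlen := h.length_le
  rw [length_code, length_code] at hlen
  have h1 : code c p (loopLength c p) = code c' p (loopLength c p) := by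
    rw [← take_code c' p hlen]
    simpa [length_code] using List.prefix_iff_eq_take.1 h
  have h2 := (code_determines h1).1 _ le_rfl
  rw [iterate_loopLength] at h2
  have h3 : loopLength c' p ≤ loopLength c p :=
    Function.IsPeriodicPt.minimalPeriod_le (loopLength_pos hc hp) h2.symm
  rw [h1, le_antisymm hlen h3]

/-- The configurations in which the loop through `p` makes given turns. -/
theorem sum_turnSeq_le {θ : ℝ} (hθ : 1 ≤ θ) (hn : 0 < n) (hnM : n < M) {B : ℕ} (hB : M ≤ B * n)
    (hp : p ∈ circleLegs ℓ M) {s : List Bool} {h : ℕ} (hh : 1 ≤ h) (hs : s.length = 2 * h) :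
    (∑ c ∈ (windowConfigs ℓ n t₀).filter (fun c => turnSeq c p = s),
      circleWeight θ ℓ n c *
        Real.exp (-((B * ℓ ^ 2 + 2 * ℓ : ℝ) * (barCount c + 1) * (1 / n)))) * θ ^ (h - 1) ≤
    4 ^ h * ∑ c ∈ windowConfigs ℓ n t₀, circleWeight θ ℓ n c := by
  set F := (windowConfigs ℓ n t₀).filter (fun c => turnSeq c p = s) with hF
  set mask : Bars M → Bars M := fun c => maskBars c (windowTimes n M) with hmask
  set walk : Bars M → List (Option Bool) := fun c => code c p (loopLength c p) with hwalk
  set Ws := (windowConfigs ℓ n t₀).image mask with hWs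
  set Ls := F.image walk with hLs
  set f : Bars M → ℝ := fun c => circleWeight θ ℓ n c *
        Real.exp (-((B * ℓ ^ 2 + 2 * ℓ : ℝ) * (barCount c + 1) * (1 / n))) with hf
  have hLmem : ∀ l ∈ Ls, ∃ c, OnChain ℓ c ∧ walk c = l ∧ l.reduceOption = s := by
    intro l hl
    obtain ⟨c, hc, rfl⟩ := Finset.mem_image.1 hl
    obtain ⟨h1, h2⟩ := Finset.mem_filter.1 hc
    exact ⟨c, (mem_windowConfigs.1 h1).1.1, rfl, h2⟩
  have hZ : ∑ c ∈ windowConfigs ℓ n t₀, circleWeight θ ℓ n c = ∑ W ∈ Ws,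
      ∑ c ∈ (windowConfigs ℓ n t₀).filter (fun c => mask c = W), circleWeight θ ℓ n c :=
    (Finset.sum_fiberwise_of_maps_to (fun c hc => Finset.mem_image_of_mem _ hc) _).symm
  have hsum : ∑ c ∈ F, f c = ∑ W ∈ Ws, ∑ l ∈ Ls,
      ∑ c ∈ (F.filter (fun c => mask c = W)).filter (fun c => walk c = l), f c := by
    rw [← Finset.sum_fiberwise_of_maps_to (g := mask) (t := Ws)
      (fun c hc => Finset.mem_image_of_mem _ (Finset.mem_filter.1 hc).1)]
    refine Finset.sum_congr rfl fun W _ => ?_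
    rw [← Finset.sum_fiberwise_of_maps_to (g := walk) (t := Ls)
      (fun c hc => Finset.mem_image_of_mem _ (Finset.mem_filter.1 hc).1)]
  rw [hsum, hZ, Finset.sum_mul, Finset.mul_sum]
  refine Finset.sum_le_sum fun W _ => ?_
  have hZW : 0 ≤ ∑ c ∈ (windowConfigs ℓ n t₀).filter (fun c => mask c = W),
      circleWeight θ ℓ n c := Finset.sum_nonneg fun c _ => circleWeight_nonneg hθ ℓ n c
  have htree : ∑ l ∈ Ls, pathWeight n p W l ≤ 4 ^ h := by
    have := sum_pathWeight_le hn (Ls.sup List.length) p W s Ls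
      (fun l hl => ⟨Finset.le_sup (f := List.length) hl, by
        obtain ⟨c, -, -, h3⟩ := hLmem l hl; exact h3⟩)
      (fun l hl l' hl' hpre => by
        obtain ⟨c, h1, rfl, -⟩ := hLmem l hl
        obtain ⟨c', -, rfl, -⟩ := hLmem l' hl'
        exact code_eq_of_prefix h1 hp hpre)
    rw [hs, pow_mul] at this
    norm_num at this
    exact this
  refine le_trans ?_ (mul_le_mul_of_nonneg_right htree hZW)
  rw [Finset.sum_mul, Finset.sum_mul]
  refine Finset.sum_le_sum fun l hl => ?_
  obtain ⟨-, -, -, h3⟩ := hLmem l hl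
  refine le_trans (le_of_eq ?_)
    (sum_code_le (t₀ := t₀) hθ hn hnM hB hp W hh (l := l) (by rw [h3, hs]))
  rw [Finset.sum_mul]
  refine Finset.sum_congr ?_ fun c _ => rfl
  ext c
  simp only [hF, Finset.mem_filter]
  constructor
  · rintro ⟨⟨⟨h1, -⟩, h4⟩, h5⟩; exact ⟨h1, h4, h5⟩
  · rintro ⟨h1, h4, h5⟩
    refine ⟨⟨⟨h1, ?_⟩, h4⟩, h5⟩
    unfold turnSeq
    rw [h5, h3]

theorem LongLoop.congr {p q : ℤ × ZMod M} (h : LongLoop ℓ c p) (hq : Conn c p q) :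
    LongLoop ℓ c q := by
  unfold LongLoop at *
  convert h using 5
  exact ⟨fun h' => hq.trans h', fun h' => hq.symm.trans h'⟩

/-- A long loop that surrounds `(x, t₀)` passes through a leg `(y, t₀)` with `y ≤ x`, and if
`y ≠ x`, then it also reaches a column to the right of `x`. -/
theorem Surrounded.exists_start {x : ℤ} (hx : x < 2 * ℓ) (hw : Windowed ℓ n c) (hc : OnChain ℓ c)
    (hnM : n < M) (h : Surrounded ℓ t₀ x c) :
    ∃ y, 0 ≤ y ∧ y ≤ x ∧ LongLoop ℓ c (y, t₀) ∧
      (y = x ∨ ∃ b, x < b ∧ Conn c (y, t₀) (b, t₀)) := by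
  obtain ⟨p, hp, hlong, h | ⟨h1, h2⟩⟩ := h
  · exact ⟨x, (mem_circleLegs.1 (loopSet_subset hc hp h)).1, le_rfl, hlong.congr h, Or.inl rfl⟩
  · have hy : ∃ y, 0 ≤ y ∧ y < x ∧ (y, t₀) ∈ loopSet c p := by
      by_contra hno
      push Not at hno
      have : par (loopSet c p) x t₀ = 0 := Finset.sum_eq_zero fun z hz => by
        have := Finset.mem_Ico.1 hz
        exact ind_of_notMem (hno z this.1 this.2)
      rw [h2] at this
      exact absurd this (by decide)
    have hb : ∃ b, x < b ∧ (b, t₀) ∈ loopSet c p := by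
      by_contra hno
      push Not at hno
      have h3 := hw.par_total hc hnM (loopSet_closed c p) t₀
      have : par (loopSet c p) x t₀ = par (loopSet c p) (2 * ℓ) t₀ := by
        refine Finset.sum_subset (Finset.Ico_subset_Ico_right hx.le) fun z hz hz' => ?_
        have e1 := Finset.mem_Ico.1 hz
        have e2 : x ≤ z := by
          by_contra h'; exact hz' (Finset.mem_Ico.2 ⟨e1.1, not_le.1 h'⟩)
        rcases eq_or_lt_of_le e2 with rfl | e3
        · exact ind_of_notMem h1
        · exact ind_of_notMem (hno z e3)
      rw [h2, h3] at this
      exact absurd this (by decide)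
    obtain ⟨y, hy0, hyx, hy⟩ := hy
    obtain ⟨b, hb0, hb⟩ := hb
    exact ⟨y, hy0, hyx.le, hlong.congr hy, Or.inr ⟨b, hb0, Conn.trans (Conn.symm hy) hb⟩⟩

/-- The sequences of turns that occur when a long loop passes through or surrounds `(x, t₀)`. -/
theorem Surrounded.exists_turnSeq {x : ℤ} (hx : x < 2 * ℓ) (hw : Windowed ℓ n c)
    (hc : OnChain ℓ c) (hnM : n < M) (h : Surrounded ℓ t₀ x c) :
    ∃ h ∈ Finset.Ico 3 (M + 1), ∃ d ∈ Finset.range (2 * ℓ), ∃ s ∈ reachingSeqs (2 * h) d,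
      0 ≤ x - d ∧ turnSeq c (x - d, t₀) = s := by
  obtain ⟨y, hy0, hyx, hlong, hb⟩ := h.exists_start hx hw hc hnM
  have hp : (y, t₀) ∈ circleLegs ℓ M := mem_circleLegs.2 ⟨hy0, by simp only; omega⟩
  have hyd : x - ((x - y).toNat : ℤ) = y := by omega
  refine ⟨(evenTurns c (y, t₀) (loopLength c (y, t₀))).card, ?_, (x - y).toNat, ?_,
    turnSeq c (y, t₀), ?_, by omega, by rw [hyd]⟩
  · rw [Finset.mem_Ico]
    refine ⟨six_le_length_turnSeq hw hc hnM hp _ (fun a ha => (Finset.mem_filter.1 ha).2) hlong,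
      Nat.lt_succ_of_le ?_⟩
    refine (card_evenTurns_le c (y, t₀) (γ := loopSet c (y, t₀)) fun q => mem_loopSet).trans ?_
    exact (Finset.card_le_univ _).trans_eq (ZMod.card M)
  · rw [Finset.mem_range]; omega
  · refine Finset.mem_filter.2 ⟨Finset.mem_filter.2 ⟨?_, disp_turnSeq c _⟩, ?_⟩
    · rw [mem_turnSeqs, length_turnSeq]
    · rcases hb with rfl | ⟨b, hxb, hb⟩
      · left; simp
      · right
        obtain ⟨i, hi, he⟩ := Conn.exists_iterate hc hp hb
        have h1 := fst_iterate_next c (y, t₀) i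
        rw [he] at h1
        have h2 := disp_le_maxDisp_of_prefix
          (reduceOption_prefix (code_prefix c (y, t₀) hi.le))
        unfold turnSeq
        simp only at h1
        omega

/-- A union bound. -/
theorem sum_filter_le_sum_filter {X K : Type*} (F : Finset X) (P : X → Prop) (T : Finset K)
    (Q : K → X → Prop) (f : X → ℝ) (hf : ∀ c, 0 ≤ f c)
    (h : ∀ c ∈ F, P c → ∃ k ∈ T, Q k c) :
    ∑ c ∈ F.filter P, f c ≤ ∑ k ∈ T, ∑ c ∈ F.filter (Q k), f c := by
  simp only [Finset.sum_filter]
  rw [Finset.sum_comm]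
  refine Finset.sum_le_sum fun c hc => ?_
  have hnn : ∀ k ∈ T, 0 ≤ if Q k c then f c else 0 := fun k _ => by
    split_ifs
    · exact hf c
    · exact le_rfl
  by_cases hP : P c
  · obtain ⟨k, hk, hQ⟩ := h c hc hP
    rw [if_pos hP]
    refine le_trans (le_of_eq ?_) (Finset.single_le_sum hnn hk)
    rw [if_pos hQ]
  · rw [if_neg hP]
    exact Finset.sum_nonneg hnn

/-- The Peierls bound at finite `n`. -/
theorem sum_surrounded_le {θ : ℝ} (hθ : 1 ≤ θ) (hn : 0 < n) (hnM : n < M) {B : ℕ}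
    (hB : M ≤ B * n) {x : ℤ} (hx : x < 2 * ℓ) {r : ℝ}
    (hr : ∀ H, ∑ h ∈ Finset.Ico 3 H,
      ((∑ d ∈ Finset.range (2 * ℓ), (reachingSeqs (2 * h) d).card : ℕ) : ℝ) * 4 ^ h *
        (θ ^ (h - 1))⁻¹ ≤ r) :
    ∑ c ∈ (windowConfigs ℓ n t₀).filter (Surrounded ℓ t₀ x), circleWeight θ ℓ n c *
      Real.exp (-((B * ℓ ^ 2 + 2 * ℓ : ℝ) * (barCount c + 1) * (1 / n))) ≤
    r * ∑ c ∈ windowConfigs ℓ n t₀, circleWeight θ ℓ n c := by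
  set Z := ∑ c ∈ windowConfigs ℓ n t₀, circleWeight θ ℓ n c with hZ
  have hZ0 : 0 ≤ Z := Finset.sum_nonneg fun c _ => circleWeight_nonneg hθ ℓ n c
  set f : Bars M → ℝ := fun c => circleWeight θ ℓ n c *
      Real.exp (-((B * ℓ ^ 2 + 2 * ℓ : ℝ) * (barCount c + 1) * (1 / n))) with hf
  have hf0 : ∀ c, 0 ≤ f c := fun c => mul_nonneg (circleWeight_nonneg hθ ℓ n c) (Real.exp_pos _).le
  have h1 := sum_filter_le_sum_filter (windowConfigs ℓ n t₀) (Surrounded ℓ t₀ x)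
    ((Finset.Ico 3 (M + 1)).sigma fun h => (Finset.range (2 * ℓ)).sigma fun d =>
      reachingSeqs (2 * h) d)
    (fun k c => 0 ≤ x - k.2.1 ∧ turnSeq c (x - k.2.1, t₀) = k.2.2) f hf0 (fun c hc hs => by
      have hc' := mem_windowConfigs.1 hc
      obtain ⟨h, hh, d, hd, s, hs, h0, h1⟩ := hs.exists_turnSeq hx hc'.2 hc'.1.1 hnM
      exact ⟨⟨h, d, s⟩, by simp only [Finset.mem_sigma]; exact ⟨hh, hd, hs⟩, h0, h1⟩)
  refine h1.trans ?_
  refine le_trans ?_ (mul_le_mul_of_nonneg_right (hr (M + 1)) hZ0)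
  rw [Finset.sum_sigma, Finset.sum_mul]
  refine Finset.sum_le_sum fun h hh => ?_
  rw [Finset.sum_sigma]
  push_cast
  rw [Finset.sum_mul, Finset.sum_mul, Finset.sum_mul]
  refine Finset.sum_le_sum fun d hd => ?_
  rw [mul_assoc, mul_assoc, ← nsmul_eq_mul, ← Finset.sum_const]
  refine Finset.sum_le_sum fun s hs => ?_
  have hθ0 : 0 < θ ^ (h - 1) := by positivity
  by_cases h0 : 0 ≤ x - (d : ℤ)
  · have hlen : s.length = 2 * h :=
      mem_turnSeqs.1 (Finset.mem_filter.1 (Finset.mem_filter.1 hs).1).1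
    have := sum_turnSeq_le (ℓ := ℓ) (t₀ := t₀) hθ hn hnM hB (p := (x - d, t₀)) (s := s) (h := h)
      (mem_circleLegs.2 ⟨h0, by simp only; omega⟩) (by have := (Finset.mem_Ico.1 hh).1; omega) hlen
    rw [← mul_assoc, mul_right_comm, ← div_eq_mul_inv, le_div_iff₀ hθ0]
    simpa only [h0, true_and] using this
  · simp only [h0, false_and, Finset.filter_false, Finset.sum_empty]
    positivity

end peierls

/-! ### Removing empty times -/

section collapse

variable {M N : ℕ} [NeZero M] [NeZero N]

/-- Two configurations, on circles of different lengths and with a marked time on each, have the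
same system of loops up to a reparametrization of time. -/
def SameLoops (c : Bars M) (t : ZMod M) (d : Bars N) (s : ZMod N) : Prop :=
  ∀ ℓ, loopCount ℓ c = loopCount ℓ d ∧ ∀ x, Surrounded ℓ t x c ↔ Surrounded ℓ s x d

theorem SameLoops.trans {L : ℕ} [NeZero L] {c : Bars M} {t : ZMod M} {d : Bars N} {s : ZMod N}
    {e : Bars L} {r : ZMod L} (h : SameLoops c t d s) (h' : SameLoops d s e r) :
    SameLoops c t e r := fun ℓ =>
  ⟨(h ℓ).1.trans (h' ℓ).1, fun x => ((h ℓ).2 x).trans ((h' ℓ).2 x)⟩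

theorem card_image_le_of_ker {X Y Z : Type*} [DecidableEq Y] [DecidableEq Z] (S : Finset X)
    (f : X → Y) (g : X → Z) (h : ∀ p ∈ S, ∀ q ∈ S, g p = g q → f p = f q) :
    (S.image f).card ≤ (S.image g).card := by
  have h1 : S.image f = (S.image fun p => (f p, g p)).image Prod.fst := by
    rw [Finset.image_image]; rfl
  have h2 : S.image g = (S.image fun p => (f p, g p)).image Prod.snd := by
    rw [Finset.image_image]; rfl
  rw [h1, h2, Finset.card_image_of_injOn (f := Prod.snd)]
  · exact Finset.card_image_le
  · intro y hy z hz he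
    obtain ⟨p, hp, rfl⟩ := Finset.mem_image.1 hy
    obtain ⟨q, hq, rfl⟩ := Finset.mem_image.1 hz
    exact Prod.ext (h p hp q hq he) he

variable {c : Bars M} {d : Bars N} {D : Set (ZMod M)} {ρ : ZMod M → ZMod N} {σ : ZMod N → ZMod M}

/-- The circle of length `M` is mapped onto the circle of length `N` by collapsing the times
outside `D`, at which there is no double bar; `σ` is the inverse bijection onto `D`. -/
structure IsCollapse (c : Bars M) (d : Bars N) (D : Set (ZMod M)) (ρ : ZMod M → ZMod N)
    (σ : ZMod N → ZMod M) : Prop where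
  step : ∀ j, j + 1 ∈ D → ρ (j + 1) = ρ j + 1
  stay : ∀ j, j + 1 ∉ D → ρ (j + 1) = ρ j
  empty : ∀ j, j ∉ D → c j = none
  bars : ∀ j ∈ D, d (ρ j) = c j
  mem : ∀ k, σ k ∈ D
  right_inv : ∀ k, ρ (σ k) = k
  left_inv : ∀ j ∈ D, σ (ρ j) = j

namespace IsCollapse

theorem conn_map (h : IsCollapse c d D ρ σ) {p q : ℤ × ZMod M} (hpq : Conn c p q) :
    Conn d (p.1, ρ p.2) (q.1, ρ q.2) := by
  refine loopOf_eq.1 (Conn.map_eq (fun p => loopOf d (p.1, ρ p.2)) ?_ ?_ ?_ hpq)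
  · intro a j ht
    by_cases hj : j + 1 ∈ D
    · have e := h.step j hj
      refine loopOf_eq.2 (Link.conn ?_)
      simp only
      rw [e]
      refine link_up ?_
      rwa [← e, h.bars _ hj]
    · simp only
      rw [h.stay j hj]
  · intro y j hy
    have hj : j + 1 ∈ D := by
      by_contra h'; rw [h.empty _ h'] at hy; cases hy
    refine loopOf_eq.2 (Link.conn (link_below ?_))
    rw [← h.step j hj, h.bars _ hj, hy]
  · intro y j hy
    have hj : j ∈ D := by
      by_contra h'; rw [h.empty _ h'] at hy; cases hy
    refine loopOf_eq.2 (Link.conn (link_above ?_))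
    rw [h.bars _ hj, hy]

/-- The column is not interrupted between a time and the representative of its class. -/
theorem conn_flat (h : IsCollapse c d D ρ σ) (a : ℤ) (j : ZMod M) :
    Conn c (a, j) (a, σ (ρ j)) := by
  have key : ∀ i : ℕ, Conn c (a, σ 0 + i) (a, σ (ρ (σ 0 + i))) := by
    intro i
    induction i with
    | zero =>
      rw [Nat.cast_zero, add_zero, h.right_inv]; exact Conn.refl _ _
    | succ i ih =>
      rw [Nat.cast_succ, ← add_assoc]
      by_cases hj : σ 0 + i + 1 ∈ D
      · rw [h.left_inv _ hj]; exact Conn.refl _ _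
      · rw [h.stay _ hj]
        refine Conn.trans (Conn.symm (Link.conn (link_up ?_))) ih
        rw [h.empty _ hj]
        simp [Touches]
  have := key (j - σ 0).val
  rw [ZMod.natCast_zmod_val, add_sub_cancel] at this
  exact this

theorem conn_comap (h : IsCollapse c d D ρ σ) {p q : ℤ × ZMod N} (hpq : Conn d p q) :
    Conn c (p.1, σ p.2) (q.1, σ q.2) := by
  have hprev : ∀ k, ∃ j, j + 1 = σ (k + 1) ∧ ρ j = k := by
    intro k
    refine ⟨σ (k + 1) - 1, by ring, ?_⟩
    have := h.step (σ (k + 1) - 1) (by rw [sub_add_cancel]; exact h.mem _)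
    rw [sub_add_cancel, h.right_inv] at this
    exact (add_right_cancel this).symm
  have hbar : ∀ k, c (σ k) = d k := fun k => by rw [← h.bars _ (h.mem k), h.right_inv]
  refine loopOf_eq.1 (Conn.map_eq (fun p => loopOf c (p.1, σ p.2)) ?_ ?_ ?_ hpq)
  · intro a k ht
    obtain ⟨j, h1, h2⟩ := hprev k
    refine loopOf_eq.2 ?_
    have h3 := h.conn_flat a j
    rw [h2] at h3
    refine h3.symm.trans ?_
    simp only
    rw [← h1]
    refine Link.conn (link_up ?_)
    rwa [h1, hbar]
  · intro y k hy
    obtain ⟨j, h1, h2⟩ := hprev k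
    have h3 := h.conn_flat y j
    have h4 := h.conn_flat (y + 1) j
    rw [h2] at h3 h4
    refine loopOf_eq.2 (h3.symm.trans (Conn.trans (Link.conn (link_below ?_)) h4))
    rw [h1, hbar, hy]
  · intro y k hy
    exact loopOf_eq.2 (Link.conn (link_above (by rw [hbar, hy])))

theorem conn_iff (h : IsCollapse c d D ρ σ) {p q : ℤ × ZMod M} :
    Conn c p q ↔ Conn d (p.1, ρ p.2) (q.1, ρ q.2) :=
  ⟨h.conn_map, fun h' =>
    ((h.conn_flat p.1 p.2).trans (h.conn_comap h')).trans (h.conn_flat q.1 q.2).symm⟩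

theorem sameLoops (h : IsCollapse c d D ρ σ) (t : ZMod M) :
    SameLoops c t d (ρ t) := by
  intro ℓ
  constructor
  · have e : (circleLegs ℓ M).image (fun p => loopOf d (p.1, ρ p.2)) =
        (circleLegs ℓ N).image (loopOf d) := by
      ext z
      simp only [Finset.mem_image, mem_circleLegs]
      constructor
      · rintro ⟨p, hp, rfl⟩; exact ⟨(p.1, ρ p.2), hp, rfl⟩
      · rintro ⟨p, hp, rfl⟩; exact ⟨(p.1, σ p.2), hp, by simp only [h.right_inv]⟩
    unfold loopCount
    rw [← e]
    refine le_antisymm (card_image_le_of_ker _ _ _ ?_) (card_image_le_of_ker _ _ _ ?_)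
    · intro p _ q _ hpq; exact loopOf_eq.2 (h.conn_iff.2 (loopOf_eq.1 hpq))
    · intro p _ q _ hpq; exact loopOf_eq.2 (h.conn_iff.1 (loopOf_eq.1 hpq))
  · intro x
    have hlong : ∀ p : ℤ × ZMod M, LongLoop ℓ c p ↔ LongLoop ℓ d (p.1, ρ p.2) := by
      intro p
      unfold LongLoop
      have : ∀ a, (∃ j, Conn c p (a, j)) ↔ ∃ k, Conn d (p.1, ρ p.2) (a, k) := by
        intro a
        constructor
        · rintro ⟨j, hj⟩; exact ⟨ρ j, h.conn_iff.1 hj⟩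
        · rintro ⟨k, hk⟩; exact ⟨σ k, h.conn_iff.2 (by simpa only [h.right_inv] using hk)⟩
      simp only [this]
    have hmem : ∀ (p : ℤ × ZMod M) a, (a, t) ∈ loopSet c p ↔
        (a, ρ t) ∈ loopSet d (p.1, ρ p.2) := fun p a => h.conn_iff
    have hpar : ∀ p : ℤ × ZMod M, par (loopSet c p) x t =
        par (loopSet d (p.1, ρ p.2)) x (ρ t) := by
      intro p
      unfold par ind
      simp only [hmem]
    unfold Surrounded
    constructor
    · rintro ⟨p, hp, h1, h2⟩
      rw [hlong, hmem, hpar] at *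
      exact ⟨(p.1, ρ p.2), mem_circleLegs.2 (by simpa using mem_circleLegs.1 hp), h1, h2⟩
    · rintro ⟨q, hq, h1, h2⟩
      refine ⟨(q.1, σ q.2), mem_circleLegs.2 (by simpa using mem_circleLegs.1 hq), ?_, ?_⟩
      · rw [hlong]; simpa only [h.right_inv] using h1
      · rw [hmem, hpar]; simpa only [h.right_inv] using h2

end IsCollapse

/-- A rotation of the time circle. -/
theorem sameLoops_rotate (c : Bars M) (t : ZMod M) :
    SameLoops (fun j => c (j - t)) t c 0 := by
  have h : IsCollapse (fun j => c (j - t)) c Set.univ (fun j => j - t) (fun k => k + t) :=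
    { step := fun j _ => by ring
      stay := fun j hj => absurd (Set.mem_univ _) hj
      empty := fun j hj => absurd (Set.mem_univ _) hj
      bars := fun j _ => rfl
      mem := fun _ => Set.mem_univ _
      right_inv := fun k => by ring
      left_inv := fun j _ => by ring }
  have := h.sameLoops t
  simpa using this

/-- The configuration with the entries of a list at the times after `0`, and nothing at time `0`. -/
def barsOf (M : ℕ) (X : List (Option ℤ)) : Bars M := fun j => (none :: X).getD j.val none

theorem natCast_val_eq {k m : ℕ} (hk : k < M) (h : m = k) : ((m : ℕ) : ZMod M).val = k := by
  rw [h, ZMod.val_natCast_of_lt hk]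

/-- An empty time can be removed. -/
theorem sameLoops_delete {P Q : List (Option ℤ)} (hM : M = P.length + Q.length + 2)
    (hN : N = P.length + Q.length + 1) :
    SameLoops (barsOf M (P ++ none :: Q)) 0 (barsOf N (P ++ Q)) 0 := by
  set m := P.length with hm
  have hget1 : ∀ i, i ≤ m → (none :: (P ++ none :: Q)).getD i none =
      (none :: (P ++ Q)).getD i none := by
    intro i hi
    cases i with
    | zero => rfl
    | succ i =>
      simp only [List.getD_cons_succ]
      rw [List.getD_append _ _ _ _ (by omega), List.getD_append _ _ _ _ (by omega)]
  have hget2 : ∀ i, m + 1 ≤ i → (none :: (P ++ none :: Q)).getD (i + 1) none =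
      (none :: (P ++ Q)).getD i none := by
    intro i hi
    obtain ⟨i, rfl⟩ : ∃ i', i = i' + 1 := ⟨i - 1, by omega⟩
    simp only [List.getD_cons_succ]
    rw [List.getD_append_right _ _ _ _ (by omega), List.getD_append_right _ _ _ _ (by omega)]
    have : i + 1 - P.length = (i - P.length) + 1 := by omega
    rw [this, List.getD_cons_succ]
  have hget3 : (none :: (P ++ none :: Q)).getD (m + 1) none = none := by
    simp only [List.getD_cons_succ]
    rw [List.getD_append_right _ _ _ _ (by omega)]
    simp [hm]
  have hv : ∀ j : ZMod M, j.val < M := fun j => ZMod.val_lt j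
  have hvN : ∀ j : ZMod N, j.val < N := fun j => ZMod.val_lt j
  set D : Set (ZMod M) := {j | j.val ≠ m + 1} with hD
  set ρ : ZMod M → ZMod N := fun j => ((if j.val ≤ m then j.val else j.val - 1 : ℕ) : ZMod N)
  set σ : ZMod N → ZMod M := fun k => ((if k.val ≤ m then k.val else k.val + 1 : ℕ) : ZMod M)
  have hρv : ∀ j, (ρ j).val = if j.val ≤ m then j.val else j.val - 1 := fun j =>
    natCast_val_eq (by have := hv j; split_ifs <;> omega) rfl
  have hσv : ∀ k, (σ k).val = if k.val ≤ m then k.val else k.val + 1 := fun k =>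
    natCast_val_eq (by have := hvN k; split_ifs <;> omega) rfl
  have hsucc : ∀ j : ZMod M, (j.val + 1 < M ∧ (j + 1).val = j.val + 1) ∨
      (j.val + 1 = M ∧ j + 1 = 0) := by
    intro j
    have := hv j
    rcases Nat.lt_or_ge (j.val + 1) M with h | h
    · exact Or.inl ⟨h, val_add_one' h⟩
    · have h' : j.val + 1 = M := by omega
      exact Or.inr ⟨h', val_add_one_of_last h'⟩
  have h : IsCollapse (barsOf M (P ++ none :: Q)) (barsOf N (P ++ Q)) D ρ σ :=
    { step := by
        intro j hj
        have hj' : (j + 1).val ≠ m + 1 := hj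
        apply ZMod.val_injective N
        rcases hsucc j with ⟨h1, h2⟩ | ⟨h1, h2⟩
        · have h3 : (ρ j).val + 1 < N := by rw [hρv]; split_ifs <;> omega
          rw [val_add_one' h3, hρv, hρv, h2]
          rw [h2] at hj'
          split_ifs <;> omega
        · have h3 : (ρ j).val + 1 = N := by rw [hρv]; split_ifs <;> omega
          rw [val_add_one_of_last h3, h2, hρv]
          simp
      stay := by
        intro j hj
        have hj' : (j + 1).val = m + 1 := not_not.1 hj
        apply ZMod.val_injective N
        rcases hsucc j with ⟨h1, h2⟩ | ⟨h1, h2⟩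
        · rw [hρv, hρv, h2]
          split_ifs <;> omega
        · rw [h2, ZMod.val_zero] at hj'; omega
      empty := by
        intro j hj
        have hj' : j.val = m + 1 := not_not.1 hj
        unfold barsOf
        rw [hj', hget3]
      bars := by
        intro j hj
        have hj' : j.val ≠ m + 1 := hj
        unfold barsOf
        rw [hρv]
        split_ifs with h1
        · exact (hget1 _ h1).symm
        · rw [← hget2 _ (by omega)]
          congr 1; omega
      mem := by
        intro k
        change (σ k).val ≠ m + 1
        rw [hσv]; split_ifs <;> omega
      right_inv := by
        intro k
        apply ZMod.val_injective N
        rw [hρv, hσv]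
        split_ifs <;> omega
      left_inv := by
        intro j hj
        have hj' : j.val ≠ m + 1 := hj
        apply ZMod.val_injective M
        rw [hσv, hρv]
        split_ifs <;> omega }
  have h0 := h.sameLoops 0
  have : ρ 0 = 0 := by
    apply ZMod.val_injective N
    rw [hρv]; simp
  rwa [this] at h0

/-- All empty times can be removed. -/
theorem sameLoops_reduce (P Q : List (Option ℤ)) {M N : ℕ} [NeZero M] [NeZero N]
    (hM : M = P.length + Q.length + 1) (hN : N = P.length + Q.reduceOption.length + 1) :
    SameLoops (barsOf M (P ++ Q)) 0 (barsOf N (P ++ Q.reduceOption.map some)) 0 := by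
  induction Q generalizing P M with
  | nil =>
    obtain rfl : M = N := by rw [hM, hN]; rfl
    exact fun ℓ => ⟨rfl, fun x => Iff.rfl⟩
  | cons o Q ih =>
    cases o with
    | none =>
      rw [List.reduceOption_cons_of_none] at *
      have : NeZero (P.length + Q.length + 1) := ⟨by omega⟩
      exact (sameLoops_delete (by rw [hM, List.length_cons]; ring) rfl).trans (ih P rfl hN)
    | some y =>
      rw [List.reduceOption_cons_of_some] at *
      have := ih (P ++ [some y]) (M := M) (by rw [hM]; simp; ring) (by rw [hN]; simp; ring)
      simpa using this

end collapse

/-! ### Sums over sparse words -/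

section words

variable {X : Type*}

/-- The lists of `N` elements of a finite set. -/
def listsOf (A : Finset X) : ℕ → Finset (List X)
  | 0 => {[]}
  | N + 1 => (A ×ˢ listsOf A N).image (fun p => p.1 :: p.2)

theorem mem_listsOf {A : Finset X} {N : ℕ} {l : List X} :
    l ∈ listsOf A N ↔ l.length = N ∧ ∀ a ∈ l, a ∈ A := by
  induction N generalizing l with
  | zero =>
    simp only [listsOf, Finset.mem_singleton, List.length_eq_zero_iff]
    constructor
    · rintro rfl; simp
    · exact fun h => h.1
  | succ N ih =>
    simp only [listsOf, Finset.mem_image, Finset.mem_product, Prod.exists]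
    constructor
    · rintro ⟨a, l, ⟨h1, h2⟩, rfl⟩
      have := ih.1 h2
      simp [this.1, h1]
      exact this.2
    · rintro ⟨h1, h2⟩
      cases l with
      | nil => simp at h1
      | cons a l =>
        exact ⟨a, l, ⟨h2 a (by simp), ih.2 ⟨by simpa using h1, fun b hb => h2 b (by simp [hb])⟩⟩,
          rfl⟩

theorem sum_listsOf_succ (A : Finset X) (N : ℕ) (φ : List X → ℝ) :
    ∑ l ∈ listsOf A (N + 1), φ l = ∑ a ∈ A, ∑ l ∈ listsOf A N, φ (a :: l) := by
  rw [listsOf, Finset.sum_image, Finset.sum_product]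
  rintro ⟨a, l⟩ - ⟨b, l'⟩ - h
  simp only [List.cons.injEq] at h
  exact Prod.ext h.1 h.2

theorem sum_listsOf_add (A : Finset X) (N N' : ℕ) (φ : List X → ℝ) :
    ∑ l ∈ listsOf A (N + N'), φ l = ∑ l ∈ listsOf A N, ∑ l' ∈ listsOf A N', φ (l ++ l') := by
  induction N generalizing φ with
  | zero => simp [listsOf]
  | succ N ih =>
    rw [Nat.add_right_comm, sum_listsOf_succ, sum_listsOf_succ]
    refine Finset.sum_congr rfl fun a _ => ?_
    rw [ih]
    rfl

theorem card_listsOf (A : Finset X) (N : ℕ) : (listsOf A N).card = A.card ^ N := by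
  induction N with
  | zero => rfl
  | succ N ih =>
    rw [listsOf, Finset.card_image_of_injective, Finset.card_product, ih, pow_succ']
    rintro ⟨a, l⟩ ⟨b, l'⟩ h
    simp only [List.cons.injEq] at h
    exact Prod.ext h.1 h.2

theorem sum_choose_succ (T : ℕ → ℝ) (N : ℕ) :
    ∑ m ∈ Finset.range (N + 1 + 1), ((N + 1).choose m : ℝ) * T m =
      ∑ m ∈ Finset.range (N + 1), (N.choose m : ℝ) * T m +
        ∑ m ∈ Finset.range (N + 1), (N.choose m : ℝ) * T (m + 1) := by
  rw [Finset.sum_range_succ' _ (N + 1)]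
  simp only [Nat.choose_succ_succ, Nat.cast_add, add_mul, Finset.sum_add_distrib]
  rw [Finset.sum_range_succ' (fun m => (N.choose m : ℝ) * T m) N,
    Finset.sum_range_succ (fun m => (N.choose (m + 1) : ℝ) * T (m + 1)) N, Nat.choose_succ_self]
  simp
  ring

/-- A word `w` is read in `N.choose w.length` ways from `N` entries, some of them empty. -/
theorem sum_reduceOption (A : Finset X) (N : ℕ) (φ : List X → ℝ) :
    ∑ l ∈ listsOf (Finset.insertNone A) N, φ l.reduceOption =
      ∑ m ∈ Finset.range (N + 1), (N.choose m : ℝ) * ∑ w ∈ listsOf A m, φ w := by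
  induction N generalizing φ with
  | zero => simp [listsOf]
  | succ N ih =>
    rw [sum_listsOf_succ, Finset.sum_insertNone]
    simp only [List.reduceOption_cons_of_none, List.reduceOption_cons_of_some]
    have h2 : ∑ a ∈ A, ∑ l ∈ listsOf (Finset.insertNone A) N, φ (a :: l.reduceOption) =
        ∑ m ∈ Finset.range (N + 1), (N.choose m : ℝ) * ∑ w ∈ listsOf A (m + 1), φ w := by
      simp only [sum_listsOf_succ]
      rw [Finset.sum_congr rfl fun a _ => ih (fun w => φ (a :: w)), Finset.sum_comm]
      simp only [Finset.mul_sum]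
    rw [ih φ, h2, sum_choose_succ (fun m => ∑ w ∈ listsOf A m, φ w)]

end words

theorem tendsto_choose_div {N : ℕ → ℕ} {a : ℝ}
    (hN : Tendsto (fun n => (N n : ℝ) / n) atTop (𝓝 a)) (m : ℕ) :
    Tendsto (fun n => ((N n).choose m : ℝ) * (1 / (n : ℝ)) ^ m) atTop
      (𝓝 (a ^ m / m.factorial)) := by
  have h1 : ∀ i : ℕ, Tendsto (fun n => ((N n - i : ℕ) : ℝ) / n) atTop (𝓝 a) := by
    intro i
    have h2 : Tendsto (fun n : ℕ => (N n : ℝ) / n - i / n) atTop (𝓝 a) := by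
      simpa using hN.sub (tendsto_const_div_atTop_nhds_zero_nat (i : ℝ))
    refine tendsto_of_tendsto_of_tendsto_of_le_of_le h2 hN (fun n => ?_) (fun n => ?_)
    · simp only
      rw [← sub_div]
      refine div_le_div_of_nonneg_right ?_ (Nat.cast_nonneg n)
      rw [sub_le_iff_le_add]
      exact_mod_cast (by omega : N n ≤ N n - i + i)
    · refine div_le_div_of_nonneg_right ?_ (Nat.cast_nonneg n)
      exact Nat.cast_le.2 (Nat.sub_le _ _)
  have h3 : Tendsto (fun n => ∏ i ∈ Finset.range m, ((N n - i : ℕ) : ℝ) / n) atTop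
      (𝓝 (∏ _i ∈ Finset.range m, a)) := tendsto_finsetProd _ fun i _ => h1 i
  rw [Finset.prod_const, Finset.card_range] at h3
  refine (h3.div_const (m.factorial : ℝ)).congr fun n => ?_
  rw [Nat.choose_eq_descFactorial_div_factorial,
    Nat.cast_div (Nat.factorial_dvd_descFactorial _ _) (by exact_mod_cast m.factorial_ne_zero),
    Nat.descFactorial_eq_prod_range, Finset.prod_div_distrib, Finset.prod_const,
    Finset.card_range, one_div, inv_pow]
  push_cast
  rw [div_mul_eq_mul_div, div_eq_mul_inv (∏ i ∈ Finset.range m, ((N n - i : ℕ) : ℝ))]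

theorem choose_mul_le {N n b : ℕ} (hN : N ≤ b * n) (m : ℕ) :
    (N.choose m : ℝ) * (1 / (n : ℝ)) ^ m ≤ (b : ℝ) ^ m / m.factorial := by
  have h1 : (N : ℝ) * (1 / n) ≤ b := by
    rcases Nat.eq_zero_or_pos n with rfl | hn
    · simp
    · rw [mul_one_div, div_le_iff₀ (by positivity)]; exact_mod_cast hN
  calc (N.choose m : ℝ) * (1 / (n : ℝ)) ^ m ≤ ((N : ℝ) ^ m / m.factorial) * (1 / (n : ℝ)) ^ m :=
        mul_le_mul_of_nonneg_right (Nat.choose_le_pow_div m N) (by positivity)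
    _ = ((N : ℝ) * (1 / n)) ^ m / m.factorial := by rw [mul_pow]; ring
    _ ≤ _ := by gcongr

/-- The sum over the words with letters in `E` that are read from a segment with `N` times, with a
factor `1/n` for each letter. -/
def segmentSum (E : Finset ℤ) (N n : ℕ) (H : List ℤ → ℝ) : ℝ :=
  ∑ X ∈ listsOf (Finset.insertNone E) N, (1 / (n : ℝ)) ^ X.reduceOption.length * H X.reduceOption

/-- The limit of `segmentSum` when the length of the segment is proportional to `n`. -/
def segmentLimit (E : Finset ℤ) (a : ℝ) (H : List ℤ → ℝ) : ℝ :=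
  ∑' m : ℕ, a ^ m / m.factorial * ∑ w ∈ listsOf E m, H w

section segment

variable {E : Finset ℤ} {C : ℝ}

theorem abs_sum_listsOf_le {H : List ℤ → ℝ} (hH : ∀ w, |H w| ≤ C) (m : ℕ) :
    |∑ w ∈ listsOf E m, H w| ≤ (E.card : ℝ) ^ m * C := by
  refine (Finset.abs_sum_le_sum_abs _ _).trans ?_
  refine (Finset.sum_le_sum fun w _ => hH w).trans_eq ?_
  rw [Finset.sum_const, card_listsOf, nsmul_eq_mul]
  push_cast
  ring

theorem segmentSum_eq (N n : ℕ) (H : List ℤ → ℝ) :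
    segmentSum E N n H =
      ∑' m : ℕ, (N.choose m : ℝ) * (1 / (n : ℝ)) ^ m * ∑ w ∈ listsOf E m, H w := by
  unfold segmentSum
  rw [sum_reduceOption E N (fun w => (1 / (n : ℝ)) ^ w.length * H w), tsum_eq_sum]
  · refine Finset.sum_congr rfl fun m _ => ?_
    rw [mul_assoc, Finset.mul_sum (listsOf E m) H]
    congr 1
    refine Finset.sum_congr rfl fun w hw => ?_
    rw [(mem_listsOf.1 hw).1]
  · intro m hm
    rw [Nat.choose_eq_zero_of_lt (by simpa using hm)]
    simp

theorem abs_segment_term_le {H : List ℤ → ℝ} (hH : ∀ w, |H w| ≤ C) {v b : ℝ} {m : ℕ}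
    (hv0 : 0 ≤ v) (hv : v ≤ b ^ m / m.factorial) :
    |v * ∑ w ∈ listsOf E m, H w| ≤ (b * E.card) ^ m / m.factorial * C := by
  rw [abs_mul, abs_of_nonneg hv0]
  calc _ ≤ b ^ m / m.factorial * ((E.card : ℝ) ^ m * C) :=
        mul_le_mul hv (abs_sum_listsOf_le hH m) (abs_nonneg _) (hv0.trans hv)
    _ = _ := by rw [mul_pow]; ring

theorem summable_segment_bound (y C : ℝ) :
    Summable (fun m : ℕ => y ^ m / m.factorial * C) :=
  (Real.summable_pow_div_factorial y).mul_right C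

theorem abs_segmentSum_le {H : List ℤ → ℝ} (hH : ∀ w, |H w| ≤ C) {N n b : ℕ} (hN : N ≤ b * n) :
    |segmentSum E N n H| ≤ ∑' m : ℕ, ((b : ℝ) * E.card) ^ m / m.factorial * C := by
  rw [segmentSum_eq, ← Real.norm_eq_abs]
  exact tsum_of_norm_bounded (summable_segment_bound _ _).hasSum fun m =>
    abs_segment_term_le hH (by positivity) (choose_mul_le hN m)

/-- Dominated convergence, with the exponential series as a dominating series. -/
theorem tendsto_segmentSum {N : ℕ → ℕ} {a : ℝ} {b : ℕ}
    (hN : Tendsto (fun n => (N n : ℝ) / n) atTop (𝓝 a)) (hb : ∀ n, N n ≤ b * n)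
    {H : ℕ → List ℤ → ℝ} {H' : List ℤ → ℝ} (hH : ∀ n w, |H n w| ≤ C)
    (hlim : ∀ w, Tendsto (fun n => H n w) atTop (𝓝 (H' w))) :
    Tendsto (fun n => segmentSum E (N n) n (H n)) atTop (𝓝 (segmentLimit E a H')) := by
  simp only [segmentSum_eq]
  refine tendsto_tsum_of_dominated_convergence
    (bound := fun m => ((b : ℝ) * E.card) ^ m / m.factorial * C) (summable_segment_bound _ _) ?_ ?_
  · intro m
    exact (tendsto_choose_div hN m).mul (tendsto_finsetSum _ fun w _ => hlim w)
  · refine Eventually.of_forall fun n m => ?_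
    exact abs_segment_term_le (hH n) (by positivity) (choose_mul_le (hb n) m)

theorem le_segmentLimit {a : ℝ} (ha : 0 ≤ a) {H : List ℤ → ℝ} (h0 : ∀ w, 0 ≤ H w)
    (hH : ∀ w, |H w| ≤ C) {m : ℕ} {w : List ℤ} (hw : w ∈ listsOf E m) :
    a ^ m / m.factorial * H w ≤ segmentLimit E a H := by
  have hs : Summable (fun m : ℕ => a ^ m / m.factorial * ∑ w ∈ listsOf E m, H w) :=
    Summable.of_norm_bounded (summable_segment_bound (a * E.card) C) fun m =>
      abs_segment_term_le hH (by positivity) le_rfl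
  refine le_trans ?_ (hs.le_tsum m fun i _ =>
    mul_nonneg (by positivity) (Finset.sum_nonneg fun w _ => h0 w))
  exact mul_le_mul_of_nonneg_left (Finset.single_le_sum (fun w _ => h0 w) hw) (by positivity)

end segment

/-! ### The weights as functions of words -/

/-- The possible places of the double bars. -/
def letters (ℓ : ℕ) : Finset ℤ := Finset.Ico 0 (2 * ℓ - 1)

/-- The configuration with the double bars given by a word, at consecutive times, on the smallest
circle on which there is also a time without double bar. -/
def wordConfig (w : List ℤ) : Bars (w.length + 1) := barsOf (w.length + 1) (w.map some)

/-- The condition on the word that is read in the window. -/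
def WordWindowed (ℓ : ℕ) (w : List ℤ) : Prop :=
  (∀ y : ℤ, 0 ≤ y → y + 1 < 2 * ℓ → Even y → y ∈ w) ∧ ∀ y ∈ w, Even y

/-- The power of `θ` in the weight of a configuration with a given word. -/
def wordWeight (θ : ℝ) (ℓ : ℕ) (w : List ℤ) : ℝ :=
  θ ^ ((loopCount ℓ (wordConfig w) : ℤ) - (w.length : ℤ))

section words

variable {M : ℕ} [NeZero M]

theorem sum_circleConfigs (ℓ : ℕ) (t : ZMod M) (G : Bars M → ℝ) :
    ∑ c ∈ circleConfigs ℓ M t, G c =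
      ∑ X ∈ listsOf (Finset.insertNone (letters ℓ)) (M - 1), G (fun j => barsOf M X (j - t)) := by
  have hM : 0 < M := NeZero.pos M
  have inv : ∀ c ∈ circleConfigs ℓ M t, (fun j => barsOf M (List.ofFn fun i : Fin (M - 1) =>
      c (((i : ℕ) + 1 : ℕ) + t)) (j - t)) = c := by
    intro c hc
    obtain ⟨hc, h0⟩ := mem_circleConfigs.1 hc
    funext j
    have hj : (((j - t).val : ℕ) : ZMod M) + t = j := by rw [ZMod.natCast_zmod_val]; ring
    unfold barsOf
    cases hk : (j - t).val with
    | zero =>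
      rw [hk] at hj
      simp only [Nat.cast_zero, zero_add] at hj
      rw [← hj, h0]; rfl
    | succ k =>
      have hlt : k < M - 1 := by have := ZMod.val_lt (j - t); omega
      rw [List.getD_cons_succ, List.getD_eq_getElem _ _ (by simpa using hlt), List.getElem_ofFn]
      rw [hk] at hj
      simp only
      rw [hj]
  refine Finset.sum_bij'
    (fun c _ => List.ofFn fun i : Fin (M - 1) => c (((i : ℕ) + 1 : ℕ) + t))
    (fun X _ j => barsOf M X (j - t)) ?_ ?_ ?_ ?_ ?_
  · intro c hc
    obtain ⟨hc, h0⟩ := mem_circleConfigs.1 hc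
    refine mem_listsOf.2 ⟨List.length_ofFn, fun o ho => ?_⟩
    obtain ⟨i, rfl⟩ := (List.mem_ofFn' _ _).1 ho
    rw [Finset.mem_insertNone]
    intro y hy
    have := hc _ y hy
    rw [letters, Finset.mem_Ico]; omega
  · intro X hX
    obtain ⟨h1, h2⟩ := mem_listsOf.1 hX
    refine mem_circleConfigs.2 ⟨fun j y hy => ?_, by simp [barsOf]⟩
    simp only [barsOf] at hy
    cases hk : (j - t).val with
    | zero => rw [hk] at hy; simp at hy
    | succ k =>
      rw [hk, List.getD_cons_succ] at hy
      have hlt : k < X.length := by have := ZMod.val_lt (j - t); omega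
      rw [List.getD_eq_getElem _ _ hlt] at hy
      have := h2 _ (List.getElem_mem hlt)
      rw [hy, Finset.some_mem_insertNone, letters, Finset.mem_Ico] at this
      omega
  · exact inv
  · intro X hX
    obtain ⟨h1, h2⟩ := mem_listsOf.1 hX
    refine List.ext_getElem (by simp [h1]) fun i hi hi' => ?_
    rw [List.getElem_ofFn]
    simp only [add_sub_cancel_right]
    unfold barsOf
    rw [ZMod.val_natCast_of_lt (by omega), List.getD_cons_succ, List.getD_eq_getElem _ _ hi']
  · intro c hc
    rw [inv c hc]

theorem card_filter_getD (L : List (Option ℤ)) :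
    ((Finset.range L.length).filter (fun i => L.getD i none ≠ none)).card =
      L.reduceOption.length := by
  simp only [Finset.card_filter]
  induction L with
  | nil => rfl
  | cons o L ih =>
    rw [List.length_cons, Finset.sum_range_succ']
    simp only [List.getD_cons_succ, List.getD_cons_zero]
    rw [ih]
    cases o with
    | none => simp
    | some y => simp

theorem barCount_barsOf {X : List (Option ℤ)} (hX : M = X.length + 1) (t : ZMod M) :
    barCount (fun j => barsOf M X (j - t)) = X.reduceOption.length := by
  have h := card_filter_getD (none :: X)
  rw [List.reduceOption_cons_of_none, List.length_cons, ← hX] at h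
  rw [← h]
  unfold barCount barsOf
  refine Finset.card_nbij' (fun j => (j - t).val) (fun i => (i : ZMod M) + t) ?_ ?_ ?_ ?_
  · intro j hj
    have := (Finset.mem_filter.1 hj).2
    exact Finset.mem_filter.2 ⟨Finset.mem_range.2 (ZMod.val_lt _), this⟩
  · intro i hi
    obtain ⟨h1, h2⟩ := Finset.mem_filter.1 hi
    refine Finset.mem_filter.2 ⟨Finset.mem_univ _, ?_⟩
    simp only [add_sub_cancel_right]
    rw [ZMod.val_natCast_of_lt (Finset.mem_range.1 h1)]
    exact h2
  · intro j _
    simp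
  · intro i hi
    obtain ⟨h1, h2⟩ := Finset.mem_filter.1 hi
    simp only [add_sub_cancel_right]
    exact ZMod.val_natCast_of_lt (Finset.mem_range.1 h1)

theorem sameLoops_wordConfig {X : List (Option ℤ)} (hX : M = X.length + 1) (t : ZMod M) :
    SameLoops (fun j => barsOf M X (j - t)) t (wordConfig X.reduceOption) 0 := by
  refine (sameLoops_rotate (barsOf M X) t).trans ?_
  have := sameLoops_reduce [] X (M := M) (N := X.reduceOption.length + 1) (by simpa using hX)
    (by simp)
  exact this

theorem circleWeight_barsOf (θ : ℝ) (ℓ n : ℕ) {X : List (Option ℤ)} (hX : M = X.length + 1)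
    (t : ZMod M) : circleWeight θ ℓ n (fun j => barsOf M X (j - t)) =
      (1 / (n : ℝ)) ^ X.reduceOption.length * wordWeight θ ℓ X.reduceOption := by
  unfold circleWeight wordWeight
  rw [barCount_barsOf hX, (sameLoops_wordConfig hX t ℓ).1]

theorem wordWeight_nonneg {θ : ℝ} (hθ : 1 ≤ θ) (ℓ : ℕ) (w : List ℤ) : 0 ≤ wordWeight θ ℓ w := by
  unfold wordWeight
  have : 0 ≤ θ := by linarith
  positivity

theorem reduceOption_map_some (w : List ℤ) : (w.map some).reduceOption = w := by
  induction w with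
  | nil => rfl
  | cons y w ih => rw [List.map_cons, List.reduceOption_cons_of_some, ih]

theorem wordWeight_le {θ : ℝ} (hθ : 1 ≤ θ) (ℓ : ℕ) (w : List ℤ) :
    wordWeight θ ℓ w ≤ θ ^ (2 * ℓ) := by
  unfold wordWeight
  rw [← zpow_natCast]
  refine zpow_le_zpow_right₀ hθ ?_
  have h1 := loopCount_le ℓ (wordConfig w)
  have h2 := barCount_barsOf (M := w.length + 1) (X := w.map some) (by simp) 0
  rw [reduceOption_map_some] at h2
  have h4 : barCount (wordConfig w) = w.length := by
    simp only [sub_zero] at h2; exact h2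
  rw [h4] at h1
  push_cast
  omega

/-- The window, seen from the marked time `t`: it is the second of three segments. -/
theorem windowed_barsOf_iff {ℓ n a : ℕ} {X₁ X₂ X₃ : List (Option ℤ)} (hn : n < M)
    (hX : M = X₁.length + X₂.length + X₃.length + 1)
    (ha : a = 0 ∧ X₁.length = 0 ∧ X₂.length = n ∨
      a = X₁.length + 1 ∧ (X₂.length = n + 1 ∨ X₂.length = n ∧ X₃.length = 0)) :
    Windowed ℓ n (fun j : ZMod M => barsOf M (X₁ ++ X₂ ++ X₃) (j - -(a : ZMod M))) ↔
      WordWindowed ℓ X₂.reduceOption := by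
  have key : ∀ y : ℤ, (∃ j : ZMod M, j.val ≤ n ∧
      barsOf M (X₁ ++ X₂ ++ X₃) (j - -(a : ZMod M)) = some y) ↔ y ∈ X₂.reduceOption := by
    intro y
    rw [List.reduceOption_mem_iff]
    constructor
    · rintro ⟨j, hj, hy⟩
      have hcast : j - -(a : ZMod M) = ((j.val + a : ℕ) : ZMod M) := by
        push_cast; rw [ZMod.natCast_zmod_val]; ring
      unfold barsOf at hy
      rw [hcast] at hy
      have hlt : j.val + a < M := by
        by_contra h
        have : j.val + a = M := by omega
        rw [this, ZMod.natCast_self, ZMod.val_zero] at hy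
        simp at hy
      rw [ZMod.val_natCast_of_lt hlt] at hy
      obtain ⟨k, hk⟩ : ∃ k, j.val + a = k + 1 := by
        refine ⟨j.val + a - 1, ?_⟩
        by_contra h
        have : j.val + a = 0 := by omega
        rw [this] at hy
        simp at hy
      rw [hk, List.getD_cons_succ, List.append_assoc,
        List.getD_append_right _ _ _ _ (by omega), List.getD_append _ _ _ _ (by omega),
        List.getD_eq_getElem _ _ (by omega)] at hy
      rw [← hy]
      exact List.getElem_mem _
    · intro hy
      obtain ⟨i, hi, hy⟩ := List.getElem_of_mem hy
      refine ⟨((X₁.length + i + 1 - a : ℕ) : ZMod M), ?_, ?_⟩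
      · rw [ZMod.val_natCast_of_lt (by omega)]; omega
      · have hcast : ((X₁.length + i + 1 - a : ℕ) : ZMod M) - -(a : ZMod M) =
            ((X₁.length + i + 1 : ℕ) : ZMod M) := by
          rw [sub_neg_eq_add, ← Nat.cast_add]; congr 1; omega
        unfold barsOf
        rw [hcast, ZMod.val_natCast_of_lt (by omega), List.getD_cons_succ, List.append_assoc,
          List.getD_append_right _ _ _ _ (by omega), List.getD_append _ _ _ _ (by omega),
          List.getD_eq_getElem _ _ (by omega), ← hy]
        congr 1; omega
  unfold Windowed WordWindowed
  simp only [key]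
  refine and_congr Iff.rfl ⟨fun h y hy => ?_, fun h j y hj hy => h y ((key y).1 ⟨j, hj, hy⟩)⟩
  obtain ⟨j, hj, hjy⟩ := (key y).2 hy
  exact h j y hj hjy

/-- The sum over the words that are read before, in, and after the window. -/
def threeSum (ℓ N₁ N₂ N₃ n : ℕ) (Φ : List ℤ → List ℤ → List ℤ → ℝ) : ℝ :=
  segmentSum (letters ℓ) N₁ n fun w₁ => segmentSum (letters ℓ) N₂ n fun w₂ =>
    segmentSum (letters ℓ) N₃ n fun w₃ => Φ w₁ w₂ w₃

theorem sum_windowConfigs {θ : ℝ} {ℓ n a N₁ N₂ N₃ : ℕ} (hn : n < M) (hM : M = N₁ + N₂ + N₃ + 1)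
    (ha : a = 0 ∧ N₁ = 0 ∧ N₂ = n ∨ a = N₁ + 1 ∧ (N₂ = n + 1 ∨ N₂ = n ∧ N₃ = 0))
    (Q : Bars M → Prop) (q : List ℤ → Prop)
    (hQ : ∀ X : List (Option ℤ), M = X.length + 1 →
      (Q (fun j => barsOf M X (j - -(a : ZMod M))) ↔ q X.reduceOption)) :
    ∑ c ∈ (windowConfigs ℓ n (-(a : ZMod M))).filter Q, circleWeight θ ℓ n c =
      threeSum ℓ N₁ N₂ N₃ n (fun w₁ w₂ w₃ => if WordWindowed ℓ w₂ ∧ q (w₁ ++ w₂ ++ w₃) then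
        wordWeight θ ℓ (w₁ ++ w₂ ++ w₃) else 0) := by
  rw [windowConfigs, Finset.filter_filter, Finset.sum_filter, sum_circleConfigs]
  have e : M - 1 = N₁ + (N₂ + N₃) := by omega
  rw [e, sum_listsOf_add]
  unfold threeSum segmentSum
  refine Finset.sum_congr rfl fun X₁ h₁ => ?_
  rw [sum_listsOf_add, Finset.mul_sum]
  refine Finset.sum_congr rfl fun X₂ h₂ => ?_
  rw [Finset.mul_sum, Finset.mul_sum]
  refine Finset.sum_congr rfl fun X₃ h₃ => ?_
  have l₁ := (mem_listsOf.1 h₁).1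
  have l₂ := (mem_listsOf.1 h₂).1
  have l₃ := (mem_listsOf.1 h₃).1
  rw [← List.append_assoc]
  have hlen : M = (X₁ ++ X₂ ++ X₃).length + 1 := by simp; omega
  rw [windowed_barsOf_iff (X₁ := X₁) (X₂ := X₂) (X₃ := X₃) hn (by omega) (by rw [l₁, l₂, l₃]; exact ha),
    hQ _ hlen, circleWeight_barsOf θ ℓ n hlen]
  simp only [List.reduceOption_append, List.length_append]
  split_ifs
  · rw [pow_add, pow_add]; ring
  · simp

end words

/-! ### The limit `n → ∞` -/

/-- The limit of `threeSum` when the lengths of the segments are proportional to `n`. -/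
def threeLimit (ℓ : ℕ) (a₁ a₂ a₃ : ℝ) (Φ : List ℤ → List ℤ → List ℤ → ℝ) : ℝ :=
  segmentLimit (letters ℓ) a₁ fun w₁ => segmentLimit (letters ℓ) a₂ fun w₂ =>
    segmentLimit (letters ℓ) a₃ fun w₃ => Φ w₁ w₂ w₃

theorem tendsto_threeSum {ℓ : ℕ} {N₁ N₂ N₃ : ℕ → ℕ} {a₁ a₂ a₃ : ℝ} {b : ℕ}
    (h₁ : Tendsto (fun n => (N₁ n : ℝ) / n) atTop (𝓝 a₁))
    (h₂ : Tendsto (fun n => (N₂ n : ℝ) / n) atTop (𝓝 a₂))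
    (h₃ : Tendsto (fun n => (N₃ n : ℝ) / n) atTop (𝓝 a₃)) (hb₁ : ∀ n, N₁ n ≤ b * n)
    (hb₂ : ∀ n, N₂ n ≤ b * n) (hb₃ : ∀ n, N₃ n ≤ b * n) {C : ℝ}
    {Φ : List ℤ → List ℤ → List ℤ → ℝ} (hΦ : ∀ w₁ w₂ w₃, |Φ w₁ w₂ w₃| ≤ C) :
    Tendsto (fun n => threeSum ℓ (N₁ n) (N₂ n) (N₃ n) n Φ) atTop
      (𝓝 (threeLimit ℓ a₁ a₂ a₃ Φ)) :=
  tendsto_segmentSum h₁ hb₁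
    (fun n w₁ => abs_segmentSum_le (fun w₂ => abs_segmentSum_le (hΦ w₁ w₂) (hb₃ n)) (hb₂ n))
    fun w₁ => tendsto_segmentSum h₂ hb₂ (fun n w₂ => abs_segmentSum_le (hΦ w₁ w₂) (hb₃ n))
      fun w₂ => tendsto_segmentSum h₃ hb₃ (fun _ => hΦ w₁ w₂) fun _ => tendsto_const_nhds

theorem segmentLimit_nonneg {E : Finset ℤ} {a : ℝ} (ha : 0 ≤ a) {H : List ℤ → ℝ}
    (h0 : ∀ w, 0 ≤ H w) : 0 ≤ segmentLimit E a H :=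
  tsum_nonneg fun _ => mul_nonneg (by positivity) (Finset.sum_nonneg fun w _ => h0 w)

theorem abs_segmentLimit_le {E : Finset ℤ} {a C : ℝ} (ha : 0 ≤ a) {H : List ℤ → ℝ}
    (hH : ∀ w, |H w| ≤ C) :
    |segmentLimit E a H| ≤ ∑' m : ℕ, (a * E.card) ^ m / m.factorial * C := by
  rw [← Real.norm_eq_abs]
  exact tsum_of_norm_bounded (summable_segment_bound _ _).hasSum fun m =>
    abs_segment_term_le hH (by positivity) le_rfl

/-- A single term of the limit, for two empty words and a word `w`, bounds it from below. -/
theorem le_threeLimit {ℓ : ℕ} {a₁ a₂ a₃ : ℝ} (h₁ : 0 ≤ a₁) (h₂ : 0 ≤ a₂) (h₃ : 0 ≤ a₃) {C : ℝ}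
    {Φ : List ℤ → List ℤ → List ℤ → ℝ} (h0 : ∀ w₁ w₂ w₃, 0 ≤ Φ w₁ w₂ w₃)
    (hΦ : ∀ w₁ w₂ w₃, |Φ w₁ w₂ w₃| ≤ C) {m : ℕ} {w : List ℤ} (hw : w ∈ listsOf (letters ℓ) m) :
    a₂ ^ m / m.factorial * Φ [] w [] ≤ threeLimit ℓ a₁ a₂ a₃ Φ := by
  have hnil : ([] : List ℤ) ∈ listsOf (letters ℓ) 0 := by simp [listsOf]
  have s₃ := le_segmentLimit h₃ (fun w₃ => h0 [] w w₃) (hΦ [] w) hnil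
  have s₂ := le_segmentLimit h₂ (fun w₂ => segmentLimit_nonneg (E := letters ℓ) h₃ (fun w₃ => h0 [] w₂ w₃))
    (fun w₂ => abs_segmentLimit_le h₃ (hΦ [] w₂)) hw
  have s₁ := le_segmentLimit h₁ (fun w₁ => segmentLimit_nonneg h₂ (fun w₂ =>
    segmentLimit_nonneg (E := letters ℓ) h₃ (fun w₃ => h0 w₁ w₂ w₃)))
    (fun w₁ => abs_segmentLimit_le (E := letters ℓ) h₂ (fun w₂ => abs_segmentLimit_le h₃ (hΦ w₁ w₂))) hnil
  simp only [pow_zero, Nat.factorial_zero, Nat.cast_one, div_one, one_mul] at s₃ s₁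
  exact (mul_le_mul_of_nonneg_left s₃ (by positivity)).trans (s₂.trans s₁)

theorem tendsto_mul_sub_one_div (k : ℕ) :
    Tendsto (fun n : ℕ => ((k * n - 1 : ℕ) : ℝ) / n) atTop (𝓝 k) := by
  have h1 : Tendsto (fun n : ℕ => (k : ℝ) - 1 / n) atTop (𝓝 k) := by
    simpa using (tendsto_const_nhds (x := (k : ℝ))).sub (tendsto_const_div_atTop_nhds_zero_nat 1)
  refine tendsto_of_tendsto_of_tendsto_of_le_of_le' h1 tendsto_const_nhds ?_ ?_
  · filter_upwards [eventually_gt_atTop 0] with n hn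
    have hn' : (0 : ℝ) < n := by exact_mod_cast hn
    rw [le_div_iff₀ hn', sub_mul, div_mul_cancel₀ _ hn'.ne', sub_le_iff_le_add]
    exact_mod_cast (by omega : k * n ≤ k * n - 1 + 1)
  · filter_upwards [eventually_gt_atTop 0] with n hn
    have hn' : (0 : ℝ) < n := by exact_mod_cast hn
    rw [div_le_iff₀ hn']
    exact_mod_cast Nat.sub_le _ _

theorem tendsto_middle_div {b k₁ k₃ : ℕ} (hb : b = k₁ + 1 + k₃) :
    Tendsto (fun n : ℕ => ((b * n - 1 - (k₁ * n - 1) - (k₃ * n - 1) : ℕ) : ℝ) / n) atTop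
      (𝓝 1) := by
  have h1 := ((tendsto_mul_sub_one_div b).sub (tendsto_mul_sub_one_div k₁)).sub
    (tendsto_mul_sub_one_div k₃)
  have e : (b : ℝ) - k₁ - k₃ = 1 := by rw [hb]; push_cast; ring
  rw [e] at h1
  refine h1.congr fun n => ?_
  have key : ∀ a p q : ℕ, p + q ≤ a → (a : ℝ) - p - q = ((a - p - q : ℕ) : ℝ) := by
    intro a p q h
    rw [Nat.cast_sub (by omega), Nat.cast_sub (by omega)]
  have hle : (k₁ * n - 1) + (k₃ * n - 1) ≤ b * n - 1 := by
    rw [hb, add_mul, add_mul]; omega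
  rw [← sub_div, ← sub_div, key _ _ _ hle]

section circle

variable {M : ℕ} [NeZero M] {ℓ n : ℕ} {t₀ : ZMod M}

theorem circleWeight_le {θ : ℝ} (hθ : 1 ≤ θ) (ℓ n : ℕ) (c : Bars M) :
    circleWeight θ ℓ n c ≤ θ ^ (2 * ℓ) * (1 / (n : ℝ)) ^ barCount c := by
  unfold circleWeight
  rw [mul_comm]
  refine mul_le_mul_of_nonneg_right ?_ (by positivity)
  rw [← zpow_natCast]
  refine zpow_le_zpow_right₀ hθ ?_
  have := loopCount_le ℓ c
  push_cast
  omega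

/-- The mean number of double bars stays bounded as `n → ∞`. -/
theorem sum_circleWeight_mul_le {θ : ℝ} (hθ : 1 ≤ θ) (hn : 0 < n) {B : ℕ} (hB : M ≤ B * n) :
    ∑ c ∈ circleConfigs ℓ M t₀, circleWeight θ ℓ n c * (barCount c + 1) ≤
      θ ^ (2 * ℓ) * Real.exp (4 * ℓ * B) := by
  set u : ℝ := 1 / n with hu
  have hu0 : 0 < u := by positivity
  have h1 : ∀ c ∈ circleConfigs ℓ M t₀, circleWeight θ ℓ n c * (barCount c + 1) ≤
      θ ^ (2 * ℓ) * (2 * u) ^ barCount c := by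
    intro c _
    have h2 : ((barCount c : ℝ) + 1) ≤ 2 ^ barCount c := by
      exact_mod_cast Nat.lt_two_pow_self (n := barCount c)
    calc _ ≤ (θ ^ (2 * ℓ) * u ^ barCount c) * 2 ^ barCount c :=
          mul_le_mul (circleWeight_le hθ ℓ n c) h2 (by positivity) (by positivity)
      _ = _ := by rw [mul_pow]; ring
  refine (Finset.sum_le_sum h1).trans ?_
  rw [← Finset.mul_sum]
  refine mul_le_mul_of_nonneg_left ?_ (by positivity)
  simp only [pow_barCount]
  unfold circleConfigs
  rw [← Finset.prod_univ_sum (f := fun _ o => if o = none then 1 else 2 * u)]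
  have h3 : ∀ j : ZMod M, ∑ o ∈ (if j = t₀ then {none} else
      Finset.insertNone (Finset.Ico (0 : ℤ) (2 * ℓ - 1))), (if o = none then (1 : ℝ) else 2 * u) ≤
      Real.exp (4 * ℓ * u) := by
    intro j
    have h4 : (1 : ℝ) + 4 * ℓ * u ≤ Real.exp (4 * ℓ * u) := by
      rw [add_comm]; exact Real.add_one_le_exp _
    have h5 : (0 : ℝ) ≤ 4 * ℓ * u := by positivity
    split_ifs
    · simp only [Finset.sum_singleton, if_true]; linarith
    · rw [Finset.sum_insertNone]
      simp only [if_true, reduceCtorEq, if_false, Finset.sum_const, nsmul_eq_mul, Int.card_Ico]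
      have h6 : (((2 * (ℓ : ℤ) - 1 - 0).toNat : ℕ) : ℝ) ≤ 2 * ℓ := by
        exact_mod_cast (by omega : (2 * (ℓ : ℤ) - 1 - 0).toNat ≤ 2 * ℓ)
      nlinarith
  refine (Finset.prod_le_prod (fun j _ => Finset.sum_nonneg fun o _ => ?_) fun j _ => h3 j).trans ?_
  · split_ifs <;> positivity
  · rw [Finset.prod_const, Finset.card_univ, ZMod.card, ← Real.exp_nat_mul]
    apply Real.exp_le_exp.2
    have h7 : (M : ℝ) * u ≤ B := by
      rw [hu, mul_one_div, div_le_iff₀ (by positivity)]; exact_mod_cast hB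
    calc (M : ℝ) * (4 * ℓ * u) = 4 * ℓ * (M * u) := by ring
      _ ≤ 4 * ℓ * B := mul_le_mul_of_nonneg_left h7 (by positivity)

/-- The Peierls bound at finite `n`, with an error that vanishes as `n → ∞`. -/
theorem sum_surrounded_le_add {θ : ℝ} (hθ : 1 ≤ θ) (hn : 0 < n) (hnM : n < M) {B : ℕ}
    (hB : M ≤ B * n) {x : ℤ} (hx : x < 2 * ℓ) {r : ℝ}
    (hr : ∀ H, ∑ h ∈ Finset.Ico 3 H,
      ((∑ d ∈ Finset.range (2 * ℓ), (reachingSeqs (2 * h) d).card : ℕ) : ℝ) * 4 ^ h *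
        (θ ^ (h - 1))⁻¹ ≤ r) :
    ∑ c ∈ (windowConfigs ℓ n t₀).filter (Surrounded ℓ t₀ x), circleWeight θ ℓ n c ≤
    r * ∑ c ∈ windowConfigs ℓ n t₀, circleWeight θ ℓ n c +
      (B * ℓ ^ 2 + 2 * ℓ) * (θ ^ (2 * ℓ) * Real.exp (4 * ℓ * B)) * (1 / n) := by
  have h1 := sum_surrounded_le (t₀ := t₀) hθ hn hnM hB hx hr
  have h2 := sum_circleWeight_mul_le (ℓ := ℓ) (t₀ := t₀) hθ hn hB
  set K : ℝ := B * ℓ ^ 2 + 2 * ℓ with hK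
  have hK0 : 0 ≤ K := by positivity
  have hn0 : (0 : ℝ) ≤ 1 / n := by positivity
  set f : Bars M → ℝ := fun c => circleWeight θ ℓ n c * (barCount c + 1) with hf
  have h3 : ∀ c, circleWeight θ ℓ n c ≤ circleWeight θ ℓ n c *
      Real.exp (-(K * (barCount c + 1) * (1 / n))) + K * (1 / n) * f c := by
    intro c
    have h4 := Real.add_one_le_exp (-(K * (barCount c + 1) * (1 / n)))
    have h5 := mul_le_mul_of_nonneg_left h4 (circleWeight_nonneg hθ ℓ n c)
    simp only [hf]
    nlinarith
  have h6 : ∑ c ∈ (windowConfigs ℓ n t₀).filter (Surrounded ℓ t₀ x), f c ≤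
      ∑ c ∈ circleConfigs ℓ M t₀, f c := by
    refine Finset.sum_le_sum_of_subset_of_nonneg
      ((Finset.filter_subset _ _).trans (Finset.filter_subset _ _)) fun c _ _ => ?_
    exact mul_nonneg (circleWeight_nonneg hθ ℓ n c) (by positivity)
  calc _ ≤ ∑ c ∈ (windowConfigs ℓ n t₀).filter (Surrounded ℓ t₀ x), (circleWeight θ ℓ n c *
      Real.exp (-(K * (barCount c + 1) * (1 / n))) + K * (1 / n) * f c) :=
        Finset.sum_le_sum fun c _ => h3 c
    _ = _ + K * (1 / n) * ∑ c ∈ (windowConfigs ℓ n t₀).filter (Surrounded ℓ t₀ x), f c := by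
        rw [Finset.sum_add_distrib, Finset.mul_sum]
    _ ≤ _ + K * (1 / n) * (θ ^ (2 * ℓ) * Real.exp (4 * ℓ * B)) :=
        add_le_add h1 (mul_le_mul_of_nonneg_left (h6.trans h2) (by positivity))
    _ = _ := by ring

end circle

/-- Every even edge once. -/
def pairWord (ℓ : ℕ) : List ℤ := (List.range ℓ).map fun i : ℕ => 2 * (i : ℤ)

theorem pairWord_mem (ℓ : ℕ) : pairWord ℓ ∈ listsOf (letters ℓ) ℓ := by
  refine mem_listsOf.2 ⟨by simp [pairWord], fun y hy => ?_⟩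
  obtain ⟨i, hi, rfl⟩ := List.mem_map.1 hy
  have := List.mem_range.1 hi
  rw [letters, Finset.mem_Ico]; omega

theorem wordWindowed_pairWord (ℓ : ℕ) : WordWindowed ℓ (pairWord ℓ) := by
  constructor
  · rintro y h0 h1 ⟨k, rfl⟩
    exact List.mem_map.2 ⟨k.toNat, List.mem_range.2 (by omega), by omega⟩
  · intro y hy
    obtain ⟨i, -, rfl⟩ := List.mem_map.1 hy
    exact even_two_mul _

/-- The contribution of three words, read before, in, and after the window, if the event `q` takes
place. -/
def eventWeight (θ : ℝ) (ℓ : ℕ) (q : List ℤ → Prop) (w₁ w₂ w₃ : List ℤ) : ℝ :=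
  if WordWindowed ℓ w₂ ∧ q (w₁ ++ w₂ ++ w₃) then wordWeight θ ℓ (w₁ ++ w₂ ++ w₃) else 0

theorem eventWeight_nonneg {θ : ℝ} (hθ : 1 ≤ θ) (ℓ : ℕ) (q : List ℤ → Prop) (w₁ w₂ w₃ : List ℤ) :
    0 ≤ eventWeight θ ℓ q w₁ w₂ w₃ := by
  unfold eventWeight
  split_ifs
  · exact wordWeight_nonneg hθ ℓ _
  · exact le_rfl

theorem abs_eventWeight_le {θ : ℝ} (hθ : 1 ≤ θ) (ℓ : ℕ) (q : List ℤ → Prop) (w₁ w₂ w₃ : List ℤ) :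
    |eventWeight θ ℓ q w₁ w₂ w₃| ≤ θ ^ (2 * ℓ) := by
  rw [abs_of_nonneg (eventWeight_nonneg hθ ℓ q w₁ w₂ w₃)]
  unfold eventWeight
  split_ifs
  · exact wordWeight_le hθ ℓ _
  · positivity

/-- The sum of the weights, as a function of words, when the circle has length `(A + 1 + k) n` and
the window begins at the distance `A n` from the marked time. -/
def weightSum (θ : ℝ) (ℓ A k : ℕ) (q : List ℤ → Prop) (n : ℕ) : ℝ :=
  threeSum ℓ (A * n - 1) ((A + 1 + k) * n - 1 - (A * n - 1) - (k * n - 1)) (k * n - 1) n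
    (eventWeight θ ℓ q)

theorem tendsto_weightSum {θ : ℝ} (hθ : 1 ≤ θ) (ℓ A k : ℕ) (q : List ℤ → Prop) :
    Tendsto (weightSum θ ℓ A k q) atTop (𝓝 (threeLimit ℓ A 1 k (eventWeight θ ℓ q))) := by
  have h : ∀ n, (A + 1 + k) * n = A * n + n + k * n := fun n => by ring
  exact tendsto_threeSum (b := A + 1 + k) (tendsto_mul_sub_one_div A) (tendsto_middle_div rfl)
    (tendsto_mul_sub_one_div k) (fun n => by rw [h]; omega) (fun n => by omega)
    (fun n => by rw [h]; omega) (abs_eventWeight_le hθ ℓ q)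

theorem sum_eq_weightSum {M : ℕ} [NeZero M] (θ : ℝ) {ℓ n A k : ℕ} (hn : 0 < n) (hAk : 0 < A + k)
    (hM : M = (A + 1 + k) * n) (Q : Bars M → Prop) (q : List ℤ → Prop)
    (hQ : ∀ X : List (Option ℤ), M = X.length + 1 →
      (Q (fun j => barsOf M X (j - -((A * n : ℕ) : ZMod M))) ↔ q X.reduceOption)) :
    ∑ c ∈ (windowConfigs ℓ n (-((A * n : ℕ) : ZMod M))).filter Q, circleWeight θ ℓ n c =
      weightSum θ ℓ A k q n := by
  have h1 : (A + 1 + k) * n = A * n + n + k * n := by ring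
  have h2 : A = 0 ∨ n ≤ A * n := by
    rcases Nat.eq_zero_or_pos A with h | h
    · exact Or.inl h
    · exact Or.inr (Nat.le_mul_of_pos_left n h)
  have h3 : k = 0 ∨ n ≤ k * n := by
    rcases Nat.eq_zero_or_pos k with h | h
    · exact Or.inl h
    · exact Or.inr (Nat.le_mul_of_pos_left n h)
  refine sum_windowConfigs ?_ ?_ ?_ Q q hQ
  · rcases h2 with rfl | h2
    · rcases h3 with rfl | h3
      · omega
      · omega
    · omega
  · omega
  · rw [h1]
    rcases h2 with rfl | h2
    · rcases h3 with rfl | h3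
      · omega
      · rw [zero_mul]; omega
    · rcases h3 with rfl | h3
      · rw [zero_mul]; omega
      · omega

/-- The limits of the sums of weights satisfy the Peierls bound. -/
theorem exists_limits {θ : ℝ} (hθ : 1 ≤ θ) {ℓ A k : ℕ} (hAk : 0 < A + k) {x : ℤ}
    (hx : x < 2 * ℓ) :
    ∃ (Z Y : ℕ → ℝ) (z y : ℝ), 0 < z ∧
      (∀ r : ℝ, (∀ H, ∑ h ∈ Finset.Ico 3 H,
        ((∑ d ∈ Finset.range (2 * ℓ), (reachingSeqs (2 * h) d).card : ℕ) : ℝ) * 4 ^ h *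
          (θ ^ (h - 1))⁻¹ ≤ r) → y ≤ r * z) ∧
      Tendsto Z atTop (𝓝 z) ∧
      Tendsto Y atTop (𝓝 y) ∧ ∀ n, 0 < n → ∀ (M : ℕ) [NeZero M], M = (A + 1 + k) * n →
        ∑ c ∈ windowConfigs ℓ n (-((A * n : ℕ) : ZMod M)), circleWeight θ ℓ n c = Z n ∧
        ∑ c ∈ (windowConfigs ℓ n (-((A * n : ℕ) : ZMod M))).filter
          (Surrounded ℓ (-((A * n : ℕ) : ZMod M)) x), circleWeight θ ℓ n c = Y n := by
  have hsum : ∀ n, 0 < n → ∀ (M : ℕ) [NeZero M], M = (A + 1 + k) * n →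
        ∑ c ∈ windowConfigs ℓ n (-((A * n : ℕ) : ZMod M)), circleWeight θ ℓ n c =
          weightSum θ ℓ A k (fun _ => True) n ∧
        ∑ c ∈ (windowConfigs ℓ n (-((A * n : ℕ) : ZMod M))).filter
          (Surrounded ℓ (-((A * n : ℕ) : ZMod M)) x), circleWeight θ ℓ n c =
          weightSum θ ℓ A k (fun w => Surrounded ℓ 0 x (wordConfig w)) n := by
    intro n hn M _ hM
    refine ⟨?_, sum_eq_weightSum θ hn hAk hM _ _ fun X hX => (sameLoops_wordConfig hX _ ℓ).2 x⟩
    rw [← sum_eq_weightSum θ hn hAk hM (fun _ => True) _ fun _ _ => Iff.rfl, Finset.filter_true]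
  refine ⟨weightSum θ ℓ A k fun _ => True,
    weightSum θ ℓ A k fun w => Surrounded ℓ 0 x (wordConfig w), _, _, ?_, ?_,
    tendsto_weightSum hθ ℓ A k _, tendsto_weightSum hθ ℓ A k _, hsum⟩
  · refine lt_of_lt_of_le ?_ (le_threeLimit (by positivity) zero_le_one (by positivity)
      (eventWeight_nonneg hθ ℓ _) (abs_eventWeight_le hθ ℓ _) (pairWord_mem ℓ))
    unfold eventWeight
    rw [if_pos ⟨wordWindowed_pairWord ℓ, trivial⟩]
    have hθ0 : 0 < θ := by linarith
    unfold wordWeight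
    positivity
  · intro r hr
    set B := A + 1 + k with hB
    refine le_of_tendsto_of_tendsto (tendsto_weightSum hθ ℓ A k _) (b := atTop)
      (g := fun n : ℕ => r * weightSum θ ℓ A k (fun _ => True) n +
          ((B : ℝ) * ℓ ^ 2 + 2 * ℓ) * (θ ^ (2 * ℓ) * Real.exp (4 * ℓ * B)) * (1 / n)) ?_ ?_
    · simpa using ((tendsto_weightSum hθ ℓ A k fun _ => True).const_mul r).add
        ((tendsto_const_div_atTop_nhds_zero_nat (1 : ℝ)).const_mul
          (((B : ℝ) * ℓ ^ 2 + 2 * ℓ) * (θ ^ (2 * ℓ) * Real.exp (4 * ℓ * B))))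
    · filter_upwards [eventually_gt_atTop 0] with n hn
      have h4 : 2 * n ≤ B * n := Nat.mul_le_mul_right n (by omega)
      have hne : NeZero (B * n) := ⟨by omega⟩
      obtain ⟨e1, e2⟩ := hsum n hn (B * n) rfl
      rw [← e1, ← e2]
      exact sum_surrounded_le_add hθ hn (by omega) le_rfl hx hr

/-! ### From the time axis to the circle -/

/-- The time `j`, counted from the beginning `α n` of the window. -/
def toTime (M n : ℕ) (α j : ℤ) : ZMod M := ((j - α * n : ℤ) : ZMod M)

/-- The representative in `[-M/2, M/2)` of a time that is counted from the beginning of the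
window. -/
def ofTime {M : ℕ} (β n : ℕ) (α : ℤ) (t : ZMod M) : ℤ :=
  ((t.val : ℤ) + α * n + β * n) % (M : ℤ) - β * n

/-- The set of double bars that is given by a function of time. -/
def ofBars {M : ℕ} (ℓ β n : ℕ) (α : ℤ) (c : Bars M) : Finset (ℤ × ℤ) :=
  (edges ℓ ×ˢ times β n).filter (fun b => c (toTime M n α b.2) = some (b.1 + ℓ - 1))

/-- The leg on the circle that corresponds to a leg. -/
def toLeg (M ℓ n : ℕ) (α : ℤ) (p : ℤ × ℤ) : ℤ × ZMod M := (p.1 + ℓ - 1, toTime M n α p.2)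

/-- The leg that corresponds to a leg on the circle. -/
def ofLeg {M : ℕ} (ℓ β n : ℕ) (α : ℤ) (p : ℤ × ZMod M) : ℤ × ℤ :=
  (p.1 - ℓ + 1, ofTime β n α p.2)

section bridge

variable {M ℓ β n : ℕ} [NeZero M] {α : ℤ}

theorem mem_times {j : ℤ} : j ∈ times β n ↔ -((β : ℤ) * n) ≤ j ∧ j < (β : ℤ) * n := by
  rw [times, Finset.mem_Ico]

theorem ofTime_mem (hM : M = 2 * β * n) (t : ZMod M) : ofTime β n α t ∈ times β n := by
  have hpos : (0 : ℤ) < M := by exact_mod_cast NeZero.pos M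
  have h1 := Int.emod_nonneg ((t.val : ℤ) + α * n + β * n) hpos.ne'
  have h2 := Int.emod_lt_of_pos ((t.val : ℤ) + α * n + β * n) hpos
  have h3 : (M : ℤ) = 2 * (β * n) := by rw [hM]; push_cast; ring
  rw [mem_times]
  unfold ofTime
  omega

theorem toTime_ofTime (t : ZMod M) : toTime M n α (ofTime β n α t) = t := by
  unfold toTime ofTime
  push_cast
  rw [ZMod.natCast_zmod_val]
  ring

theorem toTime_eq_iff {j j' : ℤ} : toTime M n α j = toTime M n α j' ↔ (M : ℤ) ∣ j' - j := by
  unfold toTime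
  rw [ZMod.intCast_eq_intCast_iff_dvd_sub]
  ring_nf

theorem toTime_injOn (hM : M = 2 * β * n) {j j' : ℤ} (hj : j ∈ times β n) (hj' : j' ∈ times β n)
    (h : toTime M n α j = toTime M n α j') : j = j' := by
  have h1 := toTime_eq_iff.1 h
  have h3 : (M : ℤ) = 2 * (β * n) := by rw [hM]; push_cast; ring
  rw [mem_times] at hj hj'
  have h4 := Int.eq_zero_of_abs_lt_dvd h1 (by rw [abs_lt]; omega)
  omega

theorem ofTime_toTime (hM : M = 2 * β * n) {j : ℤ} (hj : j ∈ times β n) :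
    ofTime β n α (toTime M n α j) = j :=
  toTime_injOn (α := α) hM (ofTime_mem hM _) hj (toTime_ofTime _)

theorem succTime_mem {j : ℤ} (hj : j ∈ times β n) : succTime β n j ∈ times β n := by
  rw [mem_times] at *
  unfold succTime
  split_ifs <;> omega

theorem toTime_succTime (hM : M = 2 * β * n) (j : ℤ) :
    toTime M n α (succTime β n j) = toTime M n α j + 1 := by
  have e : toTime M n α j + 1 = toTime M n α (j + 1) := by
    unfold toTime; push_cast; ring
  rw [e]
  unfold succTime
  split_ifs with h
  · rw [toTime_eq_iff, h, hM]
    exact ⟨1, by push_cast; ring⟩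
  · rfl

variable {c : Bars M}

theorem mem_ofBars (hc : OnChain ℓ c) {x j : ℤ} :
    (x, j) ∈ ofBars ℓ β n α c ↔ j ∈ times β n ∧ c (toTime M n α j) = some (x + ℓ - 1) := by
  unfold ofBars
  rw [Finset.mem_filter, Finset.mem_product]
  simp only
  constructor
  · rintro ⟨⟨-, h1⟩, h2⟩; exact ⟨h1, h2⟩
  · rintro ⟨h1, h2⟩
    have := hc _ _ h2
    refine ⟨⟨?_, h1⟩, h2⟩
    rw [edges, Finset.mem_Icc]; omega

theorem exists_mem_ofBars (hM : M = 2 * β * n) (hc : OnChain ℓ c) {t : ZMod M} {y : ℤ}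
    (h : c t = some y) : (y - ℓ + 1, ofTime β n α t) ∈ ofBars ℓ β n α c := by
  rw [mem_ofBars hc, toTime_ofTime, h]
  exact ⟨ofTime_mem hM t, by congr 1; ring⟩

theorem card_ofBars (hM : M = 2 * β * n) (hc : OnChain ℓ c) :
    (ofBars ℓ β n α c).card = barCount c := by
  unfold barCount
  refine Finset.card_bij (fun b _ => toTime M n α b.2) ?_ ?_ ?_
  · rintro ⟨x, j⟩ hb
    have := ((mem_ofBars hc).1 hb).2
    exact Finset.mem_filter.2 ⟨Finset.mem_univ _, by simp [this]⟩
  · rintro ⟨x, j⟩ hb ⟨x', j'⟩ hb' h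
    have h1 := (mem_ofBars hc).1 hb
    have h2 := (mem_ofBars hc).1 hb'
    simp only at h
    have h3 : j = j' := toTime_injOn hM h1.1 h2.1 h
    subst h3
    have h4 := h1.2.symm.trans h2.2
    simp only [Option.some.injEq] at h4
    have : x = x' := by omega
    rw [this]
  · intro t ht
    obtain ⟨y, hy⟩ := Option.ne_none_iff_exists'.1 (Finset.mem_filter.1 ht).2
    exact ⟨_, exists_mem_ofBars hM hc hy, toTime_ofTime t⟩

theorem ofBars_mem_configs (hc : OnChain ℓ c)
    (h0 : c (toTime M n α 0) = none) : ofBars ℓ β n α c ∈ configs ℓ β n := by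
  unfold configs
  rw [Finset.mem_filter, Finset.mem_powerset]
  refine ⟨Finset.filter_subset _ _, ?_, ?_⟩
  · rintro ⟨x, j⟩ hb hj
    simp only at hj
    have := ((mem_ofBars hc).1 hb).2
    rw [hj, h0] at this
    cases this
  · rintro ⟨x, j⟩ hb ⟨x', j'⟩ hb' h
    simp only at h
    subst h
    have h4 := ((mem_ofBars hc).1 hb).2.symm.trans ((mem_ofBars hc).1 hb').2
    simp only [Option.some.injEq] at h4
    have : x = x' := by omega
    rw [this]

theorem ofBars_injective {c' : Bars M} (hM : M = 2 * β * n) (hc : OnChain ℓ c)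
    (hc' : OnChain ℓ c') (h : ofBars ℓ β n α c = ofBars ℓ β n α c') : c = c' := by
  have key : ∀ {d d' : Bars M}, OnChain ℓ d → OnChain ℓ d' →
      ofBars ℓ β n α d = ofBars ℓ β n α d' → ∀ t y, d t = some y → d' t = some y := by
    intro d d' hd hd' he t y hy
    have h1 := exists_mem_ofBars (α := α) hM hd hy
    rw [he, mem_ofBars hd', toTime_ofTime] at h1
    rw [h1.2]; congr 1; ring
  funext t
  cases hy : c t with
  | some y => exact (key hc hc' h t y hy).symm
  | none =>
    cases hz : c' t with
    | none => rfl
    | some z =>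
      have := key hc' hc h.symm t z hz
      rw [hy] at this; exact this

theorem exists_ofBars_eq (hM : M = 2 * β * n) {ω : Finset (ℤ × ℤ)} (hω : ω ∈ configs ℓ β n) :
    ∃ c ∈ circleConfigs ℓ M (toTime M n α 0), ofBars ℓ β n α c = ω := by
  unfold configs at hω
  rw [Finset.mem_filter, Finset.mem_powerset] at hω
  obtain ⟨hsub, h0, h1⟩ := hω
  have hmem : ∀ b ∈ ω, (-(ℓ : ℤ) + 1 ≤ b.1 ∧ b.1 ≤ (ℓ : ℤ) - 1) ∧ b.2 ∈ times β n := by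
    intro b hb
    have := Finset.mem_product.1 (hsub hb)
    rw [edges, Finset.mem_Icc] at this
    exact this
  have hex : ∀ t : ZMod M, ∃ o : Option ℤ,
      ∀ y, o = some y ↔ (y - ℓ + 1, ofTime β n α t) ∈ ω := by
    intro t
    by_cases h : ∃ y : ℤ, (y - ℓ + 1, ofTime β n α t) ∈ ω
    · obtain ⟨y, hy⟩ := h
      refine ⟨some y, fun z => ⟨?_, fun hz => ?_⟩⟩
      · intro h; rw [← Option.some.inj h]; exact hy
      · have := congrArg Prod.fst (h1 _ hy _ hz rfl)
        simp only at this
        congr 1; omega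
    · exact ⟨none, fun z => ⟨fun h' => (by cases h'), fun hz => absurd ⟨z, hz⟩ h⟩⟩
  choose c hc using hex
  have hc1 : OnChain ℓ c := by
    intro t y hy
    have := (hmem _ ((hc t y).1 hy)).1
    simp only at this
    omega
  refine ⟨c, mem_circleConfigs.2 ⟨hc1, ?_⟩, ?_⟩
  · by_contra h'
    obtain ⟨y, hy⟩ := Option.ne_none_iff_exists'.1 h'
    have h2 := (hc _ y).1 hy
    have h3 : (0 : ℤ) ∈ times β n := by
      have := (hmem _ h2).2
      rw [mem_times] at *
      omega
    rw [ofTime_toTime hM h3] at h2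
    exact h0 _ h2 rfl
  · ext ⟨x, j⟩
    rw [mem_ofBars hc1]
    constructor
    · rintro ⟨h2, h3⟩
      have := (hc _ _).1 h3
      rw [ofTime_toTime hM h2] at this
      convert this using 2; ring
    · intro h
      have h2 := (hmem _ h).2
      refine ⟨h2, (hc _ _).2 ?_⟩
      rw [ofTime_toTime hM h2]
      convert h using 2; ring

/-! ### Loops on the circle -/

theorem mem_legs {p : ℤ × ℤ} : p ∈ legs ℓ β n ↔
    (-(ℓ : ℤ) + 1 ≤ p.1 ∧ p.1 ≤ ℓ) ∧ p.2 ∈ times β n := by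
  rw [legs, Finset.mem_product, sites, Finset.mem_Icc]

theorem toLeg_mem {p : ℤ × ℤ} (hp : p ∈ legs ℓ β n) : toLeg M ℓ n α p ∈ circleLegs ℓ M := by
  rw [mem_legs] at hp
  rw [mem_circleLegs]
  unfold toLeg
  simp only
  omega

theorem ofLeg_mem (hM : M = 2 * β * n) {q : ℤ × ZMod M} (hq : q ∈ circleLegs ℓ M) :
    ofLeg ℓ β n α q ∈ legs ℓ β n := by
  rw [mem_circleLegs] at hq
  rw [mem_legs]
  refine ⟨?_, ofTime_mem hM _⟩
  unfold ofLeg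
  simp only
  omega

theorem toLeg_ofLeg (q : ℤ × ZMod M) : toLeg M ℓ n α (ofLeg ℓ β n α q) = q := by
  unfold toLeg ofLeg
  simp only [toTime_ofTime]
  exact Prod.ext (by simp only; ring) rfl

theorem ofLeg_toLeg (hM : M = 2 * β * n) {p : ℤ × ℤ} (hp : p ∈ legs ℓ β n) :
    ofLeg ℓ β n α (toLeg M ℓ n α p) = p := by
  unfold toLeg ofLeg
  simp only [ofTime_toTime hM (mem_legs.1 hp).2]
  exact Prod.ext (by simp only; ring) rfl

theorem conn_of_reachable (hM : M = 2 * β * n) (hc : OnChain ℓ c) {p q : ℤ × ℤ}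
    (h : (legGraph ℓ β n (ofBars ℓ β n α c)).Reachable p q) :
    Conn c (toLeg M ℓ n α p) (toLeg M ℓ n α q) := by
  have hrel : ∀ p q : ℤ × ℤ, (p ∈ legs ℓ β n ∧ q ∈ legs ℓ β n ∧
    ((q = (p.1, succTime β n p.2) ∧ (p.1, succTime β n p.2) ∉ ofBars ℓ β n α c ∧
      (p.1 - 1, succTime β n p.2) ∉ ofBars ℓ β n α c) ∨
      (q = (p.1 + 1, p.2) ∧ ((p.1, p.2) ∈ ofBars ℓ β n α c ∨
        (p.1, succTime β n p.2) ∈ ofBars ℓ β n α c)))) →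
      Link c (toLeg M ℓ n α p) (toLeg M ℓ n α q) := by
    rintro ⟨x, j⟩ q ⟨hp, -, ⟨rfl, h1, h2⟩ | ⟨rfl, h1⟩⟩
    · have hj := succTime_mem (mem_legs.1 hp).2
      rw [mem_ofBars hc, toTime_succTime hM] at h1 h2
      unfold toLeg
      rw [toTime_succTime hM]
      refine link_up ?_
      rintro (h3 | h3)
      · exact h1 ⟨hj, h3⟩
      · exact h2 ⟨hj, by rw [h3]; congr 1; ring⟩
    · rw [mem_ofBars hc, mem_ofBars hc, toTime_succTime hM] at h1
      refine Or.inr ⟨Prod.ext (by simp only [toLeg]; ring) rfl, ?_⟩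
      exact h1.imp And.right And.right
  obtain ⟨w⟩ := h
  induction w with
  | nil => exact Conn.refl _ _
  | cons hadj _ ih =>
    refine Conn.trans ?_ ih
    rcases hadj.2 with h | h
    · exact (hrel _ _ h).conn
    · exact (hrel _ _ h).conn.symm

theorem reachable_of_conn (hM : M = 2 * β * n) (hc : OnChain ℓ c) {p q : ℤ × ℤ}
    (hp : p ∈ legs ℓ β n) (hq : q ∈ legs ℓ β n)
    (h : Conn c (toLeg M ℓ n α p) (toLeg M ℓ n α q)) :
    (legGraph ℓ β n (ofBars ℓ β n α c)).Reachable p q := by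
  set G := legGraph ℓ β n (ofBars ℓ β n α c) with hG
  set f : ℤ × ZMod M → Option G.ConnectedComponent := fun q =>
    if q ∈ circleLegs ℓ M then some (G.connectedComponentMk (ofLeg ℓ β n α q)) else none with hf
  have hreach : ∀ {q q' : ℤ × ZMod M}, (q ∈ circleLegs ℓ M ↔ q' ∈ circleLegs ℓ M) →
      (q ∈ circleLegs ℓ M → q' ∈ circleLegs ℓ M →
        G.Reachable (ofLeg ℓ β n α q) (ofLeg ℓ β n α q')) → f q = f q' := by
    intro q q' h1 h2
    simp only [hf]
    by_cases h3 : q ∈ circleLegs ℓ M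
    · rw [if_pos h3, if_pos (h1.1 h3)]
      exact congrArg some (SimpleGraph.ConnectedComponent.eq.2 (h2 h3 (h1.1 h3)))
    · rw [if_neg h3, if_neg (fun h4 => h3 (h1.2 h4))]
  have hadj : ∀ {u v : ℤ × ℤ}, u ∈ legs ℓ β n → v ∈ legs ℓ β n →
    ((v = (u.1, succTime β n u.2) ∧ (u.1, succTime β n u.2) ∉ ofBars ℓ β n α c ∧
      (u.1 - 1, succTime β n u.2) ∉ ofBars ℓ β n α c) ∨
      (v = (u.1 + 1, u.2) ∧ ((u.1, u.2) ∈ ofBars ℓ β n α c ∨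
        (u.1, succTime β n u.2) ∈ ofBars ℓ β n α c))) → G.Reachable u v := by
    intro u v hu hv h1
    by_cases huv : u = v
    · rw [huv]
    · exact SimpleGraph.Adj.reachable ⟨huv, Or.inl ⟨hu, hv, h1⟩⟩
  have hsucc : ∀ j : ZMod M, succTime β n (ofTime β n α j) = ofTime β n α (j + 1) := by
    intro j
    refine toTime_injOn (α := α) hM (succTime_mem (ofTime_mem hM _)) (ofTime_mem hM _) ?_
    rw [toTime_succTime hM, toTime_ofTime, toTime_ofTime]
  have hside : ∀ y j t, c t = some y → (t = j ∨ t = j + 1) → f (y, j) = f (y + 1, j) := by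
    intro y j t hy ht
    have h1 := hc _ _ hy
    refine hreach ?_ fun h2 h3 => hadj (ofLeg_mem hM h2) (ofLeg_mem hM h3) (Or.inr ⟨?_, ?_⟩)
    · rw [mem_circleLegs, mem_circleLegs]; simp only; omega
    · exact Prod.ext (by simp only [ofLeg]; ring) rfl
    · have h4 := exists_mem_ofBars (α := α) hM hc hy
      rcases ht with rfl | rfl
      · exact Or.inl h4
      · right
        unfold ofLeg
        simp only
        rw [hsucc]
        exact h4
  have key : f (toLeg M ℓ n α p) = f (toLeg M ℓ n α q) := by
    refine Conn.map_eq f ?_ (fun y j h1 => hside y j _ h1 (Or.inr rfl))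
      (fun y j h1 => hside y j _ h1 (Or.inl rfl)) h
    intro a j h1
    refine hreach (by rw [mem_circleLegs, mem_circleLegs]) fun h2 h3 =>
      hadj (ofLeg_mem hM h2) (ofLeg_mem hM h3) (Or.inl ⟨?_, ?_, ?_⟩)
    · unfold ofLeg; simp only; rw [hsucc]
    · unfold ofLeg; simp only
      rw [hsucc, mem_ofBars hc, toTime_ofTime]
      rintro ⟨-, h4⟩
      exact h1 (Or.inl (by rw [h4]; congr 1; ring))
    · unfold ofLeg; simp only
      rw [hsucc, mem_ofBars hc, toTime_ofTime]
      rintro ⟨-, h4⟩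
      exact h1 (Or.inr (by rw [h4]; congr 1; ring))
  simp only [hf, if_pos (toLeg_mem hp), if_pos (toLeg_mem hq), ofLeg_toLeg hM hp,
    ofLeg_toLeg hM hq] at key
  exact SimpleGraph.ConnectedComponent.eq.1 (Option.some_injective _ key)

theorem reachable_iff (hM : M = 2 * β * n) (hc : OnChain ℓ c) {p q : ℤ × ℤ}
    (hp : p ∈ legs ℓ β n) (hq : q ∈ legs ℓ β n) :
    (legGraph ℓ β n (ofBars ℓ β n α c)).Reachable p q ↔
      Conn c (toLeg M ℓ n α p) (toLeg M ℓ n α q) :=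
  ⟨conn_of_reachable hM hc, reachable_of_conn hM hc hp hq⟩

theorem card_loops (hM : M = 2 * β * n) (hc : OnChain ℓ c) :
    (loops ℓ β n (ofBars ℓ β n α c)).card = loopCount ℓ c := by
  have e : (circleLegs ℓ M).image (loopOf c) =
      (legs ℓ β n).image (fun p => loopOf c (toLeg M ℓ n α p)) := by
    ext z
    simp only [Finset.mem_image]
    constructor
    · rintro ⟨q, hq, rfl⟩; exact ⟨ofLeg ℓ β n α q, ofLeg_mem hM hq, by rw [toLeg_ofLeg]⟩
    · rintro ⟨p, hp, rfl⟩; exact ⟨_, toLeg_mem hp, rfl⟩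
  unfold loops loopCount
  rw [e]
  refine le_antisymm (card_image_le_of_ker _ _ _ ?_) (card_image_le_of_ker _ _ _ ?_)
  · intro p hp q hq h
    have h1 := (reachable_iff hM hc hp hq).2 (loopOf_eq.1 h)
    ext r
    simp only [Finset.mem_filter]
    exact and_congr_right fun _ => ⟨fun h2 => h1.symm.trans h2, fun h2 => h1.trans h2⟩
  · intro p hp q hq h
    have h1 : q ∈ (legs ℓ β n).filter
        (fun r => (legGraph ℓ β n (ofBars ℓ β n α c)).Reachable p r) := by
      rw [h]; exact Finset.mem_filter.2 ⟨hq, SimpleGraph.Reachable.refl _⟩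
    exact loopOf_eq.2 (conn_of_reachable hM hc (Finset.mem_filter.1 h1).2)

theorem weight_ofBars (hM : M = 2 * β * n) (hc : OnChain ℓ c) (S : ℝ) :
    weight S ℓ β n (ofBars ℓ β n α c) = circleWeight (2 * S + 1) ℓ n c := by
  unfold weight circleWeight
  rw [card_loops hM hc, card_ofBars hM hc]

/-! ### Events on the circle -/

theorem mem_window_iff (hM : M = 2 * β * n) (hnM : n < M) {j : ℤ} :
    j ∈ window β n α ↔ j ∈ times β n ∧ (toTime M n α j).val ≤ n := by
  unfold window
  rw [Finset.mem_filter]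
  refine and_congr_right fun _ => ?_
  have hMz : (M : ℤ) = 2 * (β : ℤ) * n := by rw [hM]; push_cast; ring
  constructor
  · rintro ⟨m, h1, h2⟩
    obtain ⟨k, hk⟩ : ∃ k : ℕ, (k : ℤ) = j + 2 * (β : ℤ) * n * m - α * n :=
      ⟨(j + 2 * (β : ℤ) * n * m - α * n).toNat, Int.toNat_of_nonneg (by linarith)⟩
    have hkn : k ≤ n := by
      have : (k : ℤ) ≤ n := by rw [hk]; linarith
      exact_mod_cast this
    have : toTime M n α j = (k : ZMod M) := by
      have e : toTime M n α j = ((k : ℤ) : ZMod M) := by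
        unfold toTime
        rw [ZMod.intCast_eq_intCast_iff_dvd_sub, hk, hMz]
        exact ⟨m, by ring⟩
      rw [e, Int.cast_natCast]
    rw [this, ZMod.val_natCast_of_lt (by omega)]
    exact hkn
  · intro h
    have e : ((j - α * n : ℤ) : ZMod M) = (((toTime M n α j).val : ℤ) : ZMod M) := by
      rw [Int.cast_natCast, ZMod.natCast_zmod_val]; rfl
    rw [ZMod.intCast_eq_intCast_iff_dvd_sub, hMz] at e
    obtain ⟨m, hm⟩ := e
    have h' : ((toTime M n α j).val : ℤ) ≤ n := by exact_mod_cast h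
    have h0 : (0 : ℤ) ≤ (toTime M n α j).val := by positivity
    exact ⟨m, by linarith, by linarith⟩

theorem mem_configsAt_iff (hM : M = 2 * β * n) (hnM : n < M) (hc : OnChain ℓ c)
    (h0 : c (toTime M n α 0) = none) :
    ofBars ℓ β n α c ∈ configsAt ℓ β n α ↔ Windowed ℓ n c := by
  unfold configsAt
  rw [Finset.mem_filter]
  have hedge : ∀ x : ℤ, x ∈ edges₁ ℓ ↔ (0 ≤ x + ℓ - 1 ∧ x + ℓ - 1 + 1 < 2 * ℓ) ∧
      Even (x + ℓ - 1) := by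
    intro x
    rw [edges₁, Finset.mem_filter, edges, Finset.mem_Icc, even_iff_two_dvd]
    have : x - (-(ℓ : ℤ) + 1) = x + ℓ - 1 := by ring
    rw [this]
    refine and_congr_left fun _ => ?_
    omega
  have hedge2 : ∀ x : ℤ, x ∈ edges₂ ℓ ↔ (0 ≤ x + ℓ - 1 ∧ x + ℓ - 1 + 1 < 2 * ℓ) ∧
      ¬ Even (x + ℓ - 1) := by
    intro x
    rw [edges₂, Finset.mem_sdiff, hedge, edges, Finset.mem_Icc]
    constructor
    · rintro ⟨h1, h2⟩
      have : 0 ≤ x + ℓ - 1 ∧ x + ℓ - 1 + 1 < 2 * ℓ := by omega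
      exact ⟨this, fun h3 => h2 ⟨this, h3⟩⟩
    · rintro ⟨h1, h2⟩
      exact ⟨by omega, fun h3 => h2 h3.2⟩
  constructor
  · rintro ⟨-, h1, h2⟩
    refine ⟨fun y hy0 hy1 hye => ?_, fun t y ht hy => ?_⟩
    · have e : y - ℓ + 1 + ℓ - 1 = y := by ring
      obtain ⟨j, hj, hb⟩ := h1 (y - ℓ + 1) ((hedge _).2 (by rw [e]; exact ⟨⟨hy0, hy1⟩, hye⟩))
      rw [mem_ofBars hc, e] at hb
      exact ⟨_, ((mem_window_iff hM hnM).1 hj).2, hb.2⟩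
    · by_contra hne
      have e : y - ℓ + 1 + ℓ - 1 = y := by ring
      refine h2 (y - ℓ + 1) ((hedge2 _).2 (by rw [e]; exact ⟨hc _ _ hy, hne⟩)) (ofTime β n α t)
        ((mem_window_iff hM hnM).2 ⟨ofTime_mem hM t, by rwa [toTime_ofTime]⟩)
        (exists_mem_ofBars hM hc hy)
  · rintro ⟨h1, h2⟩
    refine ⟨ofBars_mem_configs hc h0, fun x hx => ?_, fun x hx j hj hb => ?_⟩
    · obtain ⟨⟨e1, e2⟩, e3⟩ := (hedge x).1 hx
      obtain ⟨t, ht, hy⟩ := h1 _ e1 e2 e3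
      refine ⟨ofTime β n α t,
        (mem_window_iff hM hnM).2 ⟨ofTime_mem hM t, by rwa [toTime_ofTime]⟩, ?_⟩
      rw [mem_ofBars hc, toTime_ofTime]
      exact ⟨ofTime_mem hM t, hy⟩
    · rw [mem_ofBars hc] at hb
      exact ((hedge2 x).1 hx).2 (h2 _ _ ((mem_window_iff hM hnM).1 hj).2 hb.2)

theorem par_eq_card (γ : Set (ℤ × ZMod M)) (a : ℤ) (t : ZMod M) :
    par γ a t = (((Finset.Ico 0 a).filter (fun z => (z, t) ∈ γ)).card : ZMod 2) := by
  unfold par ind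
  rw [Finset.sum_boole]

/-- The loop through the leg `p`. -/
def legLoop (ℓ β n : ℕ) (ω : Finset (ℤ × ℤ)) (p : ℤ × ℤ) : Finset (ℤ × ℤ) :=
  (legs ℓ β n).filter (fun q => (legGraph ℓ β n ω).Reachable p q)

theorem mem_legLoop (hM : M = 2 * β * n) (hc : OnChain ℓ c) {p q : ℤ × ℤ}
    (hp : p ∈ legs ℓ β n) : q ∈ legLoop ℓ β n (ofBars ℓ β n α c) p ↔
      q ∈ legs ℓ β n ∧ toLeg M ℓ n α q ∈ loopSet c (toLeg M ℓ n α p) := by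
  unfold legLoop
  rw [Finset.mem_filter]
  exact and_congr_right fun hq => reachable_iff hM hc hp hq

theorem isLong_legLoop (hM : M = 2 * β * n) (hc : OnChain ℓ c) {p : ℤ × ℤ}
    (hp : p ∈ legs ℓ β n) : IsLong (legLoop ℓ β n (ofBars ℓ β n α c) p) ↔
      LongLoop ℓ c (toLeg M ℓ n α p) := by
  have e : (Finset.Ico (0 : ℤ) (2 * ℓ)).filter (fun a => ∃ j, Conn c (toLeg M ℓ n α p) (a, j)) =
      ((legLoop ℓ β n (ofBars ℓ β n α c) p).image Prod.fst).image (fun x : ℤ => x + (ℓ : ℤ) - 1) := by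
    ext a
    simp only [Finset.mem_filter, Finset.mem_Ico, Finset.mem_image]
    constructor
    · rintro ⟨ha, j, hj⟩
      refine ⟨a - ℓ + 1, ⟨ofLeg ℓ β n α (a, j), (mem_legLoop hM hc hp).2 ⟨?_, ?_⟩, rfl⟩, by ring⟩
      · exact ofLeg_mem hM (mem_circleLegs.2 ha)
      · rw [toLeg_ofLeg]; exact hj
    · rintro ⟨_, ⟨q, hq, rfl⟩, rfl⟩
      obtain ⟨h1, h2⟩ := (mem_legLoop hM hc hp).1 hq
      exact ⟨mem_circleLegs.1 (toLeg_mem (M := M) (α := α) h1), _, h2⟩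
  unfold IsLong LongLoop
  rw [e, Finset.card_image_of_injective _ (f := fun x : ℤ => x + (ℓ : ℤ) - 1)]
  intro x y h
  simp only at h
  omega

theorem isInside_legLoop (hM : M = 2 * β * n) (hc : OnChain ℓ c) {p q : ℤ × ℤ}
    (hp : p ∈ legs ℓ β n) (hq : q ∈ legs ℓ β n) :
    IsInside (legLoop ℓ β n (ofBars ℓ β n α c) p) q ↔
      toLeg M ℓ n α q ∉ loopSet c (toLeg M ℓ n α p) ∧
        par (loopSet c (toLeg M ℓ n α p)) (q.1 + ℓ - 1) (toTime M n α q.2) = 1 := by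
  have e : (Finset.Ico (0 : ℤ) (q.1 + ℓ - 1)).filter
      (fun z => (z, toTime M n α q.2) ∈ loopSet c (toLeg M ℓ n α p)) =
      ((legLoop ℓ β n (ofBars ℓ β n α c) p).filter (fun r => r.2 = q.2 ∧ r.1 < q.1)).image
        (fun r : ℤ × ℤ => r.1 + (ℓ : ℤ) - 1) := by
    have hq' := mem_legs.1 hq
    ext z
    simp only [Finset.mem_filter, Finset.mem_Ico, Finset.mem_image]
    constructor
    · rintro ⟨hz, hz'⟩
      refine ⟨(z - ℓ + 1, q.2), ⟨(mem_legLoop hM hc hp).2 ⟨mem_legs.2 ⟨?_, hq'.2⟩, ?_⟩, rfl, ?_⟩,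
        by ring⟩
      · simp only; omega
      · have : toLeg M ℓ n α (z - ℓ + 1, q.2) = (z, toTime M n α q.2) :=
          Prod.ext (by simp only [toLeg]; ring) rfl
        rw [this]; exact hz'
      · simp only; omega
    · rintro ⟨⟨x, j⟩, ⟨hr, rfl, hlt⟩, rfl⟩
      obtain ⟨h1, h2⟩ := (mem_legLoop hM hc hp).1 hr
      have := mem_legs.1 h1
      simp only at this hlt
      exact ⟨by simp only; omega, h2⟩
  unfold IsInside
  rw [par_eq_card, ZMod.natCast_eq_one_iff_odd, e, Finset.card_image_of_injOn, mem_legLoop hM hc hp]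
  · refine and_congr_left fun _ => ?_
    simp [hq]
  · rintro ⟨x, j⟩ h1 ⟨x', j'⟩ h2 h
    have h1' := (Finset.mem_filter.1 h1).2
    have h2' := (Finset.mem_filter.1 h2).2
    simp only at h h1' h2'
    exact Prod.ext (by simp only; omega) (h1'.1.trans h2'.1.symm)

theorem mem_surrounded_iff (hM : M = 2 * β * n) (hc : OnChain ℓ c)
    (h0 : c (toTime M n α 0) = none) {x : ℤ} (hx : (x, 0) ∈ legs ℓ β n) :
    ofBars ℓ β n α c ∈ surrounded ℓ β n x ↔
      Surrounded ℓ (toTime M n α 0) (x + ℓ - 1) c := by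
  have key : ∀ p ∈ legs ℓ β n, (IsLong (legLoop ℓ β n (ofBars ℓ β n α c) p) ∧
      ((x, 0) ∈ legLoop ℓ β n (ofBars ℓ β n α c) p ∨
        IsInside (legLoop ℓ β n (ofBars ℓ β n α c) p) (x, 0))) ↔
      (LongLoop ℓ c (toLeg M ℓ n α p) ∧
        ((x + ℓ - 1, toTime M n α 0) ∈ loopSet c (toLeg M ℓ n α p) ∨
          (x + ℓ - 1, toTime M n α 0) ∉ loopSet c (toLeg M ℓ n α p) ∧
            par (loopSet c (toLeg M ℓ n α p)) (x + ℓ - 1) (toTime M n α 0) = 1)) := by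
    intro p hp
    rw [isLong_legLoop hM hc hp, isInside_legLoop hM hc hp hx, mem_legLoop hM hc hp]
    simp only [hx, true_and]
    rfl
  unfold surrounded
  rw [Finset.mem_filter]
  unfold loops Surrounded
  constructor
  · rintro ⟨-, γ, hγ, h⟩
    obtain ⟨p, hp, rfl⟩ := Finset.mem_image.1 hγ
    exact ⟨_, toLeg_mem hp, (key p hp).1 h⟩
  · rintro ⟨q, hq, h⟩
    have hp := ofLeg_mem (α := α) hM hq
    refine ⟨ofBars_mem_configs hc h0, _, Finset.mem_image.2 ⟨_, hp, rfl⟩, (key _ hp).2 ?_⟩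
    rw [toLeg_ofLeg]
    exact h

/-- Sums over configurations, as sums over the functions that encode them. -/
theorem sum_weight_eq (hM : M = 2 * β * n) (S : ℝ) {F : Finset (Finset (ℤ × ℤ))}
    (hF : F ⊆ configs ℓ β n) (Q : Bars M → Prop)
    (hFQ : ∀ c, OnChain ℓ c → c (toTime M n α 0) = none → (ofBars ℓ β n α c ∈ F ↔ Q c)) :
    ∑ ω ∈ F, weight S ℓ β n ω =
      ∑ c ∈ (circleConfigs ℓ M (toTime M n α 0)).filter Q, circleWeight (2 * S + 1) ℓ n c := by
  symm
  refine Finset.sum_bij (fun c _ => ofBars ℓ β n α c) ?_ ?_ ?_ ?_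
  · intro c hc
    obtain ⟨h1, h2⟩ := Finset.mem_filter.1 hc
    obtain ⟨h3, h4⟩ := mem_circleConfigs.1 h1
    exact (hFQ c h3 h4).2 h2
  · intro c hc c' hc' h
    exact ofBars_injective hM (mem_circleConfigs.1 (Finset.mem_filter.1 hc).1).1
      (mem_circleConfigs.1 (Finset.mem_filter.1 hc').1).1 h
  · intro ω hω
    obtain ⟨c, hc, rfl⟩ := exists_ofBars_eq (α := α) hM (hF hω)
    obtain ⟨h3, h4⟩ := mem_circleConfigs.1 hc
    exact ⟨c, Finset.mem_filter.2 ⟨hc, (hFQ c h3 h4).1 hω⟩, rfl⟩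
  · intro c hc
    exact (weight_ofBars hM (mem_circleConfigs.1 (Finset.mem_filter.1 hc).1).1 S).symm

end bridge

/-! ### The numerical bound -/

/-- With `s = √θ`, the difference of the two sides for `27 * 4 ^ 3 = 1728` is a quadratic polynomial
in `s`, divided by `s ^ 5`. -/
theorem contour_term_three (D : ℕ) {θ : ℝ} (hθ : 1 ≤ θ) :
    ((∑ d ∈ Finset.range D, (reachingSeqs (2 * 3) d).card : ℕ) : ℝ) * 4 ^ 3 * (θ ^ (3 - 1))⁻¹ ≤
      64 / θ ^ (3 / 2 : ℝ) + 128 / θ ^ 2 +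
        1 / 12 * (((7 : ℕ) + 1) * 4 ^ 7 / θ ^ (((7 : ℕ) : ℝ) / 2 - 1)) := by
  have h1 : ((∑ d ∈ Finset.range D, (reachingSeqs (2 * 3) d).card : ℕ) : ℝ) ≤ 27 := by
    exact_mod_cast (sum_card_reachingSeqs_le 6 D).trans sum_closedSeqs_six.le
  set s := √θ with hs
  have hθ0 : 0 ≤ θ := by linarith
  have hs0 : 0 < s := Real.sqrt_pos.2 (by linarith)
  have e1 : θ = s ^ 2 := (Real.sq_sqrt hθ0).symm
  have e2 : θ ^ (3 / 2 : ℝ) = s ^ 3 := by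
    rw [hs, Real.sqrt_eq_rpow, ← Real.rpow_natCast (θ ^ (1 / 2 : ℝ)), ← Real.rpow_mul hθ0]
    norm_num
  have e3 : θ ^ (((7 : ℕ) : ℝ) / 2 - 1) = s ^ 5 := by
    rw [hs, Real.sqrt_eq_rpow, ← Real.rpow_natCast (θ ^ (1 / 2 : ℝ)), ← Real.rpow_mul hθ0]
    norm_num
  rw [e2, e3, e1]
  refine (mul_le_mul_of_nonneg_right (mul_le_mul_of_nonneg_right h1 (by norm_num))
    (by positivity)).trans ?_
  have e4 : 64 / s ^ 3 + 128 / (s ^ 2) ^ 2 + 1 / 12 * (((7 : ℕ) + 1) * 4 ^ 7 / s ^ 5) -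
      27 * 4 ^ 3 * ((s ^ 2) ^ (3 - 1))⁻¹ =
      (64 * s ^ 2 - 1600 * s + 32768 / 3) / s ^ 5 := by
    field_simp
    push_cast
    ring
  have h2 : 0 ≤ (64 * s ^ 2 - 1600 * s + 32768 / 3) / s ^ 5 := by
    apply div_nonneg _ (by positivity)
    -- The minimum of the quadratic polynomial, at `s = 25 / 2`, is positive.
    nlinarith [sq_nonneg (s - 25 / 2)]
  linarith

/-- The contours with `2 h` turns are bounded by the term `k = 2 h` of the series. -/
theorem contour_term {h : ℕ} (hh : 4 ≤ h) (D : ℕ) {θ : ℝ} (hθ : 1 ≤ θ) :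
    ((∑ d ∈ Finset.range D, (reachingSeqs (2 * h) d).card : ℕ) : ℝ) * 4 ^ h * (θ ^ (h - 1))⁻¹ ≤
      1 / 12 * ((((2 * h : ℕ) : ℝ) + 1) * 4 ^ (2 * h) / θ ^ (((2 * h : ℕ) : ℝ) / 2 - 1)) := by
  have h1 : (12 : ℝ) * ((∑ d ∈ Finset.range D, (reachingSeqs (2 * h) d).card : ℕ) : ℝ) ≤
      (2 * h + 1) * 4 ^ h := by
    exact_mod_cast twelve_mul_sum_card_reachingSeqs_le hh D
  have e1 : θ ^ (((2 * h : ℕ) : ℝ) / 2 - 1) = θ ^ (h - 1) := by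
    rw [← Real.rpow_natCast]
    congr 1
    rw [Nat.cast_sub (by omega)]
    push_cast
    ring
  rw [e1]
  have e2 : 1 / 12 * ((((2 * h : ℕ) : ℝ) + 1) * 4 ^ (2 * h) / θ ^ (h - 1)) =
      ((2 * h + 1) * 4 ^ h / 12) * 4 ^ h * (θ ^ (h - 1))⁻¹ := by
    push_cast
    rw [two_mul h, pow_add]
    ring
  rw [e2]
  have : 0 ≤ θ := by linarith
  refine mul_le_mul_of_nonneg_right (mul_le_mul_of_nonneg_right ?_ (by positivity)) (by positivity)
  linarith

/-- The terms of the series in the final bound. -/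
def seriesTerm (θ : ℝ) (k : ℕ) : ℝ := ((k : ℝ) + 1) * 4 ^ k / θ ^ ((k : ℝ) / 2 - 1)

/-- The terms `h = 3`, `4`, `5`, … are charged to the different indices `7`, `8`, `10`, … of the
series. -/
theorem sum_Ico_three_le {g T : ℕ → ℝ} {a : ℝ} (hg0 : ∀ h, 0 ≤ g h) (hT0 : ∀ k, 0 ≤ T k)
    (h3 : g 3 ≤ a + 1 / 12 * T 7) (h4 : ∀ h, 4 ≤ h → g h ≤ 1 / 12 * T (2 * h)) (H : ℕ) :
    ∑ h ∈ Finset.Ico 3 H, g h ≤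
      a + 1 / 12 * ∑ k ∈ (Finset.range (2 * H + 8)).filter (7 ≤ ·), T k := by
  have e1 : ∑ h ∈ Finset.Ico 3 H, g h ≤ g 3 + ∑ h ∈ Finset.Ico 4 H, g h := by
    rw [← Finset.sum_insert (by simp)]
    refine Finset.sum_le_sum_of_subset_of_nonneg (fun h hh => ?_) fun h _ _ => hg0 h
    rw [Finset.mem_Ico] at hh
    rw [Finset.mem_insert, Finset.mem_Ico]
    omega
  have e2 : ∑ h ∈ Finset.Ico 4 H, g h ≤ 1 / 12 * ∑ h ∈ Finset.Ico 4 H, T (2 * h) := by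
    rw [Finset.mul_sum]
    exact Finset.sum_le_sum fun h hh => h4 h (Finset.mem_Ico.1 hh).1
  have e3 : T 7 + ∑ h ∈ Finset.Ico 4 H, T (2 * h) ≤
      ∑ k ∈ (Finset.range (2 * H + 8)).filter (7 ≤ ·), T k := by
    rw [← Finset.sum_image (g := fun h => 2 * h) (f := T) (fun a _ b _ h => by
      simp only at h; omega), ← Finset.sum_insert]
    · refine Finset.sum_le_sum_of_subset_of_nonneg (fun k hk => ?_) fun k _ _ => hT0 k
      rw [Finset.mem_filter, Finset.mem_range]
      rcases Finset.mem_insert.1 hk with rfl | hk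
      · omega
      · obtain ⟨h, hh, rfl⟩ := Finset.mem_image.1 hk
        rw [Finset.mem_Ico] at hh
        omega
    · intro hk
      obtain ⟨h, -, hh⟩ := Finset.mem_image.1 hk
      omega
  linarith

/-- The sum over contours is bounded by a partial sum of the series. -/
theorem sum_contour_le (D H : ℕ) {θ : ℝ} (hθ : 1 ≤ θ) :
    ∑ h ∈ Finset.Ico 3 H,
      ((∑ d ∈ Finset.range D, (reachingSeqs (2 * h) d).card : ℕ) : ℝ) * 4 ^ h *
        (θ ^ (h - 1))⁻¹ ≤
      64 / θ ^ (3 / 2 : ℝ) + 128 / θ ^ 2 +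
        1 / 12 * ∑ k ∈ (Finset.range (2 * H + 8)).filter (7 ≤ ·), seriesTerm θ k := by
  have hθ0 : 0 ≤ θ := by linarith
  refine sum_Ico_three_le (fun h => ?_) (fun k => ?_) (contour_term_three D hθ)
    (fun h hh => contour_term hh D hθ) H
  · positivity
  · unfold seriesTerm; positivity

theorem sum_contour_le_toReal {θ : ℝ} (hθ : 1 ≤ θ) {R : ENNReal}
    (hR : R = ENNReal.ofReal (64 / θ ^ (3 / 2 : ℝ)) + ENNReal.ofReal (128 / θ ^ 2) +
      (1 / 12) * ∑' k : {k : ℕ // 7 ≤ k}, ENNReal.ofReal (seriesTerm θ k)) (hfin : R ≠ ⊤)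
    (D H : ℕ) :
    ∑ h ∈ Finset.Ico 3 H,
      ((∑ d ∈ Finset.range D, (reachingSeqs (2 * h) d).card : ℕ) : ℝ) * 4 ^ h *
        (θ ^ (h - 1))⁻¹ ≤ R.toReal := by
  refine (sum_contour_le D H hθ).trans ?_
  rw [← ENNReal.ofReal_le_iff_le_toReal hfin, hR]
  have hθ0 : 0 ≤ θ := by linarith
  have hT0 : ∀ k, 0 ≤ seriesTerm θ k := fun k => by unfold seriesTerm; positivity
  have hS0 : 0 ≤ ∑ k ∈ (Finset.range (2 * H + 8)).filter (7 ≤ ·), seriesTerm θ k :=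
    Finset.sum_nonneg fun k _ => hT0 k
  rw [ENNReal.ofReal_add (by positivity) (by positivity),
    ENNReal.ofReal_add (by positivity) (by positivity), ENNReal.ofReal_mul (by norm_num)]
  have e : ENNReal.ofReal (1 / 12) = 1 / 12 := by
    rw [ENNReal.ofReal_div_of_pos (by norm_num)]
    norm_num
  rw [e]
  gcongr
  rw [ENNReal.ofReal_sum_of_nonneg fun k _ => hT0 k, ← Finset.sum_subtype_eq_sum_filter]
  exact ENNReal.sum_le_tsum _

/-! ### Conditional probabilities -/

theorem condProb_eq {S : ℝ} (hS : 0 ≤ S) {ℓ β n : ℕ} (hn : 0 < n)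
    (A B : Finset (Finset (ℤ × ℤ))) :
    condProb S ℓ β n A B =
      (∑ ω ∈ A ∩ B, weight S ℓ β n ω) / ∑ ω ∈ B, weight S ℓ β n ω := by
  have hZ : partitionFunction S ℓ β n ≠ 0 := by
    refine (Finset.sum_pos (fun ω _ => ?_) ⟨∅, ?_⟩).ne'
    · unfold weight; positivity
    · simp [configs]
  unfold condProb prob
  rw [← Finset.sum_div, ← Finset.sum_div, div_div_div_cancel_right₀ hZ]

/-- The conditional probabilities converge, and the limit obeys every bound on the sum over
contours. -/
theorem exists_limit_condProb {S : ℝ} (hS : 0 ≤ S) {ℓ β : ℕ} {α : ℤ} (hβ : 0 < β) {x : ℤ}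
    (hx : x ∈ sites ℓ) :
    ∃ p : ℝ, Tendsto (fun n : ℕ => condProb S ℓ β n (surrounded ℓ β n x) (configsAt ℓ β n α))
      atTop (𝓝 p) ∧ ∀ r : ℝ, (∀ H, ∑ h ∈ Finset.Ico 3 H,
        ((∑ d ∈ Finset.range (2 * ℓ), (reachingSeqs (2 * h) d).card : ℕ) : ℝ) * 4 ^ h *
          ((2 * S + 1) ^ (h - 1))⁻¹ ≤ r) → p ≤ r := by
  rw [sites, Finset.mem_Icc] at hx
  have hmod0 := Int.emod_nonneg α (by omega : (2 * (β : ℤ)) ≠ 0)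
  have hmod1 := Int.emod_lt_of_pos α (by omega : (0 : ℤ) < 2 * β)
  have hmod2 := Int.emod_add_mul_ediv α (2 * (β : ℤ))
  obtain ⟨A, hA⟩ := Int.eq_ofNat_of_zero_le hmod0
  rw [hA] at hmod1 hmod2
  obtain ⟨k, hk⟩ : ∃ k, 2 * β = A + 1 + k := ⟨2 * β - A - 1, by omega⟩
  obtain ⟨Z, Y, z, y, hz, hr, hZ, hY, hsum⟩ := exists_limits (θ := 2 * S + 1) (by linarith)
    (ℓ := ℓ) (A := A) (k := k) (by omega) (x := x + ℓ - 1) (by omega)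
  refine ⟨y / z, (hY.div hZ hz.ne').congr' ?_, fun r h => by rw [div_le_iff₀ hz]; exact hr r h⟩
  filter_upwards [eventually_gt_atTop 0] with n hn
  obtain ⟨M, hM⟩ : ∃ M, M = 2 * β * n := ⟨_, rfl⟩
  have hne : NeZero M := ⟨by rw [hM]; positivity⟩
  have hnM : n < M := by
    have : 2 * n ≤ 2 * β * n := Nat.mul_le_mul_right n (by omega)
    omega
  obtain ⟨h1, h2⟩ := hsum n hn M (by rw [hM, hk])
  have ht : toTime M n α 0 = -((A * n : ℕ) : ZMod M) := by
    have e : -((A * n : ℕ) : ZMod M) = ((-(A * n : ℤ) : ℤ) : ZMod M) := by push_cast; ring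
    rw [e]
    unfold toTime
    rw [ZMod.intCast_eq_intCast_iff_dvd_sub, ← hmod2, hM]
    exact ⟨α / (2 * β), by push_cast; ring⟩
  rw [← ht] at h1 h2
  have hB : configsAt ℓ β n α ⊆ configs ℓ β n := by
    unfold configsAt
    exact Finset.filter_subset _ _
  have hAB : surrounded ℓ β n x ∩ configsAt ℓ β n α ⊆ configs ℓ β n :=
    Finset.inter_subset_right.trans hB
  have hleg : (x, (0 : ℤ)) ∈ legs ℓ β n := by
    rw [mem_legs, mem_times]
    have : (0 : ℤ) < (β : ℤ) * n := by positivity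
    exact ⟨hx, by simp only; omega⟩
  have e1 := sum_weight_eq (α := α) hM S hB (Windowed ℓ n)
    fun c hc h0 => mem_configsAt_iff hM hnM hc h0
  have e2 := sum_weight_eq (α := α) hM S hAB
    (fun c => Windowed ℓ n c ∧ Surrounded ℓ (toTime M n α 0) (x + ℓ - 1) c)
    fun c hc h0 => by
      rw [Finset.mem_inter, and_comm, mem_configsAt_iff hM hnM hc h0,
        mem_surrounded_iff hM hc h0 hleg]
  have e3 : ∑ ω ∈ surrounded ℓ β n x ∩ configsAt ℓ β n α, weight S ℓ β n ω = Y n := by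
    rw [e2, ← h2]
    refine Finset.sum_congr ?_ fun _ _ => rfl
    ext c
    simp only [windowConfigs, Finset.mem_filter, and_assoc]
  rw [condProb_eq hS hn, e1, e3, ← windowConfigs, h1]
  rfl

end SpinLoops

end

theorem mainTheorem4 (S : ℝ) (hS : ∃ m : ℕ, S = (m : ℝ) / 2) (ℓ β : ℕ) (α : ℤ)
    (hα₁ : -(β : ℤ) ≤ α) (hα₂ : α < β) (x : ℤ) (hx : x ∈ SpinLoops.sites ℓ) :
    ∃ p : ℝ,
      Tendsto (fun n : ℕ => SpinLoops.condProb S ℓ β n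
        (SpinLoops.surrounded ℓ β n x) (SpinLoops.configsAt ℓ β n α)) atTop (𝓝 p) ∧
      ENNReal.ofReal p ≤
        ENNReal.ofReal (64 / (2 * S + 1) ^ (3 / 2 : ℝ)) +
        ENNReal.ofReal (128 / (2 * S + 1) ^ 2) +
        (1 / 12) * ∑' k : {k : ℕ // 7 ≤ k},
          ENNReal.ofReal ((((k : ℕ) : ℝ) + 1) * 4 ^ (k : ℕ) /
            (2 * S + 1) ^ (((k : ℕ) : ℝ) / 2 - 1)) := by
  obtain ⟨m, rfl⟩ := hS
  have hS0 : (0 : ℝ) ≤ (m : ℝ) / 2 := by positivity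
  obtain ⟨p, hp, hbound⟩ := SpinLoops.exists_limit_condProb hS0 (ℓ := ℓ) (β := β) (α := α)
    (by omega) hx
  refine ⟨p, hp, ?_⟩
  by_cases hfin : ENNReal.ofReal (64 / (2 * ((m : ℝ) / 2) + 1) ^ (3 / 2 : ℝ)) +
      ENNReal.ofReal (128 / (2 * ((m : ℝ) / 2) + 1) ^ 2) +
      (1 / 12) * ∑' k : {k : ℕ // 7 ≤ k},
        ENNReal.ofReal (SpinLoops.seriesTerm (2 * ((m : ℝ) / 2) + 1) k) = ⊤
  · exact le_of_le_of_eq le_top hfin.symm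
  · exact (ENNReal.ofReal_le_iff_le_toReal hfin).2 (hbound _ fun H =>
      SpinLoops.sum_contour_le_toReal (by linarith) rfl hfin (2 * ℓ) H)
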